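/- **Setting.** Let $\xi$ be a random variable with values in a measurable space $\Xi$, $\mathbf F:\mathbb R^p\times\Xi\to\mathbb R^q$ measurable, $K\in\mathbb R^{q\times n}$ with spectral norm $\|K\|$, and let $\psi:\mathbb R^n\to\mathbb R\cup\{+\infty\}$, $\mathcal R:\mathbb R^p\to\mathbb R\cup\{+\infty\}$ be proper, closed and convex. Put $F(x)=\mathbb E_\xi\mathbf F(x,\xi)$, $\phi_0(u)=\sup_y\{\langle u,Ky\rangle-\psi(y)\}$, $\Psi_0(x)=\phi_0(F(x))+\mathcal R(x)$, and assume $\Psi_0^\star:=\inf_x\Psi_0(x)>-\infty$. Assume that $\mathbf F(\cdot,\xi)$ is differentiable at the points of $\operatorname{dom}\Psi_0$ for every $\xi$, with Jacobian $\mathbf F'(x,\xi)$; put $F'(x)=\mathbb E_\xi\mathbf F'(x,\xi)$. Let $\|\cdot\|$ be the Euclidean norm of vectors and the Frobenius norm of Jacobians. Assume that there are $L_F,M_F,\sigma_F,\sigma_J,M_\psi\in(0,\infty)$ such that for all $x,y\in\operatorname{dom}\Psi_0$: $\mathbb E\|\mathbf F'(x,\xi)-\mathbf F'(y,\xi)\|^2\le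 L_F^2\|x-y\|^2$, $\mathbb E\|\mathbf F(x,\xi)-F(x)\|^2\le\sigma_F^2$, $\mathbb E\|\mathbf F'(x,\xi)-F'(x)\|^2\le\sigma_J^2$, $\mathbb E\|\mathbf F'(x,\xi)\|^2\le M_F^2$; and $\|y\|\le M_\psi$ for all $y\in\operatorname{dom}\psi$. No strong convexity of $\psi$ is assumed, so $\phi_0$ may be nonsmooth. Let $d:\operatorname{dom}\psi\to[0,\infty)$ be continuous and $1$-strongly convex (for instance a continuously differentiable $1$-strongly convex function with minimum $0$), with $B_\psi:=\sup_{\operatorname{dom}\psi}d<\infty$. For $\gamma>0$ let $\phi_\gamma(u)=\max_y\{\langle u,Ky\rangle-\psi(y)-\gamma d(y)\}$ with maximizer $y^*_\gamma(u)$, let $\nabla\Phi_\gamma(x)=F'(x)^\top\nabla\phi_\gamma(F(x))$, and $\mathcal G_\eta(x)=\frac1\eta\big(x-\mathrm{prox}_{\eta\mathcal R}(x-\eta\nabla\Phi_\gamma(x))\big)$. **Parameters.** Let $c_0,c_1>0$, $\gamma\in(0,1]$, $b\ge1$ and $T\ge0$ integers, and $$\hat b_1=\hat b_2=b,\quad b_1=b_2=\tfrac{c_0b}{\gamma^2},\quad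 \hat b_0=c_1^2[b(T+1)]^{1/3},\quad b_0=\tfrac{c_0\hat b_0}{\gamma^2},$$ where the batch sizes actually used are these numbers rounded up to integers. Let $\kappa=1$ if at every iteration the two batches for $F$ are independent and $\kappa=2$ otherwise; define $\hat\kappa$ in the same way with the batches for $F'$. Put $$P=\tfrac{\sqrt{26}\|K\|}{3\sqrt{c_0}}\sqrt{\kappa M_F^4\|K\|^2+c_0\hat\kappa L_F^2M_\psi^2},\qquad Q=\tfrac{26}{9c_0}\|K\|^2\big(\kappa M_F^2\|K\|^2\sigma_F^2+c_0\hat\kappa M_\psi^2\sigma_J^2\big),$$ $$L=L_FM_\psi\|K\|+\tfrac{M_F^2\|K\|^2}{\gamma},\quad \beta=1-\tfrac{b^{1/2}}{[\hat b_0(T+1)]^{1/2}},\quad \theta=\tfrac{L\,b^{3/4}}{P[\hat b_0(T+1)]^{1/4}},\quad \eta=\tfrac{2}{L(3+\theta)}$$ (with the unrounded $\hat b_0$), and assume $\beta,\theta\in(0,1]$. **Algorithm.** Let $x_0\in\operatorname{dom}\Psi_0$, and let $\tilde F_0,\tilde J_0$ be the averages of $\mathbf F(x_0,\cdot),\mathbf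 F'(x_0,\cdot)$ over batches of sizes $b_0,\hat b_0$. For $t=0,\dots,T$ let $v_t=\tilde J_t^\top Ky^*_\gamma(\tilde F_t)$ and $x_{t+1}=(1-\theta)x_t+\theta\,\mathrm{prox}_{\eta\mathcal R}(x_t-\eta v_t)$, where for $t\ge1$ $$\tilde F_t=\beta\tilde F_{t-1}+\tfrac{\beta}{b_1}\sum_{\xi\in\mathcal B^1_t}[\mathbf F(x_t,\xi)-\mathbf F(x_{t-1},\xi)]+\tfrac{1-\beta}{b_2}\sum_{\zeta\in\mathcal B^2_t}\mathbf F(x_t,\zeta),$$ and $\tilde J_t$ is defined in the same way from $\mathbf F'$ and batches $\hat{\mathcal B}^1_t,\hat{\mathcal B}^2_t$ of sizes $\hat b_1,\hat b_2$. Each batch is an i.i.d. sample of $\xi$, and the batches of an iteration are jointly independent of everything drawn before; the four batches of one iteration may be dependent on each other, and so may the two initial ones. The output is $\bar x_T=x_\tau$, with $\tau$ independent of the samples and uniform on $\{0,\dots,T\}$ (probabilities proportional to $\theta/L$). **Claim.** Let $\hat\Delta_0=16\sqrt{c_1}\,P\big(\Psi_0(x_0)-\Psi_0^\star+B_\psi\big)+\frac{24Q}{c_1}$.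 Then $\|\mathcal G_\eta(\bar x_T)\|^2$ is integrable and $$\mathbb E\|\mathcal G_\eta(\bar x_T)\|^2\le\frac{\hat\Delta_0}{[b(T+1)]^{2/3}}.$$ Moreover, for every $\varepsilon>0$: 1. $\mathbb E\|\mathcal G_\eta(\bar x_T)\|^2\le\varepsilon^2$ if $T+1\ge\hat\Delta_0^{3/2}/(b\varepsilon^3)$, in particular if $T=\lfloor\hat\Delta_0^{3/2}/(b\varepsilon^3)\rfloor$. 2. If $T\le\lfloor\hat\Delta_0^{3/2}/(b\varepsilon^3)\rfloor$, the numbers $\mathcal T_F$, $\mathcal T_J$ of evaluations of $\mathbf F$ and of $\mathbf F'$ satisfy $$\mathcal T_F\le\frac{c_0c_1^2\hat\Delta_0^{1/2}}{\gamma^2\varepsilon}+\frac{3c_0\hat\Delta_0^{3/2}}{\gamma^2\varepsilon^3}+\Big(\frac{c_0c_1^2b^{1/3}}{\gamma^2}+3T+1\Big),\qquad \mathcal T_J\le\frac{c_1^2\hat\Delta_0^{1/2}}{\varepsilon}+\frac{3\hat\Delta_0^{3/2}}{\varepsilon^3}+\big(c_1^2b^{1/3}+1\big).$$ The terms in parentheses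 are due to rounding, and can be dropped if the prescribed batch sizes are integers and $T+1=\hat\Delta_0^{3/2}/(b\varepsilon^3)$. If $\gamma=c_2\varepsilon$ with $c_2>0$, the first bound reads $\mathcal T_F\le\frac{c_0c_1^2\hat\Delta_0^{1/2}}{c_2^2\varepsilon^3}+\frac{3c_0\hat\Delta_0^{3/2}}{c_2^2\varepsilon^5}+\big(\frac{c_0c_1^2b^{1/3}}{c_2^2\varepsilon^2}+3T+1\big)$. 3. If $T\le\lfloor\hat\Delta_0^{3/2}/(b\varepsilon^3)\rfloor$, $\varepsilon^2\le\hat\Delta_0$ and $b\varepsilon^3\le\hat\Delta_0^{3/2}$ (that is, for all small $\varepsilon$), then $\mathcal T_F\le C_F\,\hat\Delta_0^{3/2}/(\gamma^2\varepsilon^3)$ and $\mathcal T_J\le C_J\,\hat\Delta_0^{3/2}/\varepsilon^3$ with $C_F=2c_0c_1^2+3c_0+4$ and $C_J=2c_1^2+4$; if moreover $\gamma=c_2\varepsilon$ with $c_2>0$, then $\mathcal T_F\le\frac{C_F}{c_2^2}\hat\Delta_0^{3/2}/\varepsilon^5$. So $\mathcal T_J=O(\hat\Delta_0^{3/2}\varepsilon^{-3})$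 and $\mathcal T_F=O(\hat\Delta_0^{3/2}\varepsilon^{-5})$. -/

import Mathlib

open MeasureTheory ProbabilityTheory

noncomputable section

namespace HybridMinimax

/-- The Euclidean space `ℝ^k`. -/
abbrev E (k : ℕ) : Type := EuclideanSpace ℝ (Fin k)

/-- Proper, closed (lower semicontinuous), convex functions `E k → ℝ ∪ {+∞}`; convexity is
convexity of the epigraph. -/
structure IsProperClosedConvex {k : ℕ} (f : E k → EReal) : Prop where
  ne_bot : ∀ x, f x ≠ ⊥
  exists_ne_top : ∃ x, f x ≠ ⊤
  lsc : LowerSemicontinuous f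
  convex_epigraph : Convex ℝ {z : E k × ℝ | f z.1 ≤ (z.2 : EReal)}

/-- Effective domain of an extended-real-valued function. -/
def effDom {k : ℕ} (f : E k → EReal) : Set (E k) := {x | f x ≠ ⊤}

/-- Squared Frobenius norm of a `q × p` matrix, given as a linear map `ℝ^p → ℝ^q`:
the sum of the squared Euclidean norms of its columns. -/
def frobSq {p q : ℕ} (A : E p →L[ℝ] E q) : ℝ :=
  ∑ j : Fin p, ‖A (EuclideanSpace.single j 1)‖ ^ 2

/-- Proximal operator `prox_{η f}(u) = argmin_z { f z + ‖z - u‖² / (2η) }`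
(the minimizer exists and is unique if `f` is proper, closed and convex and `η > 0`). -/
def prox {k : ℕ} (η : ℝ) (f : E k → EReal) (u : E k) : E k :=
  Classical.epsilon fun z => ∀ w,
    f z + ((‖z - u‖ ^ 2 / (2 * η) : ℝ) : EReal) ≤ f w + ((‖w - u‖ ^ 2 / (2 * η) : ℝ) : EReal)

/-- The data of the problem `min_x max_y { R x + E_ξ ⟪F(x, ξ), K y⟫ - ψ y }`,
together with the function `d` that is used to smooth the inner maximum. -/
structure Problem (p q n : ℕ) (Ξ : Type*) [MeasurableSpace Ξ] where
  /-- the law of the random variable `ξ` -/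
  law : Measure Ξ
  /-- the stochastic vector function `(x, ξ) ↦ F(x, ξ)` -/
  F : E p → Ξ → E q
  /-- the matrix `K`, as a linear map `ℝ^n → ℝ^q`; its norm is the operator norm -/
  K : E n →L[ℝ] E q
  ψ : E n → EReal
  R : E p → EReal
  /-- the smoothing (prox-)function; only its values on the domain of `ψ` matter -/
  d : E n → ℝ

namespace Problem

variable {p q n : ℕ} {Ξ : Type*} [MeasurableSpace Ξ] (D : Problem p q n Ξ)

/-- The Jacobian `F'(x, ξ)` in the variable `x`. -/
def jac (x : E p) (ξ : Ξ) : E p →L[ℝ] E q := fderiv ℝ (fun z => D.F z ξ) x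

/-- The expectation function `F(x) = E_ξ F(x, ξ)`. -/
def meanF (x : E p) : E q := ∫ ξ, D.F x ξ ∂D.law

/-- The Jacobian `F'(x) = E_ξ F'(x, ξ)` of the expectation function. -/
def meanJac (x : E p) : E p →L[ℝ] E q := ∫ ξ, D.jac x ξ ∂D.law

/-- The function maximized over `y` in the definition of `φ_γ(u)`:
`⟪u, K y⟫ - ψ y - γ d y` (it is `-∞` outside the domain of `ψ`). -/
def innerObj (γ : ℝ) (u : E q) (y : E n) : EReal :=
  ((inner ℝ u (D.K y) : ℝ) : EReal) - D.ψ y - ((γ * D.d y : ℝ) : EReal)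

/-- `φ_γ(u) = sup_y { ⟪u, K y⟫ - ψ y - γ d y }`; `γ = 0` gives the unsmoothed `φ₀`. -/
def phi (γ : ℝ) (u : E q) : EReal := ⨆ y, D.innerObj γ u y

/-- The maximizer `y*_γ(u)` in the definition of `φ_γ(u)` (unique for `γ > 0`). -/
def yStar (γ : ℝ) (u : E q) : E n :=
  Classical.epsilon fun y => ∀ w, D.innerObj γ u w ≤ D.innerObj γ u y

/-- The objective `Ψ₀(x) = φ₀(F(x)) + R(x)`. -/
def Psi0 (x : E p) : EReal := D.phi 0 (D.meanF x) + D.R x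

/-- `Ψ₀^⋆ = inf_x Ψ₀(x)`. -/
def Psi0Star : EReal := ⨅ x, D.Psi0 x

/-- `B_ψ = sup { d y | y ∈ dom ψ }`. -/
def Bψ : ℝ := sSup (D.d '' effDom D.ψ)

/-- The gradient `∇Φ_γ(x) = F'(x)ᵀ ∇φ_γ(F(x))` of `Φ_γ = φ_γ ∘ F`. -/
def gradPhi (γ : ℝ) (x : E p) : E p :=
  (ContinuousLinearMap.adjoint (D.meanJac x))
    (gradient (fun u => (D.phi γ u).toReal) (D.meanF x))

/-- The gradient mapping
`G_η(x) = (x - prox_{η R}(x - η ∇Φ_γ(x))) / η`. -/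
def gradMap (γ η : ℝ) (x : E p) : E p :=
  η⁻¹ • (x - prox η D.R (x - η • D.gradPhi γ x))

/-- Standing assumptions on the model. -/
structure Standing : Prop where
  prob : IsProbabilityMeasure D.law
  measurable_F : Measurable (Function.uncurry D.F)
  differentiable_F : ∀ ξ, ∀ x ∈ effDom D.Psi0, DifferentiableAt ℝ (fun z => D.F z ξ) x
  R_pcc : IsProperClosedConvex D.R
  bounded_below : ⊥ < D.Psi0Star

end Problem

/-- The constants of the assumptions. -/
structure Constants where
  LF : ℝ
  MF : ℝ
  σF : ℝ
  σJ : ℝ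
  Mψ : ℝ

namespace Problem

variable {p q n : ℕ} {Ξ : Type*} [MeasurableSpace Ξ] (D : Problem p q n Ξ)

/-- Assumptions on `F`: average smoothness, bounded variances, and bounded second moment of the
Jacobian, on the domain of `Ψ₀`. -/
structure AssumptionF (C : Constants) : Prop where
  LF_pos : 0 < C.LF
  MF_pos : 0 < C.MF
  σF_pos : 0 < C.σF
  σJ_pos : 0 < C.σJ
  smooth : ∀ x ∈ effDom D.Psi0, ∀ y ∈ effDom D.Psi0,
    ∫⁻ ξ, ENNReal.ofReal (frobSq (D.jac x ξ - D.jac y ξ)) ∂D.law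
      ≤ ENNReal.ofReal (C.LF ^ 2 * ‖x - y‖ ^ 2)
  var_F : ∀ x ∈ effDom D.Psi0,
    ∫⁻ ξ, ENNReal.ofReal (‖D.F x ξ - D.meanF x‖ ^ 2) ∂D.law ≤ ENNReal.ofReal (C.σF ^ 2)
  var_J : ∀ x ∈ effDom D.Psi0,
    ∫⁻ ξ, ENNReal.ofReal (frobSq (D.jac x ξ - D.meanJac x)) ∂D.law
      ≤ ENNReal.ofReal (C.σJ ^ 2)
  lipschitz : ∀ x ∈ effDom D.Psi0,
    ∫⁻ ξ, ENNReal.ofReal (frobSq (D.jac x ξ)) ∂D.law ≤ ENNReal.ofReal (C.MF ^ 2)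

/-- Assumptions on `ψ`: proper, closed, convex, with domain bounded by `M_ψ`. -/
structure AssumptionPsi (C : Constants) : Prop where
  Mψ_pos : 0 < C.Mψ
  ψ_pcc : IsProperClosedConvex D.ψ
  bounded : ∀ y ∈ effDom D.ψ, ‖y‖ ≤ C.Mψ

/-- Requirements on the smoothing function `d` on the domain of `ψ`: nonnegative, continuous,
`1`-strongly convex, and `B_ψ < +∞`. Differentiability of `d` and `min d = 0` are not needed. -/
structure AssumptionSmoothing : Prop where
  nonneg : ∀ y ∈ effDom D.ψ, 0 ≤ D.d y
  cont : ContinuousOn D.d (effDom D.ψ)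
  strong : StrongConvexOn (effDom D.ψ) 1 D.d
  bdd : BddAbove (D.d '' effDom D.ψ)

end Problem

/-- The free parameters of the method: smoothness parameter `γ`, constants `c₀, c₁`,
mini-batch size `b` and number of iterations `T`. -/
structure Params where
  γ : ℝ
  c₀ : ℝ
  c₁ : ℝ
  b : ℕ
  T : ℕ

namespace Params

variable (A : Params)

/-- Prescribed value `c₁² [b (T + 1)]^{1/3}` of the initial Jacobian batch size `b̂₀`. -/
def b0hat : ℝ := A.c₁ ^ 2 * ((A.b : ℝ) * (A.T + 1)) ^ (1 / 3 : ℝ)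

/-- Initial Jacobian batch size. Prescribed batch sizes are rounded up to integers. -/
def nJ0 : ℕ := ⌈A.b0hat⌉₊

/-- Initial function batch size, `b₀ = c₀ b̂₀ / γ²`. -/
def nF0 : ℕ := ⌈A.c₀ * A.b0hat / A.γ ^ 2⌉₊

/-- Function batch size at each iteration, `b₁ = b₂ = c₀ b / γ²`. -/
def nF : ℕ := ⌈A.c₀ * A.b / A.γ ^ 2⌉₊

/-- The weight `β = β̂ = 1 - b^{1/2} / [b̂₀ (T + 1)]^{1/2}`. -/
def β : ℝ := 1 - (A.b : ℝ) ^ (1 / 2 : ℝ) / (A.b0hat * (A.T + 1)) ^ (1 / 2 : ℝ)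

end Params

/-- The mini-batches: `F0`, `J0` for the initial estimators of `F` and `F'`, and, for the
iteration `t + 1`, the batches `F1 t`, `F2 t` (sizes `b₁ = b₂`) for the estimator of `F` and
`J1 t`, `J2 t` (sizes `b̂₁ = b̂₂ = b`) for the estimator of the Jacobian. -/
structure Batches (Ω Ξ : Type*) (A : Params) where
  F0 : Ω → Fin A.nF0 → Ξ
  J0 : Ω → Fin A.nJ0 → Ξ
  F1 : ℕ → Ω → Fin A.nF → Ξ
  F2 : ℕ → Ω → Fin A.nF → Ξ
  J1 : ℕ → Ω → Fin A.b → Ξ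
  J2 : ℕ → Ω → Fin A.b → Ξ

namespace Batches

variable {Ω Ξ : Type*} [MeasurableSpace Ω] [MeasurableSpace Ξ] {A : Params}
  (S : Batches Ω Ξ A)

/-- All samples drawn at iteration `t + 1`. -/
def block (t : ℕ) (ω : Ω) :
    (Fin A.nF → Ξ) × (Fin A.nF → Ξ) × (Fin A.b → Ξ) × (Fin A.b → Ξ) :=
  (S.F1 t ω, S.F2 t ω, S.J1 t ω, S.J2 t ω)

/-- All samples drawn at initialization and in the iterations `1, …, t`. -/
def past (t : ℕ) (ω : Ω) :
    ((Fin A.nF0 → Ξ) × (Fin A.nJ0 → Ξ)) ×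
      (Fin t → (Fin A.nF → Ξ) × (Fin A.nF → Ξ) × (Fin A.b → Ξ) × (Fin A.b → Ξ)) :=
  ((S.F0 ω, S.J0 ω), fun s => S.block s ω)

/-- Each mini-batch of the `T` iterations consists of independent samples with the law of `ξ`
(its joint law is the product law), and the samples drawn at an iteration are independent of
those drawn before. Nothing is assumed on the dependence between the four batches of one
iteration, nor between the two initial ones. -/
structure IsSampling (μ : Measure Ω) (law : Measure Ξ) : Prop where
  meas_F0 : Measurable S.F0
  meas_J0 : Measurable S.J0
  meas_block : ∀ t < A.T, Measurable (S.block t)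
  law_F0 : μ.map S.F0 = Measure.pi fun _ => law
  law_J0 : μ.map S.J0 = Measure.pi fun _ => law
  law_F1 : ∀ t < A.T, μ.map (S.F1 t) = Measure.pi fun _ => law
  law_F2 : ∀ t < A.T, μ.map (S.F2 t) = Measure.pi fun _ => law
  law_J1 : ∀ t < A.T, μ.map (S.J1 t) = Measure.pi fun _ => law
  law_J2 : ∀ t < A.T, μ.map (S.J2 t) = Measure.pi fun _ => law
  indep : ∀ t < A.T, IndepFun (S.block t) (S.past t) μ

open Classical in
/-- `κ = 1` if the two function batches of every iteration are independent, `κ = 2` otherwise. -/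
def kappa (μ : Measure Ω) : ℝ :=
  if ∀ t < A.T, IndepFun (S.F1 t) (S.F2 t) μ then 1 else 2

open Classical in
/-- `κ̂ = 1` if the two Jacobian batches of every iteration are independent, `κ̂ = 2`
otherwise. -/
def kappaHat (μ : Measure Ω) : ℝ :=
  if ∀ t < A.T, IndepFun (S.J1 t) (S.J2 t) μ then 1 else 2

end Batches

section constants

variable {p q n : ℕ} {Ξ : Type*} [MeasurableSpace Ξ] (D : Problem p q n Ξ) (C : Constants)
  (A : Params) (κ κh : ℝ)

/-- The constant `P`. -/
def Pconst : ℝ :=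
  Real.sqrt 26 * ‖D.K‖ / (3 * Real.sqrt A.c₀) *
    Real.sqrt (κ * C.MF ^ 4 * ‖D.K‖ ^ 2 + A.c₀ * κh * C.LF ^ 2 * C.Mψ ^ 2)

/-- The constant `Q`. -/
def Qconst : ℝ :=
  26 / (9 * A.c₀) * ‖D.K‖ ^ 2 *
    (κ * C.MF ^ 2 * ‖D.K‖ ^ 2 * C.σF ^ 2 + A.c₀ * κh * C.Mψ ^ 2 * C.σJ ^ 2)

/-- The smoothness constant `L_{Φ_γ} = L_F M_ψ ‖K‖ + M_F² ‖K‖² / γ`. -/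
def LPhi : ℝ := C.LF * C.Mψ * ‖D.K‖ + C.MF ^ 2 * ‖D.K‖ ^ 2 / A.γ

/-- The step-size `θ = L_{Φ_γ} b^{3/4} / (P [b̂₀ (T + 1)]^{1/4})`. -/
def theta : ℝ :=
  LPhi D C A * (A.b : ℝ) ^ (3 / 4 : ℝ) /
    (Pconst D C A κ κh * (A.b0hat * (A.T + 1)) ^ (1 / 4 : ℝ))

/-- The step-size `η = 2 / (L_{Φ_γ} (3 + θ))`. -/
def eta : ℝ := 2 / (LPhi D C A * (3 + theta D C A κ κh))

/-- `Δ̂₀ = 16 √c₁ P (Ψ₀(x₀) - Ψ₀^⋆ + B_ψ) + 24 Q / c₁`. -/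
def DeltaHat (x₀ : E p) : ℝ :=
  16 * Real.sqrt A.c₁ * Pconst D C A κ κh *
      ((D.Psi0 x₀).toReal - D.Psi0Star.toReal + D.Bψ) +
    24 * Qconst D C A κ κh / A.c₁

end constants

/-- State of the algorithm at iteration `t`: the point `x_t` and the estimators of `F(x_t)` and
`F'(x_t)`. -/
structure State (p q : ℕ) where
  x : E p
  Fe : E q
  Je : E p →L[ℝ] E q

section algorithm

variable {p q n : ℕ} {Ξ Ω : Type*} [MeasurableSpace Ξ] (D : Problem p q n Ξ) {A : Params}
  (S : Batches Ω Ξ A) (θ η : ℝ) (x₀ : E p)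

/-- The update of the point: `v = Jᵀ K y*_γ(F)`, `x̂ = prox_{η R}(x - η v)`,
`x⁺ = (1 - θ) x + θ x̂`, where `F`, `J` are the current estimators. -/
def nextPoint (γ : ℝ) (s : State p q) : E p :=
  (1 - θ) • s.x +
    θ • prox η D.R (s.x - η • (ContinuousLinearMap.adjoint s.Je) (D.K (D.yStar γ s.Fe)))

/-- The algorithm, with the hybrid variance-reduced estimators. -/
def run : ℕ → Ω → State p q
  | 0, ω =>
    { x := x₀
      Fe := (A.nF0 : ℝ)⁻¹ • ∑ i, D.F x₀ (S.F0 ω i)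
      Je := (A.nJ0 : ℝ)⁻¹ • ∑ i, D.jac x₀ (S.J0 ω i) }
  | t + 1, ω =>
    let s := run t ω
    let y := nextPoint D θ η A.γ s
    { x := y
      Fe := A.β • s.Fe
        + (A.β / A.nF) • ∑ i, (D.F y (S.F1 t ω i) - D.F s.x (S.F1 t ω i))
        + ((1 - A.β) / A.nF) • ∑ i, D.F y (S.F2 t ω i)
      Je := A.β • s.Je
        + (A.β / A.b) • ∑ i, (D.jac y (S.J1 t ω i) - D.jac s.x (S.J1 t ω i))
        + ((1 - A.β) / A.b) • ∑ i, D.jac y (S.J2 t ω i) }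

/-- The iterate `x_t`. -/
def iterate (t : ℕ) (ω : Ω) : E p := (run D S θ η x₀ t ω).x

/-- The points `(x, ξ)`, with multiplicity, at which the algorithm evaluates `F(x, ξ)` during the
initialization and the iterations `1, …, T`. -/
def queriesF (ω : Ω) : Multiset (E p × Ξ) :=
  Finset.univ.val.map (fun i => (x₀, S.F0 ω i)) +
    ∑ t ∈ Finset.range A.T,
      (Finset.univ.val.map (fun i => (iterate D S θ η x₀ (t + 1) ω, S.F1 t ω i)) +
        Finset.univ.val.map (fun i => (iterate D S θ η x₀ t ω, S.F1 t ω i)) +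
        Finset.univ.val.map (fun i => (iterate D S θ η x₀ (t + 1) ω, S.F2 t ω i)))

/-- The points `(x, ξ)`, with multiplicity, at which the algorithm evaluates the Jacobian
`F'(x, ξ)` during the initialization and the iterations `1, …, T`. -/
def queriesJ (ω : Ω) : Multiset (E p × Ξ) :=
  Finset.univ.val.map (fun i => (x₀, S.J0 ω i)) +
    ∑ t ∈ Finset.range A.T,
      (Finset.univ.val.map (fun i => (iterate D S θ η x₀ (t + 1) ω, S.J1 t ω i)) +
        Finset.univ.val.map (fun i => (iterate D S θ η x₀ t ω, S.J1 t ω i)) +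
        Finset.univ.val.map (fun i => (iterate D S θ η x₀ (t + 1) ω, S.J2 t ω i)))

/-- The random index `τ` of the output `x̄_T = x_τ`: it is independent of all samples and
`Prob (τ = t)` is proportional to `θ_t / L_{Φ_{γ_t}}` for `t = 0, …, T`. -/
structure IsOutputIndex [MeasurableSpace Ω] (μ : Measure Ω) (L : ℝ) (τ : Ω → ℕ) : Prop where
  meas : Measurable τ
  prob : ∀ t ≤ A.T, μ {ω | τ ω = t} =
    ENNReal.ofReal ((θ / L) / ∑ _s ∈ Finset.range (A.T + 1), θ / L)
  indep : IndepFun τ (S.past A.T) μ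

end algorithm

end HybridMinimax

end

/-! Strong convexity of `γ d` gives quadratic growth at the inner maximizer. Hence `y*_γ` is
Lipschitz with constant `‖K‖/γ` (`norm_yStar_sub_le`), and `φ_γ` is differentiable with gradient `K
y*_γ(u)` (`gradient_phi`). Since `φ₀` is finite everywhere, `dom Ψ₀ = dom R` is convex, so segments
between iterates stay where `F(·, ξ)` is differentiable. Integrating the Jacobian along such
segments turns the moment assumptions into a Lipschitz bound and a second-order bound for the mean
function, and these give a quadratic upper bound for `φ_γ ∘ F` with constant `L` (`phi_meanF_le`).

Descent: a damped proximal step lowers `Ψ_γ` by `θ L ‖x̂ - x‖²`, up to `θ/(2L)` times the squared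
error of the gradient estimator (`PsiReal_nextPoint_le`). Summation bounds the total squared step by
the initial gap plus the total error; passing from `Ψ_γ` to `Ψ₀` costs at most `γ B_ψ ≤ B_ψ`. The
squared gradient mapping is at most `8 L² ‖x̂ - x‖²` plus twice the error (`norm_gradMap_sq_le`), so
only the total expected error remains to be controlled.

Variance: with the past frozen, the new estimation error is `β` times the old one plus two centered
batch averages. The mixed terms with the old error integrate to zero, which gives `v (t+1) ≤ β² v t
+ β² a d t + c` for the expected errors `v` and squared steps `d` (`lintegral_hybrid_sq_le`,
`integral_errSq_succ_le`). The factor `γ⁻²` in the error of `F` is cancelled by the batch size `c₀ b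
/ γ²`, which is why neither `P` nor `Q` contains `γ`.

Closing the loop: errors are bounded by steps and steps by errors. Write `y = [b(T+1)]^{1/3}`, `g =
P √c₁ y G / b` with `G` the initial gap, and `q = Q y / (c₁ b)`. For the sums `Sv`, `Sd` of `v`, `d`
over `0, …, T`, the chosen `β` and `θ` give `Sv ≤ (18/13) q + (9/26) L² Sd`, and descent gives `L²
Sd ≤ g + Sv / 2`. The product of the coupling constants is `9/52 < 1`, so the system can be solved.
As `g` and `q` scale like `y / b` while `T + 1 = y³ / b`, the average over the iterations is of
order `y⁻²` (`IsSetup.sum_integral_gradMap_sq_le`). The random index turns this average into an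
expectation (`IsSetup.integral_output`), and the evaluation counts are arithmetic with the batch
sizes. -/

namespace HybridMinimax

/-! ### Proper closed convex functions: semicontinuity, minimizers, lower bounds. -/

section Convex

variable {k : ℕ} {f : E k → EReal}

lemma IsProperClosedConvex.coe_toReal (hf : IsProperClosedConvex f) {x : E k}
    (hx : x ∈ effDom f) : ((f x).toReal : EReal) = f x :=
  EReal.coe_toReal hx (hf.ne_bot x)

lemma IsProperClosedConvex.convexOn (hf : IsProperClosedConvex f) :
    ConvexOn ℝ (effDom f) fun x => (f x).toReal := by
  have key : ∀ x ∈ effDom f, ∀ y ∈ effDom f, ∀ a b : ℝ, 0 ≤ a → 0 ≤ b → a + b = 1 →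
      f (a • x + b • y) ≤ ((a * (f x).toReal + b * (f y).toReal : ℝ) : EReal) := by
    intro x hx y hy a b ha hb hab
    have := hf.convex_epigraph (x := (x, (f x).toReal)) (y := (y, (f y).toReal))
      (by simp [hf.coe_toReal hx]) (by simp [hf.coe_toReal hy]) ha hb hab
    simpa using this
  have hconv : Convex ℝ (effDom f) := by
    intro x hx y hy a b ha hb hab h
    have := key x hx y hy a b ha hb hab
    rw [h] at this
    exact EReal.coe_ne_top _ (top_le_iff.1 this)
  refine ⟨hconv, fun x hx y hy a b ha hb hab => ?_⟩
  have := key x hx y hy a b ha hb hab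
  rw [← hf.coe_toReal (hconv hx hy ha hb hab)] at this
  exact_mod_cast this

lemma IsProperClosedConvex.convex_effDom (hf : IsProperClosedConvex f) :
    Convex ℝ (effDom f) := hf.convexOn.1

lemma IsProperClosedConvex.measurable (hf : IsProperClosedConvex f) : Measurable f :=
  hf.lsc.measurable

lemma IsProperClosedConvex.measurableSet_effDom (hf : IsProperClosedConvex f) :
    MeasurableSet (effDom f) :=
  (hf.measurable (measurableSet_singleton ⊤)).compl

/-- Since `c` is continuous only relative to the domain, points outside need care. At such a point
`f` tends to `⊤`, and the lower bound `m` keeps `c` from compensating. -/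
lemma IsProperClosedConvex.add_lsc (hf : IsProperClosedConvex f) {c : E k → ℝ}
    (hc : ContinuousOn c (effDom f)) {m : ℝ} (hm : ∀ y ∈ effDom f, m ≤ c y) :
    LowerSemicontinuous fun y => f y + (c y : EReal) := by
  intro y₀ r hr
  obtain ⟨s, hrs, hs⟩ := EReal.lt_iff_exists_real_btwn.1 hr
  have htop : ∀ y, y ∉ effDom f → f y + (c y : EReal) = ⊤ := by
    intro y hy
    have : f y = ⊤ := by simpa [effDom] using hy
    rw [this, EReal.top_add_coe]
  suffices h : ∀ᶠ y in nhds y₀, y ∈ effDom f → s < (f y).toReal + c y by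
    filter_upwards [h] with y hy
    refine hrs.trans ?_
    by_cases hyd : y ∈ effDom f
    · rw [← hf.coe_toReal hyd]; exact_mod_cast hy hyd
    · rw [htop y hyd]; exact EReal.coe_lt_top s
  have real_lt : ∀ (t : ℝ) (y), y ∈ effDom f → (t : EReal) < f y → t < (f y).toReal := by
    intro t y hy h
    rw [← hf.coe_toReal hy] at h; exact_mod_cast h
  by_cases hy₀ : y₀ ∈ effDom f
  · beta_reduce at hs
    rw [← hf.coe_toReal hy₀] at hs
    have hs' : s < (f y₀).toReal + c y₀ := by exact_mod_cast hs
    set e := ((f y₀).toReal + c y₀ - s) / 2 with he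
    have h1 : ∀ᶠ y in nhds y₀, (((f y₀).toReal - e : ℝ) : EReal) < f y := by
      apply hf.lsc y₀
      rw [← hf.coe_toReal hy₀]
      have : (f y₀).toReal - e < (f y₀).toReal := by linarith
      exact_mod_cast this
    have h2 : ∀ᶠ y in nhdsWithin y₀ (effDom f), c y₀ - e < c y :=
      (hc y₀ hy₀).eventually (lt_mem_nhds (by linarith))
    rw [eventually_nhdsWithin_iff] at h2
    filter_upwards [h1, h2] with y hy1 hy2 hyd
    linarith [real_lt _ _ hyd hy1, hy2 hyd]
  · have hT : f y₀ = ⊤ := by simpa [effDom] using hy₀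
    have h1 : ∀ᶠ y in nhds y₀, ((s - m : ℝ) : EReal) < f y := by
      apply hf.lsc y₀
      rw [hT]; exact EReal.coe_lt_top _
    filter_upwards [h1] with y hy1 hyd
    linarith [real_lt _ _ hyd hy1, hm y hyd]

/-- Existence of minimizers of `f + c`, where sublevel sets of `f + c` are bounded. -/
lemma IsProperClosedConvex.exists_minimizer (hf : IsProperClosedConvex f) {c : E k → ℝ}
    (hc : ContinuousOn c (effDom f)) {m : ℝ} (hm : ∀ y ∈ effDom f, m ≤ c y) {z₀ : E k} {r : ℝ}
    (hr : ∀ z ∈ effDom f, r < ‖z‖ → f z₀ + (c z₀ : EReal) ≤ f z + (c z : EReal)) :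
    ∃ z, ∀ w, f z + (c z : EReal) ≤ f w + (c w : EReal) := by
  obtain ⟨z, -, hz⟩ := LowerSemicontinuousOn.exists_isMinOn
    (f := fun y => f y + (c y : EReal))
    (s := Metric.closedBall 0 (max r ‖z₀‖)) ⟨z₀, by simp⟩
    (isCompact_closedBall _ _) ((hf.add_lsc hc hm).lowerSemicontinuousOn _)
  refine ⟨z, fun w => ?_⟩
  by_cases hw : w ∈ Metric.closedBall (0 : E k) (max r ‖z₀‖)
  · exact hz hw
  · by_cases hwd : w ∈ effDom f
    · refine (hz (show z₀ ∈ Metric.closedBall (0 : E k) (max r ‖z₀‖) by simp)).trans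
        (hr w hwd ?_)
      have : max r ‖z₀‖ < ‖w‖ := by simpa using hw
      exact (le_max_left _ _).trans_lt this
    · have : f w = ⊤ := by simpa [effDom] using hwd
      rw [this, EReal.top_add_coe]
      exact le_top

lemma IsProperClosedConvex.exists_lower_bound_closedBall (hf : IsProperClosedConvex f)
    (z₀ : E k) (r : ℝ) :
    ∃ m : ℝ, ∀ z ∈ effDom f, ‖z - z₀‖ ≤ r → m ≤ (f z).toReal := by
  by_cases hr : 0 ≤ r
  · obtain ⟨z, -, hz⟩ := LowerSemicontinuousOn.exists_isMinOn (f := f)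
      (s := Metric.closedBall z₀ r) ⟨z₀, by simpa using hr⟩
      (isCompact_closedBall _ _) (hf.lsc.lowerSemicontinuousOn _)
    refine ⟨(f z).toReal, fun w hw hwr => ?_⟩
    have h : f z ≤ f w := hz (by simpa [dist_eq_norm] using hwr)
    exact EReal.toReal_le_toReal h (hf.ne_bot z) hw
  · exact ⟨0, fun z _ hz => absurd ((norm_nonneg _).trans hz) hr⟩

/-- A convex function is bounded below by a linear function of the norm. -/
lemma IsProperClosedConvex.exists_linear_lower_bound (hf : IsProperClosedConvex f)
    {z₀ : E k} (hz₀ : z₀ ∈ effDom f) :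
    ∃ m : ℝ, 0 ≤ m ∧ ∀ z ∈ effDom f, -(m * (1 + ‖z - z₀‖)) ≤ (f z).toReal := by
  obtain ⟨m, hm⟩ := hf.exists_lower_bound_closedBall z₀ 1
  refine ⟨|m| + |(f z₀).toReal|, by positivity, fun z hz => ?_⟩
  have hA := neg_abs_le m
  have hB := le_abs_self (f z₀).toReal
  have hA0 := abs_nonneg m
  have hB0 := abs_nonneg (f z₀).toReal
  have hn := norm_nonneg (z - z₀)
  by_cases h : ‖z - z₀‖ ≤ 1
  · nlinarith [hm z hz h]
  · push Not at h
    have hn' : (0 : ℝ) < ‖z - z₀‖ := by linarith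
    -- With this weight, the convex combination of `z₀` and `z` lies at distance 1 from `z₀`, where
    -- `f ≥ m`; convexity carries the bound out to `z`.
    set s := ‖z - z₀‖⁻¹ with hs
    have hs0 : 0 < s := inv_pos.2 hn'
    have hs1 : s ≤ 1 := inv_le_one_of_one_le₀ h.le
    have hsn : s * ‖z - z₀‖ = 1 := inv_mul_cancel₀ hn'.ne'
    have hw : (1 - s) • z₀ + s • z ∈ effDom f :=
      hf.convex_effDom hz₀ hz (by linarith) hs0.le (by ring)
    have hconv := hf.convexOn.2 hz₀ hz (by linarith : 0 ≤ 1 - s) hs0.le (by ring)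
    have hwn : ‖(1 - s) • z₀ + s • z - z₀‖ ≤ 1 := by
      have : (1 - s) • z₀ + s • z - z₀ = s • (z - z₀) := by module
      rw [this, norm_smul, Real.norm_of_nonneg hs0.le, hsn]
    have h1 := hm _ hw hwn
    simp only [smul_eq_mul] at hconv
    have h2 : m ≤ (1 - s) * (f z₀).toReal + s * (f z).toReal := h1.trans hconv
    have h3 : m * ‖z - z₀‖ ≤ (‖z - z₀‖ - 1) * (f z₀).toReal + (f z).toReal := by
      have := mul_le_mul_of_nonneg_right h2 hn
      have e : ((1 - s) * (f z₀).toReal + s * (f z).toReal) * ‖z - z₀‖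
          = (‖z - z₀‖ - s * ‖z - z₀‖) * (f z₀).toReal + s * ‖z - z₀‖ * (f z).toReal := by ring
      rw [e, hsn] at this
      linarith
    nlinarith

end Convex

/-! ### The proximal operator. -/

section Prox

variable {k : ℕ} {f : E k → EReal} {η : ℝ}

lemma prox_spec (hf : IsProperClosedConvex f) (hη : 0 < η) (u : E k) (w : E k) :
    f (prox η f u) + ((‖prox η f u - u‖ ^ 2 / (2 * η) : ℝ) : EReal)
      ≤ f w + ((‖w - u‖ ^ 2 / (2 * η) : ℝ) : EReal) := by
  refine Classical.epsilon_spec (p := fun z => ∀ w,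
    f z + ((‖z - u‖ ^ 2 / (2 * η) : ℝ) : EReal) ≤ f w + ((‖w - u‖ ^ 2 / (2 * η) : ℝ) : EReal))
    ?_ w
  obtain ⟨z₀, hz₀⟩ := hf.exists_ne_top
  obtain ⟨m, hm0, hm⟩ := hf.exists_linear_lower_bound hz₀
  set c : E k → ℝ := fun z => ‖z - u‖ ^ 2 / (2 * η) with hc
  set a := (f z₀).toReal + c z₀ with ha
  set B := m * (1 + ‖u - z₀‖) with hB
  have hB0 : 0 ≤ B := by positivity
  -- Beyond this radius the quadratic term exceeds `(|a| + B + m) s` with `s = ‖z - u‖ ≥ 1`, which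
  -- beats both the linear lower bound of `f` and the value `a` at `z₀`.
  refine hf.exists_minimizer (c := c) (m := 0) (z₀ := z₀)
    (r := ‖u‖ + 1 + 2 * η * (|a| + B + m)) (by fun_prop)
    (fun y _ => by positivity) fun z hz hzr => ?_
  rw [← hf.coe_toReal hz₀, ← hf.coe_toReal hz]
  suffices a ≤ (f z).toReal + c z by exact_mod_cast this
  have h1 := hm z hz
  have h2 : ‖z - z₀‖ ≤ ‖z - u‖ + ‖u - z₀‖ := by
    simpa using norm_add_le (z - u) (u - z₀)
  have h3 : ‖z‖ ≤ ‖z - u‖ + ‖u‖ := by simpa using norm_add_le (z - u) u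
  set s := ‖z - u‖ with hs
  have h4 : 1 + 2 * η * (|a| + B + m) < s := by linarith
  have h5 : -(B + m * s) ≤ (f z).toReal := by nlinarith
  have hnn : 0 ≤ |a| + B + m := by positivity
  have hs1 : 1 ≤ s := by nlinarith
  have h6 : (|a| + B + m) * s ≤ s ^ 2 / (2 * η) := by
    rw [le_div_iff₀ (by positivity)]
    nlinarith
  have h7 : c z = s ^ 2 / (2 * η) := rfl
  have := le_abs_self a
  have := abs_nonneg a
  nlinarith

lemma prox_mem (hf : IsProperClosedConvex f) (hη : 0 < η) (u : E k) :
    prox η f u ∈ effDom f := by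
  obtain ⟨z₀, hz₀⟩ := hf.exists_ne_top
  intro h
  have := prox_spec hf hη u z₀
  rw [h, EReal.top_add_coe, top_le_iff, ← hf.coe_toReal hz₀] at this
  exact EReal.coe_ne_top _ (by exact_mod_cast this)

/-- Stands in for the limit `t → 0` after a variational inequality along a segment has been divided
by `t`; `c` is the coefficient of the second-order remainder. -/
lemma le_of_forall_small_mul {a b c : ℝ}
    (h : ∀ t : ℝ, 0 < t → t ≤ 1 → a ≤ b + t * c) : a ≤ b := by
  refine le_of_forall_pos_le_add fun e he => ?_
  have hc : 0 < |c| + 1 := by positivity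
  have h0 : 0 < min 1 (e / (|c| + 1)) := by positivity
  have h1 := h _ h0 (min_le_left _ _)
  have h2 : min 1 (e / (|c| + 1)) * c ≤ e := by
    calc _ ≤ min 1 (e / (|c| + 1)) * (|c| + 1) := by
          gcongr; linarith [le_abs_self c]
      _ ≤ e / (|c| + 1) * (|c| + 1) := by gcongr; exact min_le_right _ _
      _ = e := by field_simp
  linarith

/-- The optimality condition of the proximal operator. -/
lemma prox_optimality (hf : IsProperClosedConvex f) (hη : 0 < η) (u : E k) {w : E k}
    (hw : w ∈ effDom f) :
    (f (prox η f u)).toReal + inner ℝ (u - prox η f u) (w - prox η f u) / η ≤ (f w).toReal := by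
  set z := prox η f u with hz
  have hzd : z ∈ effDom f := prox_mem hf hη u
  refine le_of_forall_small_mul (c := ‖w - z‖ ^ 2 / (2 * η)) fun t ht0 ht1 => ?_
  have hmem : (1 - t) • z + t • w ∈ effDom f :=
    hf.convex_effDom hzd hw (by linarith) ht0.le (by ring)
  have h1 := prox_spec hf hη u ((1 - t) • z + t • w)
  rw [← hz, ← hf.coe_toReal hzd, ← hf.coe_toReal hmem] at h1
  have h2 : (f z).toReal + ‖z - u‖ ^ 2 / (2 * η) ≤ (f ((1 - t) • z + t • w)).toReal +
    ‖(1 - t) • z + t • w - u‖ ^ 2 / (2 * η) := by exact_mod_cast h1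
  have h3 := hf.convexOn.2 hzd hw (by linarith : 0 ≤ 1 - t) ht0.le (by ring)
  simp only [smul_eq_mul] at h3
  have h4 : ‖(1 - t) • z + t • w - u‖ ^ 2
      = ‖z - u‖ ^ 2 - 2 * t * inner ℝ (u - z) (w - z) + t ^ 2 * ‖w - z‖ ^ 2 := by
    have : (1 - t) • z + t • w - u = (z - u) + t • (w - z) := by module
    rw [this, norm_add_sq_real, norm_smul, inner_smul_right, mul_pow, Real.norm_eq_abs, sq_abs,
      ← neg_sub u z, inner_neg_left]
    ring
  rw [h4] at h2
  have h5 : (‖z - u‖ ^ 2 - 2 * t * inner ℝ (u - z) (w - z) + t ^ 2 * ‖w - z‖ ^ 2) / (2 * η)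
      = ‖z - u‖ ^ 2 / (2 * η) - t * (inner ℝ (u - z) (w - z) / η)
        + t * (t * (‖w - z‖ ^ 2 / (2 * η))) := by
    field_simp
  rw [h5] at h2
  have h6 : t * ((f z).toReal + inner ℝ (u - z) (w - z) / η)
      ≤ t * ((f w).toReal + t * (‖w - z‖ ^ 2 / (2 * η))) := by linarith
  exact le_of_mul_le_mul_left h6 ht0

/-- The proximal operator is nonexpansive. -/
lemma norm_prox_sub_prox_le (hf : IsProperClosedConvex f) (hη : 0 < η) (u v : E k) :
    ‖prox η f u - prox η f v‖ ≤ ‖u - v‖ := by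
  have h1 := prox_optimality hf hη u (prox_mem hf hη v)
  have h2 := prox_optimality hf hη v (prox_mem hf hη u)
  set z := prox η f u
  set w := prox η f v
  have h3 : inner ℝ (u - z) (w - z) / η + inner ℝ (v - w) (z - w) / η ≤ 0 := by linarith
  rw [← add_div, div_nonpos_iff] at h3
  have h4 : inner ℝ (u - z) (w - z) + inner ℝ (v - w) (z - w) ≤ 0 := by
    rcases h3 with h | h
    · linarith
    · exact h.1
  have h5 : inner ℝ (u - z) (w - z) + inner ℝ (v - w) (z - w)
      = ‖z - w‖ ^ 2 - inner ℝ (u - v) (z - w) := by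
    have e : (u - z) = (u - v) + (v - w) - (z - w) := by abel
    rw [← neg_sub z w, inner_neg_right, e, inner_sub_left, inner_add_left,
      real_inner_self_eq_norm_sq]
    ring
  have h6 := real_inner_le_norm (u - v) (z - w)
  by_contra hlt
  push Not at hlt
  nlinarith [norm_nonneg (u - v)]

lemma continuous_prox (hf : IsProperClosedConvex f) (hη : 0 < η) :
    Continuous (prox η f) :=
  (LipschitzWith.of_dist_le_mul (K := 1) fun u v => by
    simpa [dist_eq_norm] using norm_prox_sub_prox_le hf hη u v).continuous

end Prox

/-! ### The smoothed maximum `φ_γ` and its comparison with `φ₀`. -/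

namespace Problem

variable {p q n : ℕ} {Ξ : Type*} [MeasurableSpace Ξ] {D : Problem p q n Ξ} {C : Constants}

/-- The real values of the function maximized in the definition of `φ_γ(u)`. -/
noncomputable def realObj (D : Problem p q n Ξ) (γ : ℝ) (u : E q) (y : E n) : ℝ :=
  inner ℝ u (D.K y) - (D.ψ y).toReal - γ * D.d y

lemma innerObj_eq (hψ : D.AssumptionPsi C) (γ : ℝ) (u : E q) {y : E n}
    (hy : y ∈ effDom D.ψ) : D.innerObj γ u y = (D.realObj γ u y : EReal) := by
  rw [innerObj, ← hψ.ψ_pcc.coe_toReal hy, realObj]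
  push_cast
  rfl

lemma innerObj_eq_bot (γ : ℝ) (u : E q) {y : E n}
    (hy : y ∉ effDom D.ψ) : D.innerObj γ u y = ⊥ := by
  have : D.ψ y = ⊤ := by simpa [effDom] using hy
  rw [innerObj, this, EReal.sub_top, EReal.bot_sub]

lemma yStar_spec (hψ : D.AssumptionPsi C) (hd : D.AssumptionSmoothing) {γ : ℝ} (hγ : 0 ≤ γ)
    (u : E q) (w : E n) : D.innerObj γ u w ≤ D.innerObj γ u (D.yStar γ u) := by
  refine Classical.epsilon_spec (p := fun y => ∀ w, D.innerObj γ u w ≤ D.innerObj γ u y) ?_ w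
  obtain ⟨z₀, hz₀⟩ := hψ.ψ_pcc.exists_ne_top
  have hcont : ContinuousOn (fun y => γ * D.d y - inner ℝ u (D.K y)) (effDom D.ψ) := by
    refine (continuousOn_const.mul hd.cont).sub (Continuous.continuousOn ?_)
    fun_prop
  -- The condition on far points is vacuous, because the domain of `ψ` lies in the ball of radius
  -- `Mψ`.
  obtain ⟨z, hz⟩ := hψ.ψ_pcc.exists_minimizer hcont (m := -(‖u‖ * (‖D.K‖ * C.Mψ)))
    (z₀ := z₀) (r := C.Mψ) (fun y hy => by
      have h1 := hd.nonneg y hy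
      have h2 : inner ℝ u (D.K y) ≤ ‖u‖ * (‖D.K‖ * C.Mψ) :=
        (real_inner_le_norm _ _).trans (by
          gcongr
          exact (D.K.le_opNorm y).trans (by gcongr; exact hψ.bounded y hy))
      have := mul_nonneg hγ h1
      linarith) (fun z hz hzr => absurd (hψ.bounded z hz) (not_le.2 hzr))
  have hzd : z ∈ effDom D.ψ := by
    intro h
    have := hz z₀
    rw [h, EReal.top_add_coe, top_le_iff, ← hψ.ψ_pcc.coe_toReal hz₀] at this
    exact EReal.coe_ne_top _ (by exact_mod_cast this)
  refine ⟨z, fun w => ?_⟩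
  by_cases hw : w ∈ effDom D.ψ
  · rw [innerObj_eq hψ γ u hw, innerObj_eq hψ γ u hzd]
    have h1 := hz w
    rw [← hψ.ψ_pcc.coe_toReal hzd, ← hψ.ψ_pcc.coe_toReal hw] at h1
    have h2 : (D.ψ z).toReal + (γ * D.d z - inner ℝ u (D.K z))
      ≤ (D.ψ w).toReal + (γ * D.d w - inner ℝ u (D.K w)) := by exact_mod_cast h1
    simp only [realObj, EReal.coe_le_coe_iff]
    linarith
  · rw [innerObj_eq_bot γ u hw]; exact bot_le

lemma yStar_mem (hψ : D.AssumptionPsi C) (hd : D.AssumptionSmoothing) {γ : ℝ} (hγ : 0 ≤ γ)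
    (u : E q) : D.yStar γ u ∈ effDom D.ψ := by
  by_contra h
  obtain ⟨z₀, hz₀⟩ := hψ.ψ_pcc.exists_ne_top
  have := yStar_spec hψ hd hγ u z₀
  rw [innerObj_eq_bot γ u h, innerObj_eq hψ γ u hz₀, le_bot_iff] at this
  exact EReal.coe_ne_bot _ this

lemma norm_yStar_le (hψ : D.AssumptionPsi C) (hd : D.AssumptionSmoothing) {γ : ℝ} (hγ : 0 ≤ γ)
    (u : E q) : ‖D.yStar γ u‖ ≤ C.Mψ :=
  hψ.bounded _ (yStar_mem hψ hd hγ u)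

lemma realObj_le_yStar (hψ : D.AssumptionPsi C) (hd : D.AssumptionSmoothing) {γ : ℝ}
    (hγ : 0 ≤ γ) (u : E q) {w : E n} (hw : w ∈ effDom D.ψ) :
    D.realObj γ u w ≤ D.realObj γ u (D.yStar γ u) := by
  have := yStar_spec hψ hd hγ u w
  rw [innerObj_eq hψ γ u hw, innerObj_eq hψ γ u (yStar_mem hψ hd hγ u)] at this
  exact_mod_cast this

lemma phi_eq (hψ : D.AssumptionPsi C) (hd : D.AssumptionSmoothing) {γ : ℝ} (hγ : 0 ≤ γ)
    (u : E q) : D.phi γ u = (D.realObj γ u (D.yStar γ u) : EReal) := by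
  rw [← innerObj_eq hψ γ u (yStar_mem hψ hd hγ u)]
  exact le_antisymm (iSup_le fun w => yStar_spec hψ hd hγ u w) (le_iSup _ _)

lemma phi_toReal (hψ : D.AssumptionPsi C) (hd : D.AssumptionSmoothing) {γ : ℝ} (hγ : 0 ≤ γ)
    (u : E q) : (D.phi γ u).toReal = D.realObj γ u (D.yStar γ u) := by
  rw [phi_eq hψ hd hγ, EReal.toReal_coe]

/-- Quadratic growth at the maximizer. -/
lemma realObj_add_sq_le (hψ : D.AssumptionPsi C) (hd : D.AssumptionSmoothing) {γ : ℝ}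
    (hγ : 0 < γ) (u : E q) {w : E n} (hw : w ∈ effDom D.ψ) :
    D.realObj γ u w + γ / 2 * ‖w - D.yStar γ u‖ ^ 2 ≤ D.realObj γ u (D.yStar γ u) := by
  set z := D.yStar γ u with hz
  have hzd : z ∈ effDom D.ψ := yStar_mem hψ hd hγ.le u
  refine le_of_forall_small_mul (c := γ / 2 * ‖w - z‖ ^ 2) fun t ht0 ht1 => ?_
  have hmem : (1 - t) • z + t • w ∈ effDom D.ψ :=
    hψ.ψ_pcc.convex_effDom hzd hw (by linarith) ht0.le (by ring)
  have h1 := realObj_le_yStar hψ hd hγ.le u hmem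
  have h2 := hψ.ψ_pcc.convexOn.2 hzd hw (by linarith : 0 ≤ 1 - t) ht0.le (by ring)
  have h3 := hd.strong.2 hzd hw (by linarith : 0 ≤ 1 - t) ht0.le (by ring)
  rw [← hz] at h1
  simp only [smul_eq_mul] at h2 h3
  rw [norm_sub_rev z w] at h3
  simp only [realObj, map_add, map_smul, inner_add_right, inner_smul_right] at h1 ⊢
  have h4 := mul_le_mul_of_nonneg_left h3 hγ.le
  have h6 : t * (inner ℝ u (D.K w) - (D.ψ w).toReal - γ * D.d w + γ / 2 * ‖w - z‖ ^ 2)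
      ≤ t * (inner ℝ u (D.K z) - (D.ψ z).toReal - γ * D.d z + t * (γ / 2 * ‖w - z‖ ^ 2)) := by
    nlinarith
  exact le_of_mul_le_mul_left h6 ht0

/-- The maximizer is a Lipschitz function. -/
lemma norm_yStar_sub_le (hψ : D.AssumptionPsi C) (hd : D.AssumptionSmoothing) {γ : ℝ}
    (hγ : 0 < γ) (u v : E q) :
    ‖D.yStar γ u - D.yStar γ v‖ ≤ ‖D.K‖ / γ * ‖u - v‖ := by
  have h1 := realObj_add_sq_le hψ hd hγ u (yStar_mem hψ hd hγ.le v)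
  have h2 := realObj_add_sq_le hψ hd hγ v (yStar_mem hψ hd hγ.le u)
  set y := D.yStar γ u
  set z := D.yStar γ v
  rw [norm_sub_rev z y] at h1
  simp only [realObj] at h1 h2
  have h3 : inner ℝ (u - v) (D.K (y - z)) ≤ ‖u - v‖ * (‖D.K‖ * ‖y - z‖) :=
    (real_inner_le_norm _ _).trans (by gcongr; exact D.K.le_opNorm _)
  rw [map_sub, inner_sub_left, inner_sub_right, inner_sub_right] at h3
  have h4 : γ * ‖y - z‖ ^ 2 ≤ ‖D.K‖ * ‖u - v‖ * ‖y - z‖ := by nlinarith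
  rcases (norm_nonneg (y - z)).eq_or_lt with h | h
  · rw [← h]; positivity
  · rw [div_mul_eq_mul_div, le_div_iff₀ hγ]
    have : ‖y - z‖ * γ * ‖y - z‖ ≤ ‖D.K‖ * ‖u - v‖ * ‖y - z‖ := by nlinarith
    exact le_of_mul_le_mul_right this h

lemma continuous_yStar (hψ : D.AssumptionPsi C) (hd : D.AssumptionSmoothing) {γ : ℝ}
    (hγ : 0 < γ) : Continuous (D.yStar γ) :=
  (LipschitzWith.of_dist_le_mul (K := ⟨‖D.K‖ / γ, by positivity⟩) fun u v => by
    rw [dist_eq_norm, dist_eq_norm]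
    exact norm_yStar_sub_le hψ hd hγ u v).continuous

/-- The maximizer for `u` is a competitor in the maximum for `v`, and the objective is affine in the
dual variable. -/
lemma le_phi_toReal (hψ : D.AssumptionPsi C) (hd : D.AssumptionSmoothing) {γ : ℝ}
    (hγ : 0 ≤ γ) (u v : E q) :
    (D.phi γ u).toReal + inner ℝ (D.K (D.yStar γ u)) (v - u) ≤ (D.phi γ v).toReal := by
  rw [phi_toReal hψ hd hγ, phi_toReal hψ hd hγ]
  have := realObj_le_yStar hψ hd hγ v (yStar_mem hψ hd hγ u)
  refine le_trans (le_of_eq ?_) this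
  simp only [realObj]
  rw [real_inner_comm, inner_sub_right, real_inner_comm v]
  ring

/-- The maximizer for `v`, tested at `u`, loses `γ/2 ‖z - y‖²` by quadratic growth. Young's
inequality spends exactly this on the mixed term `⟪v - u, K (z - y)⟫`. -/
lemma phi_toReal_le (hψ : D.AssumptionPsi C) (hd : D.AssumptionSmoothing) {γ : ℝ}
    (hγ : 0 < γ) (u v : E q) :
    (D.phi γ v).toReal ≤ (D.phi γ u).toReal + inner ℝ (D.K (D.yStar γ u)) (v - u)
      + ‖D.K‖ ^ 2 / (2 * γ) * ‖v - u‖ ^ 2 := by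
  rw [phi_toReal hψ hd hγ.le, phi_toReal hψ hd hγ.le]
  have h1 := realObj_add_sq_le hψ hd hγ u (yStar_mem hψ hd hγ.le v)
  set y := D.yStar γ u
  set z := D.yStar γ v
  simp only [realObj] at h1 ⊢
  have h3 : inner ℝ (v - u) (D.K (z - y)) ≤ ‖v - u‖ * (‖D.K‖ * ‖z - y‖) :=
    (real_inner_le_norm _ _).trans (by gcongr; exact D.K.le_opNorm _)
  have h4 : ‖v - u‖ * (‖D.K‖ * ‖z - y‖)
      ≤ γ / 2 * ‖z - y‖ ^ 2 + ‖D.K‖ ^ 2 / (2 * γ) * ‖v - u‖ ^ 2 := by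
    have h := two_mul_le_add_sq (γ * ‖z - y‖) (‖D.K‖ * ‖v - u‖)
    have e : γ / 2 * ‖z - y‖ ^ 2 + ‖D.K‖ ^ 2 / (2 * γ) * ‖v - u‖ ^ 2
        = ((γ * ‖z - y‖) ^ 2 + (‖D.K‖ * ‖v - u‖) ^ 2) / (2 * γ) := by
      field_simp
    rw [e, le_div_iff₀ (by positivity)]
    linarith
  rw [real_inner_comm (v - u) (D.K y)]
  rw [map_sub, inner_sub_right] at h3
  simp only [inner_sub_left] at h3 ⊢
  linarith

/-- The affine minorant `le_phi_toReal` and the quadratic majorant `phi_toReal_le` touch at `u` and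
have the same linear part, so the remainder is `O(‖v - u‖²)`. -/
lemma gradient_phi (hψ : D.AssumptionPsi C) (hd : D.AssumptionSmoothing) {γ : ℝ}
    (hγ : 0 < γ) (u : E q) :
    gradient (fun u => (D.phi γ u).toReal) u = D.K (D.yStar γ u) := by
  apply HasGradientAt.gradient
  rw [hasGradientAt_iff_isLittleO]
  refine Asymptotics.IsBigO.trans_isLittleO (g := fun v => ‖v - u‖ ^ 2) ?_ ?_
  · refine Asymptotics.IsBigO.of_bound (‖D.K‖ ^ 2 / (2 * γ)) (Filter.Eventually.of_forall ?_)
    intro v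
    have h1 := le_phi_toReal hψ hd hγ.le u v
    have h2 := phi_toReal_le hψ hd hγ u v
    rw [Real.norm_of_nonneg (by linarith), Real.norm_of_nonneg (by positivity)]
    linarith
  · have : (fun v : E q => ‖v - u‖ ^ 2) = fun v => ‖v - u‖ * ‖v - u‖ := by ext; ring
    rw [this]
    have h : (fun v : E q => ‖v - u‖) =o[nhds u] fun _ => (1 : ℝ) := by
      rw [Asymptotics.isLittleO_one_iff]
      have : Continuous fun v : E q => ‖v - u‖ := by fun_prop
      simpa using this.tendsto u
    simpa using (h.mul_isBigO (Asymptotics.isBigO_refl (fun v : E q => ‖v - u‖) (nhds u))).trans_isBigO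
      (Asymptotics.isBigO_refl _ _) |>.norm_right

lemma Bψ_nonneg (hd : D.AssumptionSmoothing) : 0 ≤ D.Bψ :=
  Real.sSup_nonneg (by rintro _ ⟨y, hy, rfl⟩; exact hd.nonneg y hy)

lemma d_le_Bψ (hd : D.AssumptionSmoothing) {y : E n} (hy : y ∈ effDom D.ψ) : D.d y ≤ D.Bψ :=
  le_csSup hd.bdd ⟨y, hy, rfl⟩

lemma phi_toReal_le_phi_zero (hψ : D.AssumptionPsi C) (hd : D.AssumptionSmoothing) {γ : ℝ}
    (hγ : 0 ≤ γ) (u : E q) : (D.phi γ u).toReal ≤ (D.phi 0 u).toReal := by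
  rw [phi_toReal hψ hd hγ, phi_toReal hψ hd le_rfl]
  refine le_trans ?_ (realObj_le_yStar hψ hd le_rfl u (yStar_mem hψ hd hγ u))
  have := mul_nonneg hγ (hd.nonneg _ (yStar_mem hψ hd hγ u))
  simp only [realObj]
  linarith

lemma phi_zero_toReal_le (hψ : D.AssumptionPsi C) (hd : D.AssumptionSmoothing) {γ : ℝ}
    (hγ : 0 ≤ γ) (u : E q) : (D.phi 0 u).toReal ≤ (D.phi γ u).toReal + γ * D.Bψ := by
  rw [phi_toReal hψ hd hγ, phi_toReal hψ hd le_rfl]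
  have h1 := realObj_le_yStar hψ hd hγ u (yStar_mem hψ hd le_rfl u)
  have h2 := mul_le_mul_of_nonneg_left (d_le_Bψ hd (yStar_mem hψ hd le_rfl u)) hγ
  simp only [realObj] at h1 ⊢
  linarith

/-- The inner maximum is attained at a finite value, so `φ₀` never contributes `⊤`. The domain in
the assumptions on `F` is thus convex and measurable. -/
lemma effDom_Psi0 (hD : D.Standing) (hψ : D.AssumptionPsi C) (hd : D.AssumptionSmoothing) :
    effDom D.Psi0 = effDom D.R := by
  ext x
  simp only [effDom, Set.mem_ofPred_eq, Psi0, phi_eq hψ hd le_rfl]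
  rw [not_iff_not]
  constructor
  · intro h
    by_contra hR
    rw [← EReal.coe_toReal hR (hD.R_pcc.ne_bot x)] at h
    exact EReal.coe_ne_top _ (by exact_mod_cast h)
  · intro h
    rw [h, EReal.coe_add_top]

lemma Psi0_toReal (hD : D.Standing) (hψ : D.AssumptionPsi C) (hd : D.AssumptionSmoothing)
    {x : E p} (hx : x ∈ effDom D.R) :
    D.Psi0 x = (((D.phi 0 (D.meanF x)).toReal + (D.R x).toReal : ℝ) : EReal) := by
  rw [Psi0, ← hD.R_pcc.coe_toReal hx, phi_eq hψ hd le_rfl]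
  push_cast
  simp

/-- `Ψ_γ = φ_γ ∘ F + R`, as a real function on the domain of `R`. -/
noncomputable def PsiReal (D : Problem p q n Ξ) (γ : ℝ) (x : E p) : ℝ :=
  (D.phi γ (D.meanF x)).toReal + (D.R x).toReal

lemma Psi0Star_le (hD : D.Standing) (hψ : D.AssumptionPsi C) (hd : D.AssumptionSmoothing)
    {x : E p} (hx : x ∈ effDom D.R) : D.Psi0Star.toReal ≤ D.PsiReal 0 x := by
  have h : D.Psi0Star ≤ D.Psi0 x := iInf_le _ x
  rw [Psi0_toReal hD hψ hd hx] at h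
  have := EReal.toReal_le_toReal h hD.bounded_below.ne' (EReal.coe_ne_top _)
  rwa [EReal.toReal_coe] at this

/-- Uses `φ_γ ≤ φ₀ ≤ φ_γ + γ B_ψ` and `γ ≤ 1`: the telescoped decrease of the smoothed objective is
charged to the unsmoothed gap. -/
lemma PsiReal_sub_le (hD : D.Standing) (hψ : D.AssumptionPsi C) (hd : D.AssumptionSmoothing)
    {γ : ℝ} (hγ : 0 ≤ γ) (hγ1 : γ ≤ 1) {x y : E p} (hx : x ∈ effDom D.R)
    (hy : y ∈ effDom D.R) :
    D.PsiReal γ x - D.PsiReal γ y ≤ (D.Psi0 x).toReal - D.Psi0Star.toReal + D.Bψ := by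
  have h1 := Psi0Star_le hD hψ hd hy
  have h2 := phi_zero_toReal_le hψ hd hγ (D.meanF y)
  have h3 := phi_toReal_le_phi_zero hψ hd hγ (D.meanF x)
  have h4 := Bψ_nonneg hd
  rw [Psi0_toReal hD hψ hd hx, EReal.toReal_coe]
  simp only [PsiReal] at *
  nlinarith

end Problem

/-! ### Frobenius norm and measurability of matrix-valued maps. -/

section Frobenius

variable {p q : ℕ}

lemma frobSq_nonneg (A : E p →L[ℝ] E q) : 0 ≤ frobSq A :=
  Finset.sum_nonneg fun _ _ => by positivity

lemma frobSq_eq_sum (A : E p →L[ℝ] E q) :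
    frobSq A = ∑ j, ∑ k, (A (EuclideanSpace.single j 1) k) ^ 2 := by
  simp [frobSq, EuclideanSpace.norm_sq_eq]

lemma apply_eq_sum_single (A : E p →L[ℝ] E q) (v : E p) :
    A v = ∑ j, v j • A (EuclideanSpace.single j 1) := by
  conv_lhs => rw [← (EuclideanSpace.basisFun (Fin p) ℝ).sum_repr v]
  simp [map_sum]

lemma norm_apply_sq_le (A : E p →L[ℝ] E q) (v : E p) :
    ‖A v‖ ^ 2 ≤ frobSq A * ‖v‖ ^ 2 := by
  have h1 : ‖A v‖ ≤ ∑ j, |v j| * ‖A (EuclideanSpace.single j 1)‖ := by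
    rw [apply_eq_sum_single]
    refine (norm_sum_le _ _).trans (le_of_eq ?_)
    simp [norm_smul]
  calc ‖A v‖ ^ 2 ≤ (∑ j, |v j| * ‖A (EuclideanSpace.single j 1)‖) ^ 2 := by gcongr
    _ ≤ (∑ j, |v j| ^ 2) * ∑ j, ‖A (EuclideanSpace.single j 1)‖ ^ 2 :=
      Finset.sum_mul_sq_le_sq_mul_sq _ _ _
    _ = frobSq A * ‖v‖ ^ 2 := by
      rw [EuclideanSpace.norm_sq_eq, frobSq, mul_comm]; simp

lemma norm_apply_le (A : E p →L[ℝ] E q) (v : E p) :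
    ‖A v‖ ≤ Real.sqrt (frobSq A) * ‖v‖ := by
  refine le_of_sq_le_sq ?_ (by positivity)
  rw [mul_pow, Real.sq_sqrt (frobSq_nonneg A)]
  exact norm_apply_sq_le A v

lemma norm_le_sqrt_frobSq (A : E p →L[ℝ] E q) : ‖A‖ ≤ Real.sqrt (frobSq A) :=
  A.opNorm_le_bound (Real.sqrt_nonneg _) (norm_apply_le A)

lemma norm_sq_le_frobSq (A : E p →L[ℝ] E q) : ‖A‖ ^ 2 ≤ frobSq A := by
  rw [← Real.sq_sqrt (frobSq_nonneg A)]
  gcongr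
  exact norm_le_sqrt_frobSq A

lemma continuous_frobSq : Continuous (frobSq : (E p →L[ℝ] E q) → ℝ) := by
  unfold frobSq
  fun_prop

/-- A matrix is a finite sum of continuous images of its columns. -/
lemma measurable_clm {α : Type*} {m : MeasurableSpace α} {A : α → E p →L[ℝ] E q}
    (h : ∀ j, Measurable fun a => A a (EuclideanSpace.single j 1)) : Measurable A := by
  have hA : A = fun a => ∑ j, ContinuousLinearMap.smulRightL ℝ (E p) (E q)
      (EuclideanSpace.proj j : E p →L[ℝ] ℝ) (A a (EuclideanSpace.single j 1)) := by
    ext1 a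
    ext1 v
    rw [apply_eq_sum_single]
    simp
  rw [hA]
  exact Finset.measurable_sum _ fun j _ =>
    (ContinuousLinearMap.continuous _).measurable.comp (h j)

end Frobenius

/-! ### Jensen and mean value inequalities for lower integrals. -/

section LIntegral

variable {α : Type*} [MeasurableSpace α] {μ : Measure α}

lemma ofReal_norm_sq {V : Type*} [NormedAddCommGroup V] (v : V) :
    ENNReal.ofReal (‖v‖ ^ 2) = ‖v‖ₑ ^ 2 := by
  rw [ENNReal.ofReal_pow (norm_nonneg _), ofReal_norm]

/-- Cauchy–Schwarz against the constant 1. -/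
lemma sq_lintegral_le [IsProbabilityMeasure μ] {f : α → ENNReal} (hf : AEMeasurable f μ) :
    (∫⁻ a, f a ∂μ) ^ 2 ≤ ∫⁻ a, f a ^ 2 ∂μ := by
  have h := ENNReal.lintegral_mul_le_Lp_mul_Lq μ Real.HolderConjugate.two_two hf
    (aemeasurable_const (b := (1 : ENNReal)))
  simp only [Pi.mul_apply, mul_one, ENNReal.rpow_two, one_pow, lintegral_one, measure_univ,
    ENNReal.one_rpow] at h
  calc _ ≤ ((∫⁻ a, f a ^ 2 ∂μ) ^ (1 / 2 : ℝ)) ^ 2 := by gcongr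
    _ = _ := by rw [← ENNReal.rpow_two, ← ENNReal.rpow_mul]; norm_num

lemma memLp_two_of_lintegral {V : Type*} [NormedAddCommGroup V] {f : α → V}
    (hf : AEStronglyMeasurable f μ) (h : ∫⁻ a, ‖f a‖ₑ ^ 2 ∂μ < ⊤) : MemLp f 2 μ := by
  refine ⟨hf, ?_⟩
  rw [eLpNorm_lt_top_iff_lintegral_rpow_enorm_lt_top (by norm_num) (by norm_num)]
  simpa using h

/-- The mean value inequality in integral form, for functions with a merely measurable
derivative. -/
lemma enorm_sub_le_lintegral_of_hasDerivAt {V : Type*} [NormedAddCommGroup V] [NormedSpace ℝ V]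
    [CompleteSpace V] {g g' : ℝ → V} (hg : ∀ s ∈ Set.Icc (0 : ℝ) 1, HasDerivAt g (g' s) s)
    (hm : AEStronglyMeasurable g' (volume.restrict (Set.Ioc (0 : ℝ) 1))) :
    ‖g 1 - g 0‖ₑ ≤ ∫⁻ s in Set.Ioc (0 : ℝ) 1, ‖g' s‖ₑ := by
  by_cases hfin : ∫⁻ s in Set.Ioc (0 : ℝ) 1, ‖g' s‖ₑ = ⊤
  · rw [hfin]; exact le_top
  have hint : IntervalIntegrable g' volume 0 1 := by
    rw [intervalIntegrable_iff_integrableOn_Ioc_of_le zero_le_one]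
    exact ⟨hm, lt_top_iff_ne_top.2 hfin⟩
  rw [← intervalIntegral.integral_eq_sub_of_hasDerivAt (f := g) (f' := g')
    (by simpa [Set.uIcc_of_le] using hg) hint, intervalIntegral.integral_of_le zero_le_one]
  exact enorm_integral_le_lintegral_enorm _

/-- Lets `sq_lintegral_le` be applied to the parameter of a segment. -/
instance : IsProbabilityMeasure (volume.restrict (Set.Ioc (0 : ℝ) 1)) := ⟨by simp⟩

end LIntegral

/-! ### Measurability of the Jacobian; Lipschitz and second-order bounds for the mean function. -/

namespace Problem

variable {p q n : ℕ} {Ξ : Type*} [MeasurableSpace Ξ] {D : Problem p q n Ξ} {C : Constants}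

/-- A pointwise limit of the difference quotients with increment `e / N`. The indicator is needed
because differentiability is known only on the domain. -/
lemma measurable_jac_indicator (hD : D.Standing) (hdom : effDom D.Psi0 = effDom D.R) (e : E p) :
    Measurable fun z : E p × Ξ => (effDom D.R).indicator (fun x => D.jac x z.2 e) z.1 := by
  have hS : MeasurableSet (effDom D.R) := hD.R_pcc.measurableSet_effDom
  have hS' : MeasurableSet {z : E p × Ξ | z.1 ∈ effDom D.R} := measurable_fst hS
  refine measurable_of_tendsto_metrizable (f := fun (N : ℕ) (z : E p × Ξ) =>
    {z : E p × Ξ | z.1 ∈ effDom D.R}.indicator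
      (fun z => (N : ℝ) • (D.F (z.1 + (N : ℝ)⁻¹ • e) z.2 - D.F z.1 z.2)) z) ?_ ?_
  · intro N
    refine Measurable.indicator ?_ hS'
    have h1 : Measurable fun z : E p × Ξ => D.F (z.1 + (N : ℝ)⁻¹ • e) z.2 :=
      hD.measurable_F.comp (by fun_prop : Measurable fun z : E p × Ξ => (z.1 + (N : ℝ)⁻¹ • e, z.2))
    have h2 : Measurable fun z : E p × Ξ => D.F z.1 z.2 := hD.measurable_F
    exact (h1.sub h2).const_smul (N : ℝ)
  · rw [tendsto_pi_nhds]
    rintro ⟨x, ξ⟩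
    by_cases hx : x ∈ effDom D.R
    · have hd := (hD.differentiable_F ξ x (by rwa [hdom])).hasFDerivAt
      have := hd.lim e (c := fun N : ℕ => (N : ℝ)) (l := Filter.atTop)
        (by simpa using tendsto_natCast_atTop_atTop (R := ℝ))
      simpa [hx, jac] using this
    · simp [hx]

lemma measurable_jac_clm_indicator (hD : D.Standing) (hdom : effDom D.Psi0 = effDom D.R) :
    Measurable fun z : E p × Ξ => (effDom D.R).indicator (fun x => D.jac x z.2) z.1 := by
  refine measurable_clm fun j => ?_
  convert measurable_jac_indicator hD hdom (EuclideanSpace.single j 1) using 2 with z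
  by_cases hz : z.1 ∈ effDom D.R <;> simp [hz]

lemma measurable_jac (hD : D.Standing) (hdom : effDom D.Psi0 = effDom D.R) {x : E p}
    (hx : x ∈ effDom D.R) : Measurable (D.jac x) := by
  have := (measurable_jac_clm_indicator hD hdom).comp (measurable_prodMk_left (x := x))
  simpa [Function.comp_def, hx] using this

lemma measurable_F (hD : D.Standing) (x : E p) : Measurable (D.F x) :=
  hD.measurable_F.comp measurable_prodMk_left

lemma memLp_F (hD : D.Standing) (hF : D.AssumptionF C) {x : E p} (hx : x ∈ effDom D.Psi0) :
    MemLp (D.F x) 2 D.law := by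
  have := hD.prob
  have h := memLp_two_of_lintegral (μ := D.law) (f := fun ξ => D.F x ξ - D.meanF x)
    ((measurable_F hD x).sub_const _).aestronglyMeasurable (by
      simp_rw [← ofReal_norm_sq]
      exact (hF.var_F x hx).trans_lt ENNReal.ofReal_lt_top)
  have h2 : MemLp (fun ξ => (D.F x ξ - D.meanF x) + D.meanF x) 2 D.law :=
    h.add (memLp_const (D.meanF x))
  simpa using h2

lemma memLp_jac (hD : D.Standing) (hF : D.AssumptionF C) (hdom : effDom D.Psi0 = effDom D.R)
    {x : E p} (hx : x ∈ effDom D.R) : MemLp (D.jac x) 2 D.law := by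
  refine memLp_two_of_lintegral (measurable_jac hD hdom hx).aestronglyMeasurable ?_
  refine lt_of_le_of_lt (lintegral_mono fun ξ => ?_)
    ((hF.lipschitz x (by rwa [hdom])).trans_lt ENNReal.ofReal_lt_top)
  rw [← ofReal_norm_sq]
  exact ENNReal.ofReal_le_ofReal (norm_sq_le_frobSq _)

lemma integrable_jac (hD : D.Standing) (hF : D.AssumptionF C)
    (hdom : effDom D.Psi0 = effDom D.R)
    {x : E p} (hx : x ∈ effDom D.R) : Integrable (D.jac x) D.law :=
  have := hD.prob
  (memLp_jac hD hF hdom hx).integrable one_le_two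

lemma meanJac_apply (hD : D.Standing) (hF : D.AssumptionF C)
    (hdom : effDom D.Psi0 = effDom D.R) {x : E p} (hx : x ∈ effDom D.R) (e : E p) :
    D.meanJac x e = ∫ ξ, D.jac x ξ e ∂D.law :=
  ContinuousLinearMap.integral_apply (integrable_jac hD hF hdom hx) e

lemma norm_meanJac_le (hD : D.Standing) (hF : D.AssumptionF C)
    (hdom : effDom D.Psi0 = effDom D.R) {x : E p} (hx : x ∈ effDom D.R) :
    ‖D.meanJac x‖ ≤ C.MF := by
  have := hD.prob
  have h1 : ‖D.meanJac x‖ₑ ^ 2 ≤ ENNReal.ofReal (C.MF ^ 2) := by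
    calc ‖D.meanJac x‖ₑ ^ 2 ≤ (∫⁻ ξ, ‖D.jac x ξ‖ₑ ∂D.law) ^ 2 := by
          gcongr; exact enorm_integral_le_lintegral_enorm _
      _ ≤ ∫⁻ ξ, ‖D.jac x ξ‖ₑ ^ 2 ∂D.law :=
          sq_lintegral_le (measurable_jac hD hdom hx).enorm.aemeasurable
      _ ≤ ∫⁻ ξ, ENNReal.ofReal (frobSq (D.jac x ξ)) ∂D.law := by
          refine lintegral_mono fun ξ => ?_
          rw [← ofReal_norm_sq]
          exact ENNReal.ofReal_le_ofReal (norm_sq_le_frobSq _)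
      _ ≤ _ := hF.lipschitz x (by rwa [hdom])
  rw [← ofReal_norm_sq] at h1
  exact le_of_sq_le_sq ((ENNReal.ofReal_le_ofReal_iff (by positivity)).1 h1) hF.MF_pos.le

/-- The derivative of `F(·, ξ)` along a segment, extended by zero outside of the domain. -/
noncomputable def segDeriv (D : Problem p q n Ξ) (x v : E p) (s : ℝ) (ξ : Ξ) : E q :=
  (effDom D.R).indicator (fun z => D.jac z ξ v) (x + s • v)

lemma measurable_segDeriv (hD : D.Standing) (hdom : effDom D.Psi0 = effDom D.R) (x v : E p) :
    Measurable (Function.uncurry (D.segDeriv x v)) :=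
  (measurable_jac_indicator hD hdom v).comp
    (by fun_prop : Measurable fun z : ℝ × Ξ => (x + z.1 • v, z.2))

lemma seg_mem (hD : D.Standing) {x y : E p} (hx : x ∈ effDom D.R) (hy : y ∈ effDom D.R) {s : ℝ}
    (hs : s ∈ Set.Icc (0 : ℝ) 1) : x + s • (y - x) ∈ effDom D.R := by
  have := hD.R_pcc.convex_effDom hx hy (by linarith [hs.2] : 0 ≤ 1 - s) hs.1 (by ring)
  convert this using 1
  module

lemma hasDerivAt_segment (hD : D.Standing) (hdom : effDom D.Psi0 = effDom D.R) {x y : E p}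
    (hx : x ∈ effDom D.R) (hy : y ∈ effDom D.R) (ξ : Ξ) {s : ℝ} (hs : s ∈ Set.Icc (0 : ℝ) 1) :
    HasDerivAt (fun s : ℝ => D.F (x + s • (y - x)) ξ) (D.segDeriv x (y - x) s ξ) s := by
  have hm := seg_mem hD hx hy hs
  have h1 := (hD.differentiable_F ξ _ (by rwa [hdom])).hasFDerivAt
  have h2 : HasDerivAt (fun s : ℝ => x + s • (y - x)) (y - x) s := by
    simpa using ((hasDerivAt_id s).smul_const (y - x)).const_add x
  have e : D.segDeriv x (y - x) s ξ = fderiv ℝ (fun z => D.F z ξ) (x + s • (y - x)) (y - x) := by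
    simp only [segDeriv, hm, Set.indicator_of_mem, jac]
  rw [e]
  exact h1.comp_hasDerivAt s h2

/-- No pathwise Lipschitz constant is available. The increment is bounded by the integral of the
derivative along the segment; Jensen in the parameter and Tonelli then leave the second moment of
the Jacobian at each point of the segment. -/
lemma lintegral_F_sub_sq_le (hD : D.Standing) (hF : D.AssumptionF C)
    (hdom : effDom D.Psi0 = effDom D.R) {x y : E p}
    (hx : x ∈ effDom D.R) (hy : y ∈ effDom D.R) :
    ∫⁻ ξ, ENNReal.ofReal (‖D.F y ξ - D.F x ξ‖ ^ 2) ∂D.law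
      ≤ ENNReal.ofReal (C.MF ^ 2 * ‖y - x‖ ^ 2) := by
  have := hD.prob
  have hmeas := measurable_segDeriv hD hdom x (y - x)
  calc ∫⁻ ξ, ENNReal.ofReal (‖D.F y ξ - D.F x ξ‖ ^ 2) ∂D.law
      ≤ ∫⁻ ξ, (∫⁻ s in Set.Ioc (0 : ℝ) 1, ‖D.segDeriv x (y - x) s ξ‖ₑ ^ 2) ∂D.law := by
        refine lintegral_mono fun ξ => ?_
        have hm : Measurable fun s => D.segDeriv x (y - x) s ξ :=
          hmeas.comp measurable_prodMk_right
        have h := enorm_sub_le_lintegral_of_hasDerivAt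
          (fun s hs => hasDerivAt_segment hD hdom hx hy ξ hs) hm.aestronglyMeasurable
        simp only [one_smul, zero_smul, add_zero, add_sub_cancel] at h
        rw [ofReal_norm_sq]
        exact (pow_le_pow_left₀ zero_le h 2).trans (sq_lintegral_le hm.enorm.aemeasurable)
    _ = ∫⁻ s in Set.Ioc (0 : ℝ) 1, ∫⁻ ξ, ‖D.segDeriv x (y - x) s ξ‖ₑ ^ 2 ∂D.law :=
        (lintegral_lintegral_swap (hmeas.enorm.pow_const 2).aemeasurable).symm
    _ ≤ ∫⁻ s in Set.Ioc (0 : ℝ) 1, ENNReal.ofReal (C.MF ^ 2 * ‖y - x‖ ^ 2) := by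
        refine setLIntegral_mono measurable_const fun s hs => ?_
        have hm := seg_mem hD hx hy ⟨hs.1.le, hs.2⟩
        rw [ENNReal.ofReal_mul (by positivity)]
        refine le_trans ?_ (mul_le_mul_left (hF.lipschitz _ (by rwa [hdom])) _)
        rw [← lintegral_mul_const']
        swap
        · exact ENNReal.ofReal_ne_top
        refine lintegral_mono fun ξ => ?_
        rw [← ofReal_norm_sq, ← ENNReal.ofReal_mul (frobSq_nonneg _)]
        refine ENNReal.ofReal_le_ofReal ?_
        simpa [segDeriv, hm] using norm_apply_sq_le (D.jac (x + s • (y - x)) ξ) (y - x)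
    _ = _ := by simp

lemma norm_meanF_sub_le (hD : D.Standing) (hF : D.AssumptionF C)
    (hdom : effDom D.Psi0 = effDom D.R) {x y : E p}
    (hx : x ∈ effDom D.R) (hy : y ∈ effDom D.R) :
    ‖D.meanF y - D.meanF x‖ ≤ C.MF * ‖y - x‖ := by
  have := hD.prob
  have hI : ∀ z ∈ effDom D.R, Integrable (D.F z) D.law := fun z hz =>
    (memLp_F hD hF (by rwa [hdom])).integrable one_le_two
  have h1 : ENNReal.ofReal (‖D.meanF y - D.meanF x‖ ^ 2)
      ≤ ENNReal.ofReal ((C.MF * ‖y - x‖) ^ 2) := by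
    rw [meanF, meanF, ← integral_sub (hI y hy) (hI x hx), ofReal_norm_sq, mul_pow]
    calc _ ≤ (∫⁻ ξ, ‖D.F y ξ - D.F x ξ‖ₑ ∂D.law) ^ 2 := by
          gcongr; exact enorm_integral_le_lintegral_enorm _
      _ ≤ ∫⁻ ξ, ‖D.F y ξ - D.F x ξ‖ₑ ^ 2 ∂D.law :=
          sq_lintegral_le ((measurable_F hD y).sub (measurable_F hD x)).enorm.aemeasurable
      _ ≤ _ := by
          simp_rw [← ofReal_norm_sq]
          exact lintegral_F_sub_sq_le hD hF hdom hx hy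
  have := hF.MF_pos
  exact le_of_sq_le_sq ((ENNReal.ofReal_le_ofReal_iff (by positivity)).1 h1) (by positivity)

lemma lintegral_Ioc_ofReal_mul (c : ℝ) :
    ∫⁻ s in Set.Ioc (0 : ℝ) 1, ENNReal.ofReal (s * c) = ENNReal.ofReal (c / 2) := by
  have h : ∀ s : ℝ, s ∈ Set.Ioc (0 : ℝ) 1 →
      ENNReal.ofReal (s * c) = ENNReal.ofReal s * ENNReal.ofReal c := fun s hs =>
    ENNReal.ofReal_mul hs.1.le
  rw [setLIntegral_congr_fun measurableSet_Ioc h, lintegral_mul_const' _ _ ENNReal.ofReal_ne_top,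
    ← ofReal_integral_eq_lintegral_ofReal, ← intervalIntegral.integral_of_le zero_le_one,
    integral_id, ← ENNReal.ofReal_mul (by norm_num)]
  · congr 1; ring
  · exact (continuous_id.integrableOn_Icc (a := (0 : ℝ)) (b := 1)).mono_set Set.Ioc_subset_Icc_self
  · filter_upwards [ae_restrict_mem measurableSet_Ioc] with s hs using hs.1.le

/-- The segment argument is applied to `F` minus its linearization at `x`. Average smoothness bounds
the expected integrand by `s L_F ‖y - x‖²`, and `∫₀¹ s ds = 1/2`. Differentiation under the integral
sign is not needed. -/
lemma norm_meanF_sub_sub_le (hD : D.Standing) (hF : D.AssumptionF C)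
    (hdom : effDom D.Psi0 = effDom D.R) {x y : E p}
    (hx : x ∈ effDom D.R) (hy : y ∈ effDom D.R) :
    ‖D.meanF y - D.meanF x - D.meanJac x (y - x)‖ ≤ C.LF / 2 * ‖y - x‖ ^ 2 := by
  have := hD.prob
  have hI : ∀ z ∈ effDom D.R, Integrable (D.F z) D.law := fun z hz =>
    (memLp_F hD hF (by rwa [hdom])).integrable one_le_two
  have hJ : Integrable (fun ξ => D.jac x ξ (y - x)) D.law :=
    (integrable_jac hD hF hdom hx).apply_continuousLinearMap (y - x)
  have hJm : Measurable fun ξ => D.jac x ξ (y - x) := by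
    have := (measurable_jac_indicator hD hdom (y - x)).comp (measurable_prodMk_left (x := x))
    simpa [Function.comp_def, hx] using this
  have hmeas := measurable_segDeriv hD hdom x (y - x)
  have hmeas' : Measurable fun z : ℝ × Ξ => D.segDeriv x (y - x) z.1 z.2 - D.jac x z.2 (y - x) :=
    Measurable.sub hmeas (hJm.comp measurable_snd)
  have hLF := hF.LF_pos
  have h1 : ENNReal.ofReal ‖D.meanF y - D.meanF x - D.meanJac x (y - x)‖
      ≤ ENNReal.ofReal (C.LF * ‖y - x‖ ^ 2 / 2) := by
    have e : D.meanF y - D.meanF x - D.meanJac x (y - x)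
        = ∫ ξ, (D.F y ξ - D.F x ξ - D.jac x ξ (y - x)) ∂D.law := by
      have hI2 : Integrable (fun ξ => D.F y ξ - D.F x ξ) D.law := (hI y hy).sub (hI x hx)
      rw [integral_sub hI2 hJ, integral_sub (hI y hy) (hI x hx), meanJac_apply hD hF hdom hx]
      rfl
    rw [e, ofReal_norm]
    calc _ ≤ ∫⁻ ξ, ‖D.F y ξ - D.F x ξ - D.jac x ξ (y - x)‖ₑ ∂D.law :=
          enorm_integral_le_lintegral_enorm _
      _ ≤ ∫⁻ ξ, (∫⁻ s in Set.Ioc (0 : ℝ) 1,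
            ‖D.segDeriv x (y - x) s ξ - D.jac x ξ (y - x)‖ₑ) ∂D.law := by
          refine lintegral_mono fun ξ => ?_
          have hm : Measurable fun s => D.segDeriv x (y - x) s ξ :=
            hmeas.comp measurable_prodMk_right
          have h := enorm_sub_le_lintegral_of_hasDerivAt
            (g := fun s : ℝ => D.F (x + s • (y - x)) ξ - s • D.jac x ξ (y - x))
            (g' := fun s => D.segDeriv x (y - x) s ξ - D.jac x ξ (y - x))
            (fun s hs => (hasDerivAt_segment hD hdom hx hy ξ hs).sub (by
              simpa using (hasDerivAt_id s).smul_const (D.jac x ξ (y - x))))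
            (hm.sub_const _).aestronglyMeasurable
          simp only [one_smul, zero_smul, add_zero, add_sub_cancel, sub_zero] at h
          refine le_trans (le_of_eq ?_) h
          congr 1
          abel
      _ = ∫⁻ s in Set.Ioc (0 : ℝ) 1, ∫⁻ ξ,
            ‖D.segDeriv x (y - x) s ξ - D.jac x ξ (y - x)‖ₑ ∂D.law :=
          (lintegral_lintegral_swap hmeas'.enorm.aemeasurable).symm
      _ ≤ ∫⁻ s in Set.Ioc (0 : ℝ) 1, ENNReal.ofReal (s * (C.LF * ‖y - x‖ ^ 2)) := by
          refine setLIntegral_mono (by fun_prop) fun s hs => ?_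
          have hm := seg_mem hD hx hy ⟨hs.1.le, hs.2⟩
          have hs0 := hs.1.le
          have h2 : (∫⁻ ξ, ‖D.segDeriv x (y - x) s ξ - D.jac x ξ (y - x)‖ₑ ∂D.law) ^ 2
              ≤ ENNReal.ofReal (s * (C.LF * ‖y - x‖ ^ 2)) ^ 2 := by
            refine (sq_lintegral_le
              (hmeas'.comp measurable_prodMk_left).enorm.aemeasurable).trans ?_
            calc _ ≤ ∫⁻ ξ, ENNReal.ofReal (frobSq (D.jac (x + s • (y - x)) ξ - D.jac x ξ))
                  * ENNReal.ofReal (‖y - x‖ ^ 2) ∂D.law := by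
                  refine lintegral_mono fun ξ => ?_
                  rw [← ENNReal.ofReal_mul (frobSq_nonneg _)]
                  have := norm_apply_sq_le (D.jac (x + s • (y - x)) ξ - D.jac x ξ) (y - x)
                  simp only [Function.comp_apply]
                  rw [← ofReal_norm_sq]
                  refine ENNReal.ofReal_le_ofReal ?_
                  simpa [segDeriv, hm] using this
              _ ≤ ENNReal.ofReal (C.LF ^ 2 * ‖x + s • (y - x) - x‖ ^ 2)
                    * ENNReal.ofReal (‖y - x‖ ^ 2) := by
                  rw [lintegral_mul_const' _ _ ENNReal.ofReal_ne_top]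
                  gcongr
                  exact hF.smooth _ (by rwa [hdom]) _ (by rwa [hdom])
              _ = _ := by
                  rw [← ENNReal.ofReal_mul (by positivity), ← ENNReal.ofReal_pow (by positivity),
                    add_sub_cancel_left, norm_smul, Real.norm_of_nonneg hs0]
                  congr 1; ring
          exact (ENNReal.pow_le_pow_left_iff two_ne_zero).1 h2
      _ = _ := lintegral_Ioc_ofReal_mul _
  have := (ENNReal.ofReal_le_ofReal_iff (by positivity)).1 h1
  linarith

end Problem

/-! ### One step of the method: estimator error, descent, gradient mapping. -/

namespace Problem

variable {p q n : ℕ} {Ξ : Type*} [MeasurableSpace Ξ] {D : Problem p q n Ξ} {C : Constants}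

lemma gradPhi_eq (hψ : D.AssumptionPsi C) (hd : D.AssumptionSmoothing) {γ : ℝ} (hγ : 0 < γ)
    (x : E p) : D.gradPhi γ x =
      ContinuousLinearMap.adjoint (D.meanJac x) (D.K (D.yStar γ (D.meanF x))) := by
  rw [gradPhi, gradient_phi hψ hd hγ]

/-- The stochastic estimator `v = Jᵀ K y*_γ(F)` of the gradient of `Φ_γ`. -/
noncomputable def gradEst (D : Problem p q n Ξ) (γ : ℝ) (s : State p q) : E p :=
  ContinuousLinearMap.adjoint s.Je (D.K (D.yStar γ s.Fe))

/-- The squared length of a proximal step. -/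
noncomputable def stepSq (D : Problem p q n Ξ) (γ η : ℝ) (s : State p q) : ℝ :=
  ‖prox η D.R (s.x - η • D.gradEst γ s) - s.x‖ ^ 2

/-- A weighted sum of the squared errors of the two estimators, which bounds the squared error
of the gradient estimator. -/
noncomputable def errSq (D : Problem p q n Ξ) (C : Constants) (γ : ℝ) (s : State p q) : ℝ :=
  2 * C.MF ^ 2 * ‖D.K‖ ^ 4 / γ ^ 2 * ‖s.Fe - D.meanF s.x‖ ^ 2 +
    2 * ‖D.K‖ ^ 2 * C.Mψ ^ 2 * frobSq (s.Je - D.meanJac s.x)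

lemma errSq_nonneg (C : Constants) (γ : ℝ) (s : State p q) : 0 ≤ D.errSq C γ s := by
  have := frobSq_nonneg (s.Je - D.meanJac s.x)
  unfold errSq
  positivity

/-- The difference splits into the true Jacobian applied to the change of the maximizer, controlled
by `M_F` and the Lipschitz constant `‖K‖/γ`, and the Jacobian error applied to a dual vector of norm
at most `Mψ`. -/
lemma norm_gradPhi_sub_gradEst_sq_le (hD : D.Standing) (hF : D.AssumptionF C)
    (hψ : D.AssumptionPsi C) (hd : D.AssumptionSmoothing) {γ : ℝ} (hγ : 0 < γ)
    {s : State p q} (hs : s.x ∈ effDom D.R) :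
    ‖D.gradPhi γ s.x - D.gradEst γ s‖ ^ 2 ≤ D.errSq C γ s := by
  have hdom := effDom_Psi0 hD hψ hd
  rw [gradPhi_eq hψ hd hγ, gradEst]
  set y := D.yStar γ s.Fe with hy
  set z := D.yStar γ (D.meanF s.x) with hz
  have e : ContinuousLinearMap.adjoint (D.meanJac s.x) (D.K z)
      - ContinuousLinearMap.adjoint s.Je (D.K y)
      = ContinuousLinearMap.adjoint (D.meanJac s.x) (D.K (z - y))
        - ContinuousLinearMap.adjoint (s.Je - D.meanJac s.x) (D.K y) := by
    simp only [map_sub, sub_apply]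
    abel
  have hMψ := hψ.Mψ_pos
  have hMF := hF.MF_pos
  have hM := norm_meanJac_le hD hF hdom hs
  have h1 : ‖ContinuousLinearMap.adjoint (D.meanJac s.x) (D.K (z - y))‖
      ≤ C.MF * (‖D.K‖ * (‖D.K‖ / γ * ‖s.Fe - D.meanF s.x‖)) := by
    refine (ContinuousLinearMap.le_opNorm _ _).trans ?_
    rw [LinearIsometryEquiv.norm_map]
    gcongr
    refine (ContinuousLinearMap.le_opNorm _ _).trans ?_
    gcongr
    rw [norm_sub_rev s.Fe]
    exact norm_yStar_sub_le hψ hd hγ _ _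
  have h2 : ‖ContinuousLinearMap.adjoint (s.Je - D.meanJac s.x) (D.K y)‖
      ≤ Real.sqrt (frobSq (s.Je - D.meanJac s.x)) * (‖D.K‖ * C.Mψ) := by
    refine (ContinuousLinearMap.le_opNorm _ _).trans ?_
    rw [LinearIsometryEquiv.norm_map]
    gcongr
    · exact norm_le_sqrt_frobSq _
    · refine (ContinuousLinearMap.le_opNorm _ _).trans ?_
      gcongr
      exact norm_yStar_le hψ hd hγ.le _
  rw [e]
  calc _ ≤ (‖ContinuousLinearMap.adjoint (D.meanJac s.x) (D.K (z - y))‖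
        + ‖ContinuousLinearMap.adjoint (s.Je - D.meanJac s.x) (D.K y)‖) ^ 2 := by
        gcongr; exact norm_sub_le _ _
    _ ≤ (C.MF * (‖D.K‖ * (‖D.K‖ / γ * ‖s.Fe - D.meanF s.x‖))
        + Real.sqrt (frobSq (s.Je - D.meanJac s.x)) * (‖D.K‖ * C.Mψ)) ^ 2 := by gcongr
    _ ≤ 2 * ((C.MF * (‖D.K‖ * (‖D.K‖ / γ * ‖s.Fe - D.meanF s.x‖))) ^ 2
        + (Real.sqrt (frobSq (s.Je - D.meanJac s.x)) * (‖D.K‖ * C.Mψ)) ^ 2) := add_sq_le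
    _ = D.errSq C γ s := by
      rw [errSq, mul_pow (Real.sqrt _), Real.sq_sqrt (frobSq_nonneg _)]
      ring

lemma nextPoint_eq (γ θ η : ℝ) (s : State p q) : nextPoint D θ η γ s =
    (1 - θ) • s.x + θ • prox η D.R (s.x - η • D.gradEst γ s) := rfl

lemma nextPoint_mem (hD : D.Standing) {γ θ η : ℝ} (hη : 0 < η) (hθ : θ ∈ Set.Ioc (0 : ℝ) 1)
    {s : State p q} (hs : s.x ∈ effDom D.R) : nextPoint D θ η γ s ∈ effDom D.R :=
  hD.R_pcc.convex_effDom hs (prox_mem hD.R_pcc hη _) (by linarith [hθ.2]) hθ.1.le (by ring)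

lemma norm_nextPoint_sub_sq (γ θ η : ℝ) (s : State p q) :
    ‖nextPoint D θ η γ s - s.x‖ ^ 2 = θ ^ 2 * D.stepSq γ η s := by
  have : nextPoint D θ η γ s - s.x
      = θ • (prox η D.R (s.x - η • D.gradEst γ s) - s.x) := by
    rw [nextPoint_eq]; module
  rw [this, norm_smul, mul_pow, Real.norm_eq_abs, sq_abs, stepSq]

/-- The quadratic upper bound for `Φ_γ = φ_γ ∘ F`. -/
lemma phi_meanF_le (hD : D.Standing) (hF : D.AssumptionF C)
    (hψ : D.AssumptionPsi C) (hd : D.AssumptionSmoothing) {γ : ℝ} (hγ : 0 < γ) {x y : E p}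
    (hx : x ∈ effDom D.R) (hy : y ∈ effDom D.R) :
    (D.phi γ (D.meanF y)).toReal ≤ (D.phi γ (D.meanF x)).toReal
      + inner ℝ (D.gradPhi γ x) (y - x)
      + (C.LF * C.Mψ * ‖D.K‖ + C.MF ^ 2 * ‖D.K‖ ^ 2 / γ) / 2 * ‖y - x‖ ^ 2 := by
  have hdom := effDom_Psi0 hD hψ hd
  have h1 := phi_toReal_le hψ hd hγ (D.meanF x) (D.meanF y)
  have h2 := norm_meanF_sub_le hD hF hdom hx hy
  have h3 := norm_meanF_sub_sub_le hD hF hdom hx hy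
  have hMψ := hψ.Mψ_pos
  rw [gradPhi_eq hψ hd hγ, ContinuousLinearMap.adjoint_inner_left]
  set z := D.yStar γ (D.meanF x) with hz
  have h4 : inner ℝ (D.K z) (D.meanF y - D.meanF x - D.meanJac x (y - x))
      ≤ ‖D.K‖ * C.Mψ * (C.LF / 2 * ‖y - x‖ ^ 2) := by
    refine (real_inner_le_norm _ _).trans ?_
    gcongr
    refine (ContinuousLinearMap.le_opNorm _ _).trans ?_
    gcongr
    exact norm_yStar_le hψ hd hγ.le _
  rw [inner_sub_right] at h4
  have h5 : ‖D.K‖ ^ 2 / (2 * γ) * ‖D.meanF y - D.meanF x‖ ^ 2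
      ≤ ‖D.K‖ ^ 2 / (2 * γ) * (C.MF * ‖y - x‖) ^ 2 := by gcongr
  have h6 : ‖D.K‖ ^ 2 / (2 * γ) * (C.MF * ‖y - x‖) ^ 2
      = C.MF ^ 2 * ‖D.K‖ ^ 2 / γ / 2 * ‖y - x‖ ^ 2 := by field_simp
  linarith

/-- Adds four facts: the quadratic bound for `φ_γ ∘ F`, convexity of `R` on the damped step,
optimality of the proximal point, and Young's inequality for the estimator error. They contribute `θ
L / 2`, `0`, `-(3 + θ) L / 2` and `L / 2` to the coefficient of `θ ‖x̂ - x‖²`; the choice of `η`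
makes the total exactly `-L`. -/
lemma PsiReal_nextPoint_le (hD : D.Standing) (hF : D.AssumptionF C)
    (hψ : D.AssumptionPsi C) (hd : D.AssumptionSmoothing) {γ θ η L : ℝ} (hγ : 0 < γ)
    (hθ : θ ∈ Set.Ioc (0 : ℝ) 1)
    (hL : L = C.LF * C.Mψ * ‖D.K‖ + C.MF ^ 2 * ‖D.K‖ ^ 2 / γ) (hL0 : 0 < L)
    (hη : η = 2 / (L * (3 + θ))) {s : State p q} (hs : s.x ∈ effDom D.R) :
    D.PsiReal γ (nextPoint D θ η γ s) + θ * L * D.stepSq γ η s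
      ≤ D.PsiReal γ s.x + θ / (2 * L) * D.errSq C γ s := by
  obtain ⟨hθ0, hθ1⟩ := hθ
  have hη0 : 0 < η := by rw [hη]; positivity
  have hnext := nextPoint_mem (γ := γ) hD hη0 ⟨hθ0, hθ1⟩ hs
  have h1 := phi_meanF_le hD hF hψ hd hγ hs hnext
  rw [← hL, norm_nextPoint_sub_sq] at h1
  have hxd := prox_mem hD.R_pcc hη0 (s.x - η • D.gradEst γ s)
  have h2 := prox_optimality hD.R_pcc hη0 (s.x - η • D.gradEst γ s) hs
  have h3 := hD.R_pcc.convexOn.2 hs hxd (by linarith : 0 ≤ 1 - θ) hθ0.le (by ring)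
  have h4 := norm_gradPhi_sub_gradEst_sq_le hD hF hψ hd hγ hs
  have e1 : nextPoint D θ η γ s - s.x
      = θ • (prox η D.R (s.x - η • D.gradEst γ s) - s.x) := by
    rw [nextPoint_eq]; module
  rw [e1, inner_smul_right] at h1
  simp only [smul_eq_mul] at h3
  rw [← nextPoint_eq] at h3
  simp only [PsiReal, stepSq] at *
  set z := prox η D.R (s.x - η • D.gradEst γ s) with hz
  set v := D.gradEst γ s with hv
  set g := D.gradPhi γ s.x with hg
  have e2 : inner ℝ (s.x - η • v - z) (s.x - z) / η
      = inner ℝ v (z - s.x) + ‖z - s.x‖ ^ 2 / η := by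
    have : s.x - η • v - z = -(z - s.x) - η • v := by abel
    rw [this, ← neg_sub z s.x, inner_neg_right, inner_sub_left, inner_neg_left, inner_smul_left,
      real_inner_self_eq_norm_sq]
    field_simp
    simp
    ring
  rw [e2] at h2
  have e3 : ‖z - s.x‖ ^ 2 / η = ‖z - s.x‖ ^ 2 * (L * (3 + θ) / 2) := by
    rw [hη]; field_simp
  rw [e3] at h2
  have h5 : inner ℝ (g - v) (z - s.x) ≤ D.errSq C γ s / (2 * L) + L / 2 * ‖z - s.x‖ ^ 2 := by
    refine (real_inner_le_norm _ _).trans ?_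
    have h := two_mul_le_add_sq ‖g - v‖ (L * ‖z - s.x‖)
    have e : D.errSq C γ s / (2 * L) + L / 2 * ‖z - s.x‖ ^ 2
        = (D.errSq C γ s + (L * ‖z - s.x‖) ^ 2) / (2 * L) := by field_simp
    rw [e, le_div_iff₀ (by positivity)]
    linarith
  rw [inner_sub_left] at h5
  have h6 := mul_le_mul_of_nonneg_left (add_le_add h2 h5) hθ0.le
  have e4 : θ / (2 * L) * D.errSq C γ s = θ * (D.errSq C γ s / (2 * L)) := by ring
  rw [e4]
  nlinarith

/-- By nonexpansiveness the exact and the estimated proximal points differ by at most `η` times the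
gradient error. As `θ ≤ 1`, one has `η⁻¹ = L (3 + θ) / 2 ≤ 2 L`. -/
lemma norm_gradMap_sq_le (hD : D.Standing) (hF : D.AssumptionF C)
    (hψ : D.AssumptionPsi C) (hd : D.AssumptionSmoothing) {γ θ η L : ℝ} (hγ : 0 < γ)
    (hθ : θ ∈ Set.Ioc (0 : ℝ) 1) (hL0 : 0 < L)
    (hη : η = 2 / (L * (3 + θ))) {s : State p q} (hs : s.x ∈ effDom D.R) :
    ‖D.gradMap γ η s.x‖ ^ 2 ≤ 8 * L ^ 2 * D.stepSq γ η s + 2 * D.errSq C γ s := by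
  obtain ⟨hθ0, hθ1⟩ := hθ
  have hη0 : 0 < η := by rw [hη]; positivity
  have h4 := norm_gradPhi_sub_gradEst_sq_le hD hF hψ hd hγ hs
  have hη1 : η⁻¹ ≤ 2 * L := by rw [hη, inv_div]; nlinarith
  rw [gradMap, stepSq]
  set z := prox η D.R (s.x - η • D.gradEst γ s) with hz
  have h1 : ‖s.x - prox η D.R (s.x - η • D.gradPhi γ s.x)‖
      ≤ ‖z - s.x‖ + η * ‖D.gradPhi γ s.x - D.gradEst γ s‖ := by
    have h2 := norm_prox_sub_prox_le hD.R_pcc hη0 (s.x - η • D.gradEst γ s)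
      (s.x - η • D.gradPhi γ s.x)
    have e : s.x - η • D.gradEst γ s - (s.x - η • D.gradPhi γ s.x)
        = η • (D.gradPhi γ s.x - D.gradEst γ s) := by module
    rw [e, norm_smul, Real.norm_of_nonneg hη0.le] at h2
    rw [norm_sub_rev z]
    exact (norm_sub_le_norm_sub_add_norm_sub _ z _).trans (by gcongr)
  have h3 : ‖η⁻¹ • (s.x - prox η D.R (s.x - η • D.gradPhi γ s.x))‖
      ≤ 2 * L * ‖z - s.x‖ + ‖D.gradPhi γ s.x - D.gradEst γ s‖ := by
    rw [norm_smul, Real.norm_of_nonneg (inv_nonneg.2 hη0.le)]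
    calc _ ≤ η⁻¹ * (‖z - s.x‖ + η * ‖D.gradPhi γ s.x - D.gradEst γ s‖) := by gcongr
      _ = η⁻¹ * ‖z - s.x‖ + ‖D.gradPhi γ s.x - D.gradEst γ s‖ := by field_simp
      _ ≤ _ := by gcongr
  calc _ ≤ (2 * L * ‖z - s.x‖ + ‖D.gradPhi γ s.x - D.gradEst γ s‖) ^ 2 := by gcongr
    _ ≤ 2 * ((2 * L * ‖z - s.x‖) ^ 2 + ‖D.gradPhi γ s.x - D.gradEst γ s‖ ^ 2) := add_sq_le
    _ ≤ _ := by nlinarith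

end Problem

/-! ### Descent along a trajectory. -/

section Iterates

variable {p q n : ℕ} {Ξ Ω : Type*} [MeasurableSpace Ξ] {D : Problem p q n Ξ} {C : Constants}
  {A : Params} {S : Batches Ω Ξ A} {θ η : ℝ} {x₀ : E p}

open Problem

lemma run_mem (hD : D.Standing) (hη : 0 < η) (hθ : θ ∈ Set.Ioc (0 : ℝ) 1)
    (hx₀ : x₀ ∈ effDom D.R) (t : ℕ) (ω : Ω) : (run D S θ η x₀ t ω).x ∈ effDom D.R := by
  induction t with
  | zero => exact hx₀
  | succ t ih => exact nextPoint_mem hD hη hθ ih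

lemma run_succ_x (t : ℕ) (ω : Ω) :
    (run D S θ η x₀ (t + 1) ω).x = nextPoint D θ η A.γ (run D S θ η x₀ t ω) := rfl

/-- The summed descent inequality along a trajectory. -/
lemma sum_stepSq_le (hD : D.Standing) (hF : D.AssumptionF C)
    (hψ : D.AssumptionPsi C) (hd : D.AssumptionSmoothing) {L : ℝ}
    (hγ : A.γ ∈ Set.Ioc (0 : ℝ) 1) (hθ : θ ∈ Set.Ioc (0 : ℝ) 1)
    (hL : L = C.LF * C.Mψ * ‖D.K‖ + C.MF ^ 2 * ‖D.K‖ ^ 2 / A.γ) (hL0 : 0 < L)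
    (hη : η = 2 / (L * (3 + θ))) (hx₀ : x₀ ∈ effDom D.R) (N : ℕ) (ω : Ω) :
    θ * L * ∑ t ∈ Finset.range N, D.stepSq A.γ η (run D S θ η x₀ t ω)
      ≤ ((D.Psi0 x₀).toReal - D.Psi0Star.toReal + D.Bψ)
        + θ / (2 * L) * ∑ t ∈ Finset.range N, D.errSq C A.γ (run D S θ η x₀ t ω) := by
  have hη0 : 0 < η := by
    have := hθ.1
    rw [hη]; positivity
  have hmem := run_mem (S := S) hD hη0 hθ hx₀
  have h0 : D.PsiReal A.γ x₀ - D.PsiReal A.γ (run D S θ η x₀ N ω).x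
      ≤ (D.Psi0 x₀).toReal - D.Psi0Star.toReal + D.Bψ :=
    PsiReal_sub_le hD hψ hd hγ.1.le hγ.2 hx₀ (hmem N ω)
  suffices h : D.PsiReal A.γ (run D S θ η x₀ N ω).x
      + θ * L * ∑ t ∈ Finset.range N, D.stepSq A.γ η (run D S θ η x₀ t ω)
      ≤ D.PsiReal A.γ x₀
        + θ / (2 * L) * ∑ t ∈ Finset.range N, D.errSq C A.γ (run D S θ η x₀ t ω) by
    linarith
  clear h0
  induction N with
  | zero => simp [run]
  | succ N ih =>
    rw [Finset.sum_range_succ, Finset.sum_range_succ, run_succ_x, mul_add, mul_add]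
    have := PsiReal_nextPoint_le hD hF hψ hd hγ.1 hθ hL hL0 hη (hmem N ω)
    linarith

end Iterates

/-! ### Variance of batch averages and of the scalar hybrid estimator. -/

section Variance

variable {Ξ : Type*} [MeasurableSpace Ξ] {law : Measure Ξ} [IsProbabilityMeasure law] {m : ℕ}

/-- The sample average of a function over a batch. -/
noncomputable def batchAvg (g : Ξ → ℝ) (B : Fin m → Ξ) : ℝ := (m : ℝ)⁻¹ * ∑ i, g (B i)

lemma measurable_batchAvg {g : Ξ → ℝ} (hg : Measurable g) :
    Measurable (batchAvg g : (Fin m → Ξ) → ℝ) := by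
  unfold batchAvg
  fun_prop

lemma memLp_comp_eval {g : Ξ → ℝ} (hg : MemLp g 2 law) (i : Fin m) :
    MemLp (fun B : Fin m → Ξ => g (B i)) 2 (Measure.pi fun _ => law) :=
  hg.comp_measurePreserving (measurePreserving_eval (fun _ : Fin m => law) i)

lemma memLp_batchAvg {g : Ξ → ℝ} (hg : MemLp g 2 law) :
    MemLp (batchAvg g : (Fin m → Ξ) → ℝ) 2 (Measure.pi fun _ => law) :=
  (memLp_finsetSum _ fun i _ => memLp_comp_eval hg i).const_mul _

lemma integral_comp_eval {g : Ξ → ℝ} (hg : Measurable g) (i : Fin m) :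
    ∫ B : Fin m → Ξ, g (B i) ∂(Measure.pi fun _ => law) = ∫ ξ, g ξ ∂law := by
  have h := (measurePreserving_eval (fun _ : Fin m => law) i).map_eq
  have h2 := integral_map (μ := Measure.pi fun _ : Fin m => law)
    (measurable_pi_apply (X := fun _ : Fin m => Ξ) i).aemeasurable (f := g)
    hg.aestronglyMeasurable
  rw [← h2]
  exact congrArg (fun ρ => ∫ ξ, g ξ ∂ρ) h

lemma integral_batchAvg {g : Ξ → ℝ} (hgm : Measurable g) (hg : MemLp g 2 law)
    (h0 : ∫ ξ, g ξ ∂law = 0) :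
    ∫ B : Fin m → Ξ, batchAvg g B ∂(Measure.pi fun _ => law) = 0 := by
  unfold batchAvg
  rw [integral_const_mul, integral_finsetSum]
  · simp [integral_comp_eval hgm, h0]
  · exact fun i _ => (memLp_comp_eval hg i).integrable one_le_two

/-- Coordinates of a product measure are independent, so the variances of the centered samples add
up. -/
lemma integral_batchAvg_sq {g : Ξ → ℝ} (hgm : Measurable g) (hg : MemLp g 2 law)
    (h0 : ∫ ξ, g ξ ∂law = 0) (hm : 0 < m) :
    ∫ B : Fin m → Ξ, batchAvg g B ^ 2 ∂(Measure.pi fun _ => law)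
      = (m : ℝ)⁻¹ * ∫ ξ, g ξ ^ 2 ∂law := by
  have hmean := integral_batchAvg (m := m) hgm hg h0
  have h1 := variance_of_integral_eq_zero (memLp_batchAvg (m := m) hg).aemeasurable hmean
  rw [← h1]
  have hind : iIndepFun (fun (i : Fin m) (B : Fin m → Ξ) => g (B i))
      (Measure.pi fun _ => law) := iIndepFun_pi fun i => hgm.aemeasurable
  have h2 := IndepFun.variance_sum (s := Finset.univ)
    (X := fun (i : Fin m) (B : Fin m → Ξ) => g (B i)) (μ := Measure.pi fun _ => law)
    (fun i _ => memLp_comp_eval hg i) (fun i _ j _ hij => hind.indepFun hij)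
  have h3 : ∀ i : Fin m, variance (fun B : Fin m → Ξ => g (B i)) (Measure.pi fun _ => law)
      = ∫ ξ, g ξ ^ 2 ∂law := by
    intro i
    rw [variance_of_integral_eq_zero (memLp_comp_eval hg i).aemeasurable
      (by rw [integral_comp_eval hgm, h0])]
    exact integral_comp_eval (hgm.pow_const 2) i
  have h4 : (batchAvg g : (Fin m → Ξ) → ℝ)
      = fun B => (m : ℝ)⁻¹ * (∑ i, fun B : Fin m → Ξ => g (B i)) B := by
    ext B; simp [batchAvg]
  rw [h4, variance_const_mul, h2, Finset.sum_congr rfl fun i _ => h3 i]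
  simp
  field_simp

/-- Bound for the second moment of a sum of a constant and two centered sample averages. -/
lemma lintegral_sq_add_batchAvg_le {ν : Measure ((Fin m → Ξ) × (Fin m → Ξ))}
    [IsProbabilityMeasure ν] (h1 : ν.map Prod.fst = Measure.pi fun _ => law)
    (h2 : ν.map Prod.snd = Measure.pi fun _ => law) {κ : ℝ}
    (hκ : κ = 2 ∨ (κ = 1 ∧ IndepFun Prod.fst Prod.snd ν)) (hm : 0 < m) {g₁ g₂ : Ξ → ℝ}
    (hgm₁ : Measurable g₁) (hgm₂ : Measurable g₂) (hg₁ : MemLp g₁ 2 law) (hg₂ : MemLp g₂ 2 law)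
    (h₁ : ∫ ξ, g₁ ξ ∂law = 0) (h₂ : ∫ ξ, g₂ ξ ∂law = 0) (a : ℝ) :
    ∫⁻ B, ENNReal.ofReal ((a + batchAvg g₁ B.1 + batchAvg g₂ B.2) ^ 2) ∂ν
      ≤ ENNReal.ofReal (a ^ 2) + ENNReal.ofReal (κ / m) *
        (∫⁻ ξ, ENNReal.ofReal (g₁ ξ ^ 2) ∂law + ∫⁻ ξ, ENNReal.ofReal (g₂ ξ ^ 2) ∂law) := by
  have mp1 : MeasurePreserving Prod.fst ν (Measure.pi fun _ => law) := ⟨measurable_fst, h1⟩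
  have mp2 : MeasurePreserving Prod.snd ν (Measure.pi fun _ => law) := ⟨measurable_snd, h2⟩
  set U : (Fin m → Ξ) × (Fin m → Ξ) → ℝ := fun B => batchAvg g₁ B.1 with hU
  set V : (Fin m → Ξ) × (Fin m → Ξ) → ℝ := fun B => batchAvg g₂ B.2 with hV
  have hUL : MemLp U 2 ν := (memLp_batchAvg hg₁).comp_measurePreserving mp1
  have hVL : MemLp V 2 ν := (memLp_batchAvg hg₂).comp_measurePreserving mp2
  have hUi := hUL.integrable one_le_two
  have hVi := hVL.integrable one_le_two
  have hU2 := hUL.integrable_sq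
  have hV2 := hVL.integrable_sq
  have tr1 : ∀ φ : (Fin m → Ξ) → ℝ, Measurable φ →
      ∫ B, φ B.1 ∂ν = ∫ B, φ B ∂(Measure.pi fun _ => law) := by
    intro φ hφ
    rw [← h1, integral_map measurable_fst.aemeasurable hφ.aestronglyMeasurable]
  have tr2 : ∀ φ : (Fin m → Ξ) → ℝ, Measurable φ →
      ∫ B, φ B.2 ∂ν = ∫ B, φ B ∂(Measure.pi fun _ => law) := by
    intro φ hφ
    rw [← h2, integral_map measurable_snd.aemeasurable hφ.aestronglyMeasurable]
  have hW1 := measurable_batchAvg (m := m) hgm₁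
  have hW2 := measurable_batchAvg (m := m) hgm₂
  have eU : ∫ B, U B ∂ν = 0 := by rw [hU, tr1 _ hW1, integral_batchAvg hgm₁ hg₁ h₁]
  have eV : ∫ B, V B ∂ν = 0 := by rw [hV, tr2 _ hW2, integral_batchAvg hgm₂ hg₂ h₂]
  have eU2 : ∫ B, U B ^ 2 ∂ν = (m : ℝ)⁻¹ * ∫ ξ, g₁ ξ ^ 2 ∂law :=
    (tr1 _ (hW1.pow_const 2)).trans (integral_batchAvg_sq hgm₁ hg₁ h₁ hm)
  have eV2 : ∫ B, V B ^ 2 ∂ν = (m : ℝ)⁻¹ * ∫ ξ, g₂ ξ ^ 2 ∂law :=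
    (tr2 _ (hW2.pow_const 2)).trans (integral_batchAvg_sq hgm₂ hg₂ h₂ hm)
  have key : ∫ B, (a + U B + V B) ^ 2 ∂ν
      ≤ a ^ 2 + κ / m * (∫ ξ, g₁ ξ ^ 2 ∂law + ∫ ξ, g₂ ξ ^ 2 ∂law) := by
    -- The terms linear in `U` and `V` integrate to zero in both cases. The product `U V` is
    -- absorbed by `2 U V ≤ U² + V²` if `κ = 2`, and has mean zero by independence if `κ = 1`.
    rcases hκ with rfl | ⟨rfl, hind⟩
    · have hi : Integrable (fun B => a ^ 2 + 2 * a * U B + 2 * a * V B + 2 * U B ^ 2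
          + 2 * V B ^ 2) ν := by fun_prop
      have hle : ∫ B, (a + U B + V B) ^ 2 ∂ν ≤ ∫ B, (a ^ 2 + 2 * a * U B + 2 * a * V B
          + 2 * U B ^ 2 + 2 * V B ^ 2) ∂ν := by
        refine integral_mono_of_nonneg (Filter.Eventually.of_forall fun B => sq_nonneg _) hi
          (Filter.Eventually.of_forall fun B => ?_)
        beta_reduce
        nlinarith [sq_nonneg (U B - V B)]
      refine hle.trans (le_of_eq ?_)
      rw [integral_add (by fun_prop) (by fun_prop), integral_add (by fun_prop) (by fun_prop),
        integral_add (by fun_prop) (by fun_prop), integral_add (by fun_prop) (by fun_prop)]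
      simp only [integral_const_mul, eU, eV, eU2, eV2, integral_const, probReal_univ]
      simp
      ring
    · have hUV : Integrable (fun B => U B * V B) ν := hUL.integrable_mul hVL
      have hUVind : IndepFun U V ν := hind.comp hW1 hW2
      have eUV : ∫ B, U B * V B ∂ν = 0 := by
        have := hUVind.integral_fun_mul_eq_mul_integral hUL.aestronglyMeasurable
          hVL.aestronglyMeasurable
        rw [this, eU, zero_mul]
      have e : ∫ B, (a + U B + V B) ^ 2 ∂ν = ∫ B, (a ^ 2 + 2 * a * U B + 2 * a * V B
          + 2 * (U B * V B) + U B ^ 2 + V B ^ 2) ∂ν := by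
        congr 1; ext B; ring
      rw [e]
      refine le_of_eq ?_
      rw [integral_add (by fun_prop) (by fun_prop), integral_add (by fun_prop) (by fun_prop),
        integral_add (by fun_prop) (by fun_prop), integral_add (by fun_prop) (by fun_prop),
        integral_add (by fun_prop) (by fun_prop)]
      simp only [integral_const_mul, eU, eV, eU2, eV2, eUV, integral_const, probReal_univ]
      simp
      ring
  have hκ0 : 0 ≤ κ / m := by
    rcases hκ with rfl | ⟨rfl, -⟩ <;> positivity
  have hint : Integrable (fun B => (a + U B + V B) ^ 2) ν :=
    (((memLp_const a).add hUL).add hVL).integrable_sq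
  have hi1 := hg₁.integrable_sq
  have hi2 := hg₂.integrable_sq
  rw [← ofReal_integral_eq_lintegral_ofReal hint
      (Filter.Eventually.of_forall fun _ => sq_nonneg _),
    ← ofReal_integral_eq_lintegral_ofReal hi1 (Filter.Eventually.of_forall fun _ => sq_nonneg _),
    ← ofReal_integral_eq_lintegral_ofReal hi2 (Filter.Eventually.of_forall fun _ => sq_nonneg _),
    ← ENNReal.ofReal_add (by positivity) (by positivity), ← ENNReal.ofReal_mul hκ0,
    ← ENNReal.ofReal_add (by positivity) (by positivity)]
  exact ENNReal.ofReal_le_ofReal key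

variable {Ω Z : Type*} [MeasurableSpace Ω] [MeasurableSpace Z] {μ : Measure Ω}

/-- The same bound, where the constant and the functions depend on a random variable that is
independent of the batches. -/
lemma lintegral_sq_add_batchAvg_comp_le [IsProbabilityMeasure μ] {B₁ B₂ : Ω → Fin m → Ξ} {X : Ω → Z}
    (hB₁ : Measurable B₁) (hB₂ : Measurable B₂) (hX : Measurable X)
    (h1 : μ.map B₁ = Measure.pi fun _ => law) (h2 : μ.map B₂ = Measure.pi fun _ => law) {κ : ℝ}
    (hκ : κ = 2 ∨ (κ = 1 ∧ IndepFun B₁ B₂ μ)) (hm : 0 < m)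
    (hind : IndepFun (fun ω => (B₁ ω, B₂ ω)) X μ) {g₁ g₂ : Z → Ξ → ℝ}
    (hgm₁ : Measurable (Function.uncurry g₁)) (hgm₂ : Measurable (Function.uncurry g₂))
    (hg₁ : ∀ z, MemLp (g₁ z) 2 law) (hg₂ : ∀ z, MemLp (g₂ z) 2 law)
    (h₁ : ∀ z, ∫ ξ, g₁ z ξ ∂law = 0) (h₂ : ∀ z, ∫ ξ, g₂ z ξ ∂law = 0)
    {a : Z → ℝ} (ha : Measurable a) :
    ∫⁻ ω, ENNReal.ofReal ((a (X ω) + batchAvg (g₁ (X ω)) (B₁ ω)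
        + batchAvg (g₂ (X ω)) (B₂ ω)) ^ 2) ∂μ
      ≤ ∫⁻ ω, ENNReal.ofReal (a (X ω) ^ 2) ∂μ + ENNReal.ofReal (κ / m) *
        (∫⁻ ω, ∫⁻ ξ, ENNReal.ofReal (g₁ (X ω) ξ ^ 2) ∂law ∂μ
          + ∫⁻ ω, ∫⁻ ξ, ENNReal.ofReal (g₂ (X ω) ξ ^ 2) ∂law ∂μ) := by
  have hB : Measurable fun ω => (B₁ ω, B₂ ω) := hB₁.prodMk hB₂
  -- By independence the joint law of batches and `X` is a product, so Tonelli permits freezing `X`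
  -- and using the bound for deterministic `a`, `g₁`, `g₂`. This replaces conditional expectations.
  have hmap := (indepFun_iff_map_prod_eq_prod_map_map hB.aemeasurable hX.aemeasurable).1 hind
  set ν := μ.map fun ω => (B₁ ω, B₂ ω) with hν
  set ρ := μ.map X with hρ
  have : IsProbabilityMeasure ν := Measure.isProbabilityMeasure_map hB.aemeasurable
  have : IsProbabilityMeasure ρ := Measure.isProbabilityMeasure_map hX.aemeasurable
  have hν1 : ν.map Prod.fst = Measure.pi fun _ => law := by
    rw [hν, Measure.map_map measurable_fst hB]; exact h1
  have hν2 : ν.map Prod.snd = Measure.pi fun _ => law := by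
    rw [hν, Measure.map_map measurable_snd hB]; exact h2
  have hκ' : κ = 2 ∨ (κ = 1 ∧ IndepFun Prod.fst Prod.snd ν) := by
    refine hκ.imp id fun h => ⟨h.1, ?_⟩
    have h3 := (indepFun_iff_map_prod_eq_prod_map_map hB₁.aemeasurable hB₂.aemeasurable).1 h.2
    rw [indepFun_iff_map_prod_eq_prod_map_map measurable_fst.aemeasurable
      measurable_snd.aemeasurable, hν1, hν2]
    simp only [Prod.mk.eta, Measure.map_id']
    rw [hν, h3, h1, h2]
  have hm1 : Measurable fun z : Z => ∫⁻ ξ, ENNReal.ofReal (g₁ z ξ ^ 2) ∂law :=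
    Measurable.lintegral_prod_right' (f := fun z : Z × Ξ => ENNReal.ofReal (g₁ z.1 z.2 ^ 2))
      (hgm₁.pow_const 2).ennreal_ofReal
  have hm2 : Measurable fun z : Z => ∫⁻ ξ, ENNReal.ofReal (g₂ z ξ ^ 2) ∂law :=
    Measurable.lintegral_prod_right' (f := fun z : Z × Ξ => ENNReal.ofReal (g₂ z.1 z.2 ^ 2))
      (hgm₂.pow_const 2).ennreal_ofReal
  have ham : Measurable fun z => ENNReal.ofReal (a z ^ 2) := (ha.pow_const 2).ennreal_ofReal
  have hbig : Measurable fun w : ((Fin m → Ξ) × (Fin m → Ξ)) × Z =>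
      ENNReal.ofReal ((a w.2 + batchAvg (g₁ w.2) w.1.1 + batchAvg (g₂ w.2) w.1.2) ^ 2) := by
    refine Measurable.ennreal_ofReal (Measurable.pow_const ?_ 2)
    refine ((ha.comp measurable_snd).add ?_).add ?_
    · refine Measurable.const_mul (Finset.measurable_sum _ fun i _ => ?_) _
      exact hgm₁.comp (by fun_prop : Measurable fun w : ((Fin m → Ξ) × (Fin m → Ξ)) × Z =>
        (w.2, w.1.1 i))
    · refine Measurable.const_mul (Finset.measurable_sum _ fun i _ => ?_) _
      exact hgm₂.comp (by fun_prop : Measurable fun w : ((Fin m → Ξ) × (Fin m → Ξ)) × Z =>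
        (w.2, w.1.2 i))
  calc _ = ∫⁻ w, ENNReal.ofReal ((a w.2 + batchAvg (g₁ w.2) w.1.1
          + batchAvg (g₂ w.2) w.1.2) ^ 2) ∂(ν.prod ρ) := by
        rw [← hmap, lintegral_map hbig (hB.prodMk hX)]
    _ = ∫⁻ z, ∫⁻ B, ENNReal.ofReal ((a z + batchAvg (g₁ z) B.1
          + batchAvg (g₂ z) B.2) ^ 2) ∂ν ∂ρ := lintegral_prod_symm' _ hbig
    _ ≤ ∫⁻ z, (ENNReal.ofReal (a z ^ 2) + ENNReal.ofReal (κ / m) *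
        (∫⁻ ξ, ENNReal.ofReal (g₁ z ξ ^ 2) ∂law + ∫⁻ ξ, ENNReal.ofReal (g₂ z ξ ^ 2) ∂law)) ∂ρ :=
        lintegral_mono fun z => lintegral_sq_add_batchAvg_le hν1 hν2 hκ' hm
          (hgm₁.comp measurable_prodMk_left) (hgm₂.comp measurable_prodMk_left)
          (hg₁ z) (hg₂ z) (h₁ z) (h₂ z) (a z)
    _ = _ := by
        rw [lintegral_add_left ham, lintegral_const_mul' _ _ ENNReal.ofReal_ne_top, lintegral_add_left hm1,
          hρ, lintegral_map ham hX, lintegral_map hm1 hX, lintegral_map hm2 hX]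

/-- The variance recursion of the hybrid estimator of the mean of a scalar random function. -/
lemma lintegral_hybrid_sq_le [IsProbabilityMeasure μ] {V : Type*} [MeasurableSpace V] {B₁ B₂ : Ω → Fin m → Ξ}
    {X Y : Ω → V} {e : Ω → ℝ}
    (hB₁ : Measurable B₁) (hB₂ : Measurable B₂) (hX : Measurable X) (hY : Measurable Y)
    (he : Measurable e)
    (h1 : μ.map B₁ = Measure.pi fun _ => law) (h2 : μ.map B₂ = Measure.pi fun _ => law) {κ : ℝ}
    (hκ : κ = 2 ∨ (κ = 1 ∧ IndepFun B₁ B₂ μ)) (hm : 0 < m)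
    (hind : IndepFun (fun ω => (B₁ ω, B₂ ω)) (fun ω => (X ω, Y ω, e ω)) μ) {f : V → Ξ → ℝ}
    (hfm : Measurable (Function.uncurry f)) (hf : ∀ x, MemLp (f x) 2 law) (β : ℝ) :
    ∫⁻ ω, ENNReal.ofReal ((β * e ω + β / m * ∑ i, (f (Y ω) (B₁ ω i) - f (X ω) (B₁ ω i))
        + (1 - β) / m * ∑ i, f (Y ω) (B₂ ω i) - ∫ ξ, f (Y ω) ξ ∂law) ^ 2) ∂μ
      ≤ ENNReal.ofReal (β ^ 2) * ∫⁻ ω, ENNReal.ofReal ((e ω - ∫ ξ, f (X ω) ξ ∂law) ^ 2) ∂μ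
        + ENNReal.ofReal (κ / m) *
        (ENNReal.ofReal (β ^ 2) *
            ∫⁻ ω, ∫⁻ ξ, ENNReal.ofReal ((f (Y ω) ξ - f (X ω) ξ) ^ 2) ∂law ∂μ
          + ENNReal.ofReal ((1 - β) ^ 2) *
            ∫⁻ ω, ∫⁻ ξ, ENNReal.ofReal ((f (Y ω) ξ - ∫ ζ, f (Y ω) ζ ∂law) ^ 2) ∂law ∂μ) := by
  set M : V → ℝ := fun x => ∫ ξ, f x ξ ∂law with hM
  have hMm : Measurable M := (hfm.stronglyMeasurable.integral_prod_right').measurable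
  have hi : ∀ x, Integrable (f x) law := fun x => (hf x).integrable one_le_two
  have hfY : ∀ (π : V × V × ℝ → V), Measurable π →
      Measurable fun w : (V × V × ℝ) × Ξ => f (π w.1) w.2 := fun π hπ =>
    hfm.comp ((hπ.comp measurable_fst).prodMk measurable_snd)
  -- For frozen `(X, Y, e)` the new error is `β (e - M X)` plus the batch averages of `g₁` and `g₂`,
  -- both centered: the means subtracted here are what turns `- M Y` into `- β M X`.
  set g₁ : V × V × ℝ → Ξ → ℝ := fun z ξ => β * (f z.2.1 ξ - f z.1 ξ - (M z.2.1 - M z.1)) with hg₁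
  set g₂ : V × V × ℝ → Ξ → ℝ := fun z ξ => (1 - β) * (f z.2.1 ξ - M z.2.1) with hg₂
  have key := lintegral_sq_add_batchAvg_comp_le (law := law) hB₁ hB₂ (hX.prodMk (hY.prodMk he))
    h1 h2 hκ hm hind (g₁ := g₁) (g₂ := g₂) (a := fun z => β * (z.2.2 - M z.1))
    (by
      refine Measurable.const_mul (Measurable.sub (Measurable.sub ?_ ?_) (Measurable.sub ?_ ?_)) β
      · exact hfY (fun z => z.2.1) (by fun_prop)
      · exact hfY (fun z => z.1) (by fun_prop)
      · fun_prop
      · fun_prop)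
    (by
      refine Measurable.const_mul (Measurable.sub ?_ ?_) (1 - β)
      · exact hfY (fun z => z.2.1) (by fun_prop)
      · fun_prop)
    (fun z => (((hf _).sub (hf _)).sub (memLp_const _)).const_mul β)
    (fun z => ((hf _).sub (memLp_const _)).const_mul (1 - β))
    (fun z => by
      have hs : Integrable (fun ξ => f z.2.1 ξ - f z.1 ξ) law := (hi _).sub (hi _)
      simp only [hg₁]
      rw [integral_const_mul, integral_sub hs (integrable_const _), integral_sub (hi _) (hi _)]
      simp [hM])
    (fun z => by
      simp only [hg₂]
      rw [integral_const_mul, integral_sub (hi _) (integrable_const _)]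
      simp [hM])
    (by fun_prop)
  have hm' : (m : ℝ) ≠ 0 := by positivity
  have hl : ∀ ω, β * e ω + β / m * ∑ i, (f (Y ω) (B₁ ω i) - f (X ω) (B₁ ω i))
        + (1 - β) / m * ∑ i, f (Y ω) (B₂ ω i) - M (Y ω)
      = β * (e ω - M (X ω)) + batchAvg (g₁ (X ω, Y ω, e ω)) (B₁ ω)
        + batchAvg (g₂ (X ω, Y ω, e ω)) (B₂ ω) := by
    intro ω
    simp only [batchAvg, hg₁, hg₂, ← Finset.mul_sum, Finset.sum_sub_distrib, Finset.sum_const,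
      Finset.card_univ, Fintype.card_fin, nsmul_eq_mul]
    field_simp
    ring
  have hMM : ∀ x, ∫ ξ, f x ξ ∂law = M x := fun _ => rfl
  simp only [hMM, hl]
  refine key.trans ?_
  have r0 : ∫⁻ ω, ENNReal.ofReal ((β * (e ω - M (X ω))) ^ 2) ∂μ
      = ENNReal.ofReal (β ^ 2) * ∫⁻ ω, ENNReal.ofReal ((e ω - M (X ω)) ^ 2) ∂μ := by
    rw [← lintegral_const_mul' _ _ ENNReal.ofReal_ne_top]
    congr 1; ext ω
    rw [mul_pow, ENNReal.ofReal_mul (by positivity)]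
  have r1 : ∫⁻ ω, ∫⁻ ξ, ENNReal.ofReal (g₁ (X ω, Y ω, e ω) ξ ^ 2) ∂law ∂μ
      ≤ ENNReal.ofReal (β ^ 2) *
        ∫⁻ ω, ∫⁻ ξ, ENNReal.ofReal ((f (Y ω) ξ - f (X ω) ξ) ^ 2) ∂law ∂μ := by
    rw [← lintegral_const_mul' _ _ ENNReal.ofReal_ne_top]
    refine lintegral_mono fun ω => ?_
    have hs : MemLp (fun ξ => f (Y ω) ξ - f (X ω) ξ) 2 law := (hf _).sub (hf _)
    have hs2 := hs.integrable_sq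
    have hg : MemLp (fun ξ => f (Y ω) ξ - f (X ω) ξ - (M (Y ω) - M (X ω))) 2 law :=
      hs.sub (memLp_const _)
    -- Centering the increment only lowers its second moment.
    have hle : ∫ ξ, (f (Y ω) ξ - f (X ω) ξ - (M (Y ω) - M (X ω))) ^ 2 ∂law
        ≤ ∫ ξ, (f (Y ω) ξ - f (X ω) ξ) ^ 2 ∂law := by
      have hmean : ∫ ξ, (f (Y ω) ξ - f (X ω) ξ) ∂law = M (Y ω) - M (X ω) :=
        integral_sub (hi _) (hi _)
      rw [← hmean, ← variance_eq_integral hs.aemeasurable]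
      exact variance_le_expectation_sq hs.aestronglyMeasurable
    simp only [hg₁, mul_pow]
    rw [lintegral_congr fun ξ => ENNReal.ofReal_mul (sq_nonneg β),
      lintegral_const_mul' _ _ ENNReal.ofReal_ne_top,
      ← ofReal_integral_eq_lintegral_ofReal hs2 (Filter.Eventually.of_forall fun _ => sq_nonneg _),
      ← ofReal_integral_eq_lintegral_ofReal hg.integrable_sq
        (Filter.Eventually.of_forall fun _ => sq_nonneg _)]
    gcongr
  have r2 : ∫⁻ ω, ∫⁻ ξ, ENNReal.ofReal (g₂ (X ω, Y ω, e ω) ξ ^ 2) ∂law ∂μ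
      = ENNReal.ofReal ((1 - β) ^ 2) *
        ∫⁻ ω, ∫⁻ ξ, ENNReal.ofReal ((f (Y ω) ξ - M (Y ω)) ^ 2) ∂law ∂μ := by
    rw [← lintegral_const_mul' _ _ ENNReal.ofReal_ne_top]
    refine lintegral_congr fun ω => ?_
    simp only [hg₂, mul_pow]
    rw [lintegral_congr fun ξ => ENNReal.ofReal_mul (sq_nonneg (1 - β)),
      lintegral_const_mul' _ _ ENNReal.ofReal_ne_top]
  rw [r0, r2]
  gcongr

/-- The variance of the sample average. -/
lemma lintegral_batchAvg_sub_sq {B : Ω → Fin m → Ξ} (hB : Measurable B)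
    (h1 : μ.map B = Measure.pi fun _ => law) (hm : 0 < m) {f : Ξ → ℝ} (hfm : Measurable f)
    (hf : MemLp f 2 law) :
    ∫⁻ ω, ENNReal.ofReal (((m : ℝ)⁻¹ * ∑ i, f (B ω i) - ∫ ξ, f ξ ∂law) ^ 2) ∂μ
      = ENNReal.ofReal (m : ℝ)⁻¹ *
        ∫⁻ ξ, ENNReal.ofReal ((f ξ - ∫ ζ, f ζ ∂law) ^ 2) ∂law := by
  set c := ∫ ξ, f ξ ∂law with hc
  have hgm : Measurable fun ξ => f ξ - c := hfm.sub_const c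
  have hg : MemLp (fun ξ => f ξ - c) 2 law := hf.sub (memLp_const c)
  have h0 : ∫ ξ, (f ξ - c) ∂law = 0 := by
    rw [integral_sub (hf.integrable one_le_two) (integrable_const c)]
    simp [hc]
  have key := integral_batchAvg_sq hgm hg h0 hm
  have hm' : (m : ℝ) ≠ 0 := by positivity
  have hl : ∀ ω, (m : ℝ)⁻¹ * ∑ i, f (B ω i) - c = batchAvg (fun ξ => f ξ - c) (B ω) := by
    intro ω
    simp only [batchAvg, Finset.sum_sub_distrib, Finset.sum_const, Finset.card_univ,
      Fintype.card_fin, nsmul_eq_mul]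
    field_simp
  simp only [hl]
  rw [← lintegral_map (f := fun B : Fin m → Ξ => ENNReal.ofReal (batchAvg (fun ξ => f ξ - c) B ^ 2))
    ((measurable_batchAvg hgm).pow_const 2).ennreal_ofReal hB, h1,
    ← ofReal_integral_eq_lintegral_ofReal (memLp_batchAvg hg).integrable_sq
      (Filter.Eventually.of_forall fun _ => sq_nonneg _), key,
    ← ofReal_integral_eq_lintegral_ofReal hg.integrable_sq
      (Filter.Eventually.of_forall fun _ => sq_nonneg _), ENNReal.ofReal_mul (by positivity)]

end Variance

/-! ### Measurability of scaled sums over a batch. -/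

section MeasurableSmul

variable {α V : Type*} [MeasurableSpace α] [MeasurableSpace V]

lemma measurable_real_smul [SMul ℝ V] [MeasurableConstSMul ℝ V] (c : ℝ) {g : α → V} (hg : Measurable g) :
    Measurable fun a => c • g a := hg.const_smul c

lemma measurable_real_smul_sum [AddCommMonoid V] [SMul ℝ V] [MeasurableConstSMul ℝ V]
    [MeasurableAdd₂ V] {m : ℕ} (c : ℝ) {g : Fin m → α → V}
    (hg : ∀ i, Measurable (g i)) : Measurable fun a => c • ∑ i, g i a := by
  refine measurable_real_smul c ?_
  simpa only [Finset.sum_apply] using Finset.measurable_sum Finset.univ fun i _ => hg i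

lemma measurable_batch_eval {Ξ : Type*} [MeasurableSpace Ξ] {m : ℕ} {B : α → Fin m → Ξ}
    (hB : Measurable B) (i : Fin m) : Measurable fun a => B a i :=
  (measurable_pi_apply i).comp hB

end MeasurableSmul

/-! ### Vector-valued estimators, coordinate by coordinate. -/

section VectorVariance

variable {Ξ : Type*} [MeasurableSpace Ξ] {law : Measure Ξ} {m : ℕ}
  {Ω : Type*} [MeasurableSpace Ω] {μ : Measure Ω} {ι : Type*} [Fintype ι]

lemma ofReal_norm_sq_eq_sum (v : EuclideanSpace ℝ ι) :
    ENNReal.ofReal (‖v‖ ^ 2) = ∑ k, ENNReal.ofReal (v k ^ 2) := by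
  rw [EuclideanSpace.norm_sq_eq, ENNReal.ofReal_sum_of_nonneg fun _ _ => by positivity]
  simp

lemma integral_apply_eq {g : Ξ → EuclideanSpace ℝ ι} (hg : Integrable g law) (k : ι) :
    (∫ ξ, g ξ ∂law) k = ∫ ξ, g ξ k ∂law :=
  ((EuclideanSpace.proj k : EuclideanSpace ℝ ι →L[ℝ] ℝ).integral_comp_comm hg).symm

lemma memLp_apply {g : Ξ → EuclideanSpace ℝ ι} (hg : MemLp g 2 law) (k : ι) :
    MemLp (fun ξ => g ξ k) 2 law :=
  (EuclideanSpace.proj k : EuclideanSpace ℝ ι →L[ℝ] ℝ).comp_memLp' hg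

lemma measurable_apply {α : Type*} [MeasurableSpace α] {g : α → EuclideanSpace ℝ ι}
    (hg : Measurable g) (k : ι) : Measurable fun a => g a k :=
  (EuclideanSpace.proj k : EuclideanSpace ℝ ι →L[ℝ] ℝ).continuous.measurable.comp hg

lemma lintegral_norm_sq_eq_sum {α : Type*} [MeasurableSpace α] {ρ : Measure α}
    {g : α → EuclideanSpace ℝ ι} (hg : Measurable g) :
    ∫⁻ a, ENNReal.ofReal (‖g a‖ ^ 2) ∂ρ = ∑ k, ∫⁻ a, ENNReal.ofReal (g a k ^ 2) ∂ρ := by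
  simp_rw [ofReal_norm_sq_eq_sum]
  exact lintegral_finsetSum _ fun k _ =>
    ((measurable_apply hg k).pow_const 2).ennreal_ofReal

/-- The variance recursion of the hybrid estimator of the mean of a random vector function. -/
lemma lintegral_hybrid_norm_sq_le [IsProbabilityMeasure law]
    [IsProbabilityMeasure μ] {V : Type*} [MeasurableSpace V]
    {B₁ B₂ : Ω → Fin m → Ξ} {X Y : Ω → V} {e : Ω → EuclideanSpace ℝ ι}
    (hB₁ : Measurable B₁) (hB₂ : Measurable B₂) (hX : Measurable X) (hY : Measurable Y)
    (he : Measurable e)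
    (h1 : μ.map B₁ = Measure.pi fun _ => law) (h2 : μ.map B₂ = Measure.pi fun _ => law) {κ : ℝ}
    (hκ : κ = 2 ∨ (κ = 1 ∧ IndepFun B₁ B₂ μ)) (hm : 0 < m)
    (hind : IndepFun (fun ω => (B₁ ω, B₂ ω)) (fun ω => (X ω, Y ω, e ω)) μ)
    {f : V → Ξ → EuclideanSpace ℝ ι}
    (hfm : Measurable (Function.uncurry f)) (hf : ∀ x, MemLp (f x) 2 law) (β : ℝ) :
    ∫⁻ ω, ENNReal.ofReal (‖β • e ω + (β / m) • ∑ i, (f (Y ω) (B₁ ω i) - f (X ω) (B₁ ω i))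
        + ((1 - β) / m) • ∑ i, f (Y ω) (B₂ ω i) - ∫ ξ, f (Y ω) ξ ∂law‖ ^ 2) ∂μ
      ≤ ENNReal.ofReal (β ^ 2) * ∫⁻ ω, ENNReal.ofReal (‖e ω - ∫ ξ, f (X ω) ξ ∂law‖ ^ 2) ∂μ
        + ENNReal.ofReal (κ / m) *
        (ENNReal.ofReal (β ^ 2) *
            ∫⁻ ω, ∫⁻ ξ, ENNReal.ofReal (‖f (Y ω) ξ - f (X ω) ξ‖ ^ 2) ∂law ∂μ
          + ENNReal.ofReal ((1 - β) ^ 2) *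
            ∫⁻ ω, ∫⁻ ξ, ENNReal.ofReal (‖f (Y ω) ξ - ∫ ζ, f (Y ω) ζ ∂law‖ ^ 2) ∂law ∂μ) := by
  have hi : ∀ x, Integrable (f x) law := fun x => (hf x).integrable one_le_two
  have hM : Measurable fun x => ∫ ξ, f x ξ ∂law :=
    (hfm.stronglyMeasurable.integral_prod_right').measurable
  have hfX : ∀ {W : Ω → V}, Measurable W → Measurable fun w : Ω × Ξ => f (W w.1) w.2 :=
    fun hW => hfm.comp ((hW.comp measurable_fst).prodMk measurable_snd)
  have hfB : ∀ {W : Ω → V} {B : Ω → Fin m → Ξ}, Measurable W → Measurable B → ∀ i,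
      Measurable fun ω => f (W ω) (B ω i) := fun hW hB i =>
    hfm.comp (hW.prodMk (measurable_batch_eval hB i))
  have mL : Measurable fun ω => β • e ω + (β / m) • ∑ i, (f (Y ω) (B₁ ω i) - f (X ω) (B₁ ω i))
        + ((1 - β) / m) • ∑ i, f (Y ω) (B₂ ω i) - ∫ ξ, f (Y ω) ξ ∂law := by
    refine Measurable.sub (Measurable.add (Measurable.add (measurable_real_smul β he) ?_) ?_) (hM.comp hY)
    · exact measurable_real_smul_sum _ fun i => (hfB hY hB₁ i).sub (hfB hX hB₁ i)
    · exact measurable_real_smul_sum _ fun i => hfB hY hB₂ i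
  have mE : Measurable fun ω => e ω - ∫ ξ, f (X ω) ξ ∂law := he.sub (hM.comp hX)
  have mD : Measurable fun w : Ω × Ξ => f (Y w.1) w.2 - f (X w.1) w.2 := (hfX hY).sub (hfX hX)
  have mS : Measurable fun w : Ω × Ξ => f (Y w.1) w.2 - ∫ ζ, f (Y w.1) ζ ∂law :=
    (hfX hY).sub ((hM.comp hY).comp measurable_fst)
  have dbl : ∀ {g : Ω → Ξ → EuclideanSpace ℝ ι}, Measurable (Function.uncurry g) →
      ∫⁻ ω, ∫⁻ ξ, ENNReal.ofReal (‖g ω ξ‖ ^ 2) ∂law ∂μ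
        = ∑ k, ∫⁻ ω, ∫⁻ ξ, ENNReal.ofReal (g ω ξ k ^ 2) ∂law ∂μ := by
    intro g hg
    rw [← lintegral_finsetSum]
    · exact lintegral_congr fun ω => lintegral_norm_sq_eq_sum (hg.comp measurable_prodMk_left)
    · intro k _
      exact Measurable.lintegral_prod_right'
        (f := fun z : Ω × Ξ => ENNReal.ofReal (g z.1 z.2 k ^ 2))
        ((measurable_apply hg k).pow_const 2).ennreal_ofReal
  rw [lintegral_norm_sq_eq_sum mL, lintegral_norm_sq_eq_sum mE, dbl (g := fun ω ξ => f (Y ω) ξ - f (X ω) ξ) mD,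
    dbl (g := fun ω ξ => f (Y ω) ξ - ∫ ζ, f (Y ω) ζ ∂law) mS,
    Finset.mul_sum, Finset.mul_sum, Finset.mul_sum, ← Finset.sum_add_distrib, Finset.mul_sum,
    ← Finset.sum_add_distrib]
  -- Every term is a squared norm, hence a sum over coordinates, and the scalar bound is linear in
  -- these terms with coefficients independent of `k`.
  refine Finset.sum_le_sum fun k _ => ?_
  have hindk : IndepFun (fun ω => (B₁ ω, B₂ ω)) (fun ω => (X ω, Y ω, e ω k)) μ :=
    hind.comp (φ := id) (ψ := fun z : V × V × EuclideanSpace ℝ ι => (z.1, z.2.1, z.2.2 k))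
      measurable_id (measurable_fst.prodMk ((measurable_fst.comp measurable_snd).prodMk
        (measurable_apply (measurable_snd.comp measurable_snd) k)))
  have key := lintegral_hybrid_sq_le hB₁ hB₂ hX hY (measurable_apply he k) h1 h2 hκ hm hindk
    (f := fun x ξ => f x ξ k) (measurable_apply hfm k) (fun x => memLp_apply (hf x) k) β
  simp only [PiLp.sub_apply, PiLp.add_apply, PiLp.smul_apply, smul_eq_mul,
    integral_apply_eq (hi _)]
  simpa using key

lemma lintegral_average_sub_norm_sq [IsProbabilityMeasure law] {B : Ω → Fin m → Ξ} (hB : Measurable B)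
    (h1 : μ.map B = Measure.pi fun _ => law) (hm : 0 < m) {f : Ξ → EuclideanSpace ℝ ι}
    (hfm : Measurable f) (hf : MemLp f 2 law) :
    ∫⁻ ω, ENNReal.ofReal (‖(m : ℝ)⁻¹ • ∑ i, f (B ω i) - ∫ ξ, f ξ ∂law‖ ^ 2) ∂μ
      = ENNReal.ofReal (m : ℝ)⁻¹ *
        ∫⁻ ξ, ENNReal.ofReal (‖f ξ - ∫ ζ, f ζ ∂law‖ ^ 2) ∂law := by
  have hi : Integrable f law := hf.integrable one_le_two
  have mL : Measurable fun ω => (m : ℝ)⁻¹ • ∑ i, f (B ω i) - ∫ ξ, f ξ ∂law :=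
    (measurable_real_smul_sum _ fun i => hfm.comp (measurable_batch_eval hB i)).sub_const _
  rw [lintegral_norm_sq_eq_sum mL, lintegral_norm_sq_eq_sum (hfm.sub_const _), Finset.mul_sum]
  refine Finset.sum_congr rfl fun k _ => ?_
  have key := lintegral_batchAvg_sub_sq hB h1 hm (measurable_apply hfm k) (memLp_apply hf k)
  simp only [PiLp.sub_apply, PiLp.smul_apply, smul_eq_mul, integral_apply_eq hi]
  simpa using key

end VectorVariance

/-! ### Matrices as Euclidean vectors. -/

section Vectorization

variable {p q : ℕ}

/-- The entries of a matrix as a vector; the Euclidean norm becomes the Frobenius norm. -/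
noncomputable def vec : (E p →L[ℝ] E q) →L[ℝ] EuclideanSpace ℝ (Fin p × Fin q) :=
  LinearMap.toContinuousLinearMap
    { toFun := fun A => WithLp.toLp 2 fun jk => A (EuclideanSpace.single jk.1 1) jk.2
      map_add' := fun A B => by ext; simp
      map_smul' := fun c A => by ext; simp }

lemma vec_apply (A : E p →L[ℝ] E q) (jk : Fin p × Fin q) :
    vec A jk = A (EuclideanSpace.single jk.1 1) jk.2 := rfl

lemma norm_vec_sq (A : E p →L[ℝ] E q) : ‖vec A‖ ^ 2 = frobSq A := by
  rw [EuclideanSpace.norm_sq_eq, frobSq_eq_sum, Fintype.sum_prod_type]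
  simp [vec_apply]

end Vectorization

/-! ### Extension of `F` and its Jacobian by zero, so that measurability and moments hold at all
points. -/

namespace Problem

variable {p q n : ℕ} {Ξ : Type*} [MeasurableSpace Ξ] {D : Problem p q n Ξ} {C : Constants}

/-- The function `F`, extended by zero outside of the domain of `R`. -/
noncomputable def domF (D : Problem p q n Ξ) (x : E p) (ξ : Ξ) : E q :=
  (effDom D.R).indicator (fun x => D.F x ξ) x

/-- The vectorized Jacobian of `F`, extended by zero outside of the domain of `R`. -/
noncomputable def domJac (D : Problem p q n Ξ) (x : E p) (ξ : Ξ) :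
    EuclideanSpace ℝ (Fin p × Fin q) :=
  vec ((effDom D.R).indicator (fun x => D.jac x ξ) x)

lemma domF_eq {x : E p} (hx : x ∈ effDom D.R) (ξ : Ξ) : D.domF x ξ = D.F x ξ := by
  simp [domF, hx]

lemma domJac_eq {x : E p} (hx : x ∈ effDom D.R) (ξ : Ξ) : D.domJac x ξ = vec (D.jac x ξ) := by
  simp [domJac, hx]

lemma measurable_domF (hD : D.Standing) : Measurable (Function.uncurry D.domF) := by
  have h : Function.uncurry D.domF = {z : E p × Ξ | z.1 ∈ effDom D.R}.indicator
      (Function.uncurry D.F) := by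
    ext1 z
    by_cases hz : z.1 ∈ effDom D.R <;> simp [Function.uncurry, domF, hz]
  rw [h]
  exact hD.measurable_F.indicator (measurable_fst hD.R_pcc.measurableSet_effDom)

lemma measurable_domJac (hD : D.Standing) (hdom : effDom D.Psi0 = effDom D.R) :
    Measurable (Function.uncurry D.domJac) :=
  vec.continuous.measurable.comp (measurable_jac_clm_indicator hD hdom)

lemma memLp_domF (hD : D.Standing) (hF : D.AssumptionF C) (hdom : effDom D.Psi0 = effDom D.R)
    (x : E p) : MemLp (D.domF x) 2 D.law := by
  by_cases hx : x ∈ effDom D.R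
  · rw [show D.domF x = D.F x from funext (domF_eq hx)]
    exact memLp_F hD hF (by rwa [hdom])
  · have h : D.domF x = 0 := by ext1 ξ; simp [domF, hx]
    rw [h]; exact MemLp.zero

lemma memLp_domJac (hD : D.Standing) (hF : D.AssumptionF C) (hdom : effDom D.Psi0 = effDom D.R)
    (x : E p) : MemLp (D.domJac x) 2 D.law := by
  by_cases hx : x ∈ effDom D.R
  · rw [show D.domJac x = fun ξ => vec (D.jac x ξ) from funext (domJac_eq hx)]
    exact vec.comp_memLp' (memLp_jac hD hF hdom hx)
  · have h : D.domJac x = 0 := by ext1 ξ; simp [domJac, hx]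
    rw [h]; exact MemLp.zero

lemma integral_domF {x : E p} (hx : x ∈ effDom D.R) : ∫ ξ, D.domF x ξ ∂D.law = D.meanF x := by
  simp only [domF_eq hx, meanF]

lemma integral_domJac (hD : D.Standing) (hF : D.AssumptionF C)
    (hdom : effDom D.Psi0 = effDom D.R) {x : E p} (hx : x ∈ effDom D.R) :
    ∫ ξ, D.domJac x ξ ∂D.law = vec (D.meanJac x) := by
  simp only [domJac_eq hx, meanJac]
  exact vec.integral_comp_comm (integrable_jac hD hF hdom hx)

end Problem

/-! ### Measurability of the iterates. -/

section RunMeasurability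

variable {p q n : ℕ} {Ξ Ω : Type*} [MeasurableSpace Ξ] {D : Problem p q n Ξ} {C : Constants}
  {A : Params} {S : Batches Ω Ξ A} {θ η : ℝ} {x₀ : E p}

open Problem

/-- The σ-algebra on `Ω` is left free, so that the result serves both the ambient one and the one
generated by the past samples. -/
lemma measurable_proxStep {m : MeasurableSpace Ω} (hD : D.Standing)
    (hψ : D.AssumptionPsi C) (hd : D.AssumptionSmoothing) {γ : ℝ} (hγ : 0 < γ) (hη : 0 < η)
    {s : Ω → State p q} (hx : Measurable fun ω => (s ω).x) (hFe : Measurable fun ω => (s ω).Fe)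
    (hJe : Measurable fun ω => (s ω).Je) :
    Measurable fun ω => prox η D.R ((s ω).x - η • D.gradEst γ (s ω)) := by
  have hc : Continuous fun z : E p × E q × (E p →L[ℝ] E q) =>
      z.1 - η • ContinuousLinearMap.adjoint z.2.2 (D.K (D.yStar γ z.2.1)) := by
    have h1 : Continuous fun z : E p × E q × (E p →L[ℝ] E q) =>
        ContinuousLinearMap.adjoint z.2.2 :=
      (LinearIsometryEquiv.continuous _).comp (by fun_prop)
    have h2 : Continuous fun z : E p × E q × (E p →L[ℝ] E q) => D.K (D.yStar γ z.2.1) :=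
      D.K.continuous.comp ((continuous_yStar hψ hd hγ).comp (by fun_prop))
    exact continuous_fst.sub ((h1.clm_apply h2).const_smul η)
  have hm : Measurable fun z : E p × E q × (E p →L[ℝ] E q) =>
      z.1 - η • ContinuousLinearMap.adjoint z.2.2 (D.K (D.yStar γ z.2.1)) := hc.measurable
  have hz : Measurable fun ω => ((s ω).x, (s ω).Fe, (s ω).Je) := hx.prodMk (hFe.prodMk hJe)
  have hv : Measurable fun ω => (s ω).x - η • D.gradEst γ (s ω) := hm.comp hz
  exact (continuous_prox hD.R_pcc hη).measurable.comp hv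

lemma measurable_nextPoint {m : MeasurableSpace Ω} (hD : D.Standing)
    (hψ : D.AssumptionPsi C) (hd : D.AssumptionSmoothing) {γ : ℝ} (hγ : 0 < γ) (hη : 0 < η)
    {s : Ω → State p q} (hx : Measurable fun ω => (s ω).x) (hFe : Measurable fun ω => (s ω).Fe)
    (hJe : Measurable fun ω => (s ω).Je) :
    Measurable fun ω => nextPoint D θ η γ (s ω) :=
  (measurable_real_smul (1 - θ) hx).add
    (measurable_real_smul θ (measurable_proxStep hD hψ hd hγ hη hx hFe hJe))

/-- The states of the algorithm are measurable with respect to the samples drawn. -/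
lemma measurable_run {m : MeasurableSpace Ω} (hD : D.Standing)
    (hψ : D.AssumptionPsi C) (hd : D.AssumptionSmoothing) (hγ : 0 < A.γ) (hη : 0 < η)
    (hθ : θ ∈ Set.Ioc (0 : ℝ) 1) (hx₀ : x₀ ∈ effDom D.R) (hF0 : Measurable S.F0)
    (hJ0 : Measurable S.J0) {t : ℕ} (h : ∀ s < t, Measurable (S.F1 s) ∧ Measurable (S.F2 s) ∧
      Measurable (S.J1 s) ∧ Measurable (S.J2 s)) :
    Measurable (fun ω => (run D S θ η x₀ t ω).x) ∧
    Measurable (fun ω => (run D S θ η x₀ t ω).Fe) ∧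
    Measurable (fun ω => (run D S θ η x₀ t ω).Je) := by
  have hdom := effDom_Psi0 hD hψ hd
  have ev : ∀ {k : ℕ} {B : Ω → Fin k → Ξ}, Measurable B → ∀ i, Measurable fun ω => B ω i :=
    fun hB i => measurable_batch_eval hB i
  have mF : ∀ {x : Ω → E p} {b : Ω → Ξ}, Measurable x → Measurable b →
      Measurable fun ω => D.F (x ω) (b ω) := fun hx hb => hD.measurable_F.comp (hx.prodMk hb)
  have mJ : ∀ {x : Ω → E p} {b : Ω → Ξ}, Measurable x → (∀ ω, x ω ∈ effDom D.R) →
      Measurable b → Measurable fun ω => D.jac (x ω) (b ω) := by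
    intro x b hx hxd hb
    have := (measurable_jac_clm_indicator hD hdom).comp (hx.prodMk hb)
    simpa [Function.comp_def, hxd] using this
  induction t with
  | zero =>
    refine ⟨measurable_const, ?_, ?_⟩
    · exact measurable_real_smul_sum _ fun i => mF measurable_const (ev hF0 i)
    · exact measurable_real_smul_sum _ fun i => mJ measurable_const (fun _ => hx₀) (ev hJ0 i)
  | succ t ih =>
    obtain ⟨ix, iF, iJ⟩ := ih fun s hs => h s (hs.trans t.lt_succ_self)
    obtain ⟨h1, h2, h3, h4⟩ := h t t.lt_succ_self
    have hy := measurable_nextPoint (θ := θ) hD hψ hd hγ hη ix iF iJ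
    have hyd : ∀ ω, nextPoint D θ η A.γ (run D S θ η x₀ t ω) ∈ effDom D.R :=
      fun ω => run_mem hD hη hθ hx₀ (t + 1) ω
    have hxd : ∀ ω, (run D S θ η x₀ t ω).x ∈ effDom D.R := run_mem hD hη hθ hx₀ t
    refine ⟨hy, ?_, ?_⟩
    · refine Measurable.add (Measurable.add (measurable_real_smul _ iF) ?_) ?_
      · exact measurable_real_smul_sum _ fun i => (mF hy (ev h1 i)).sub (mF ix (ev h1 i))
      · exact measurable_real_smul_sum _ fun i => mF hy (ev h2 i)
    · refine Measurable.add (Measurable.add (measurable_real_smul _ iJ) ?_) ?_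
      · exact measurable_real_smul_sum _ fun i =>
          (mJ hy hyd (ev h3 i)).sub (mJ ix hxd (ev h3 i))
      · exact measurable_real_smul_sum _ fun i => mJ hy hyd (ev h4 i)

end RunMeasurability

/-- Measurability with respect to the generated σ-algebras suffices, so the iterates need not be
written as explicit functions of the samples. -/
lemma indepFun_of_comap {Ω α β α' β' : Type*} [MeasurableSpace Ω] [MeasurableSpace α]
    [MeasurableSpace β] [MeasurableSpace α'] [MeasurableSpace β'] {μ : Measure Ω} {X : Ω → α}
    {Y : Ω → β} {X' : Ω → α'} {Y' : Ω → β'} (h : IndepFun X Y μ)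
    (hX : Measurable[MeasurableSpace.comap X inferInstance] X')
    (hY : Measurable[MeasurableSpace.comap Y inferInstance] Y') : IndepFun X' Y' μ := by
  rw [IndepFun_iff_Indep] at h ⊢
  exact indep_of_indep_of_le_left (indep_of_indep_of_le_right h hY.comap_le) hX.comap_le

/-! ### Measurability of the batches and the factors `κ`, `κ̂`. -/

namespace Batches

variable {Ω Ξ : Type*} [MeasurableSpace Ξ] {A : Params} {S : Batches Ω Ξ A}

lemma measurable_of_block {m : MeasurableSpace Ω} {t : ℕ} (h : Measurable (S.block t)) :
    Measurable (S.F1 t) ∧ Measurable (S.F2 t) ∧ Measurable (S.J1 t) ∧ Measurable (S.J2 t) :=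
  ⟨h.fst, h.snd.fst, h.snd.snd.fst, h.snd.snd.snd⟩

lemma measurable_block_comap_past (S : Batches Ω Ξ A) {s t : ℕ} (hs : s < t) :
    Measurable[MeasurableSpace.comap (S.past t) inferInstance] (S.block s) :=
  (measurable_pi_apply (⟨s, hs⟩ : Fin t)).comp
    (measurable_snd.comp (comap_measurable (S.past t)))

variable [MeasurableSpace Ω]

lemma kappa_spec (S : Batches Ω Ξ A) (μ : Measure Ω) {t : ℕ} (ht : t < A.T) :
    S.kappa μ = 2 ∨ (S.kappa μ = 1 ∧ IndepFun (S.F1 t) (S.F2 t) μ) := by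
  unfold kappa
  split_ifs with h
  · exact Or.inr ⟨rfl, h t ht⟩
  · exact Or.inl rfl

lemma kappaHat_spec (S : Batches Ω Ξ A) (μ : Measure Ω) {t : ℕ} (ht : t < A.T) :
    S.kappaHat μ = 2 ∨ (S.kappaHat μ = 1 ∧ IndepFun (S.J1 t) (S.J2 t) μ) := by
  unfold kappaHat
  split_ifs with h
  · exact Or.inr ⟨rfl, h t ht⟩
  · exact Or.inl rfl

lemma one_le_kappa (S : Batches Ω Ξ A) (μ : Measure Ω) : 1 ≤ S.kappa μ := by
  unfold kappa; split_ifs <;> norm_num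

lemma one_le_kappaHat (S : Batches Ω Ξ A) (μ : Measure Ω) : 1 ≤ S.kappaHat μ := by
  unfold kappaHat; split_ifs <;> norm_num

end Batches

/-! ### The variance recursion along the algorithm. -/

section Recursion

variable {p q n : ℕ} {Ξ Ω : Type*} [MeasurableSpace Ξ] {D : Problem p q n Ξ} {C : Constants}
  {A : Params} {S : Batches Ω Ξ A} {θ η : ℝ} {x₀ : E p}

open Problem

/-- Taking `comap (S.past t)` as the σ-algebra makes the first `t` states functions of past samples,
hence independent of the block drawn next. -/
lemma measurable_run_past (hD : D.Standing) (hψ : D.AssumptionPsi C)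
    (hd : D.AssumptionSmoothing) (hγ : 0 < A.γ) (hη : 0 < η) (hθ : θ ∈ Set.Ioc (0 : ℝ) 1)
    (hx₀ : x₀ ∈ effDom D.R) (S : Batches Ω Ξ A) {s t : ℕ} (hst : s ≤ t) :
    Measurable[MeasurableSpace.comap (S.past t) inferInstance]
      (fun ω => (run D S θ η x₀ s ω).x) ∧
    Measurable[MeasurableSpace.comap (S.past t) inferInstance]
      (fun ω => (run D S θ η x₀ s ω).Fe) ∧
    Measurable[MeasurableSpace.comap (S.past t) inferInstance]
      (fun ω => (run D S θ η x₀ s ω).Je) := by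
  refine measurable_run (m := MeasurableSpace.comap (S.past t) inferInstance) hD hψ hd hγ hη hθ
    hx₀ ?_ ?_ fun r hr => ?_
  · exact measurable_fst.comp (measurable_fst.comp (comap_measurable (S.past t)))
  · exact measurable_snd.comp (measurable_fst.comp (comap_measurable (S.past t)))
  · have h := S.measurable_block_comap_past (hr.trans_le hst)
    exact ⟨measurable_fst.comp h, measurable_fst.comp (measurable_snd.comp h),
      measurable_fst.comp (measurable_snd.comp (measurable_snd.comp h)),
      measurable_snd.comp (measurable_snd.comp (measurable_snd.comp h))⟩

variable [MeasurableSpace Ω] {μ : Measure Ω}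

lemma measurable_run_sampling (hD : D.Standing) (hψ : D.AssumptionPsi C)
    (hd : D.AssumptionSmoothing)
    (hγ : 0 < A.γ) (hη : 0 < η) (hθ : θ ∈ Set.Ioc (0 : ℝ) 1) (hx₀ : x₀ ∈ effDom D.R)
    (hS : S.IsSampling μ D.law) {t : ℕ} (ht : t ≤ A.T) :
    Measurable (fun ω => (run D S θ η x₀ t ω).x) ∧
    Measurable (fun ω => (run D S θ η x₀ t ω).Fe) ∧
    Measurable (fun ω => (run D S θ η x₀ t ω).Je) :=
  measurable_run hD hψ hd hγ hη hθ hx₀ hS.meas_F0 hS.meas_J0 fun s hs =>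
    Batches.measurable_of_block (hS.meas_block s (hs.trans_le ht))

/-- The hybrid recursion with `X = x_t`, `Y = x_{t+1}` and the current estimator, all determined by
the past. The increment of `F` is controlled by `M_F` and `‖x_{t+1} - x_t‖² = θ² stepSq`. -/
lemma lintegral_errF_succ_le [IsProbabilityMeasure μ] (hD : D.Standing) (hF : D.AssumptionF C)
    (hψ : D.AssumptionPsi C) (hd : D.AssumptionSmoothing) (hγ : 0 < A.γ) (hη : 0 < η)
    (hθ : θ ∈ Set.Ioc (0 : ℝ) 1) (hx₀ : x₀ ∈ effDom D.R) (hS : S.IsSampling μ D.law)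
    (hnF : 0 < A.nF) {t : ℕ} (ht : t < A.T) :
    ∫⁻ ω, ENNReal.ofReal (‖(run D S θ η x₀ (t + 1) ω).Fe
        - D.meanF (run D S θ η x₀ (t + 1) ω).x‖ ^ 2) ∂μ
      ≤ ENNReal.ofReal (A.β ^ 2) * ∫⁻ ω, ENNReal.ofReal (‖(run D S θ η x₀ t ω).Fe
          - D.meanF (run D S θ η x₀ t ω).x‖ ^ 2) ∂μ
        + ENNReal.ofReal (S.kappa μ / A.nF) *
        (ENNReal.ofReal (A.β ^ 2) * (ENNReal.ofReal (C.MF ^ 2 * θ ^ 2) *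
            ∫⁻ ω, ENNReal.ofReal (D.stepSq A.γ η (run D S θ η x₀ t ω)) ∂μ)
          + ENNReal.ofReal ((1 - A.β) ^ 2) * ENNReal.ofReal (C.σF ^ 2)) := by
  have hdom := effDom_Psi0 hD hψ hd
  have := hD.prob
  have hmem := run_mem (S := S) hD hη hθ hx₀
  obtain ⟨h1, h2, -, -⟩ := Batches.measurable_of_block (hS.meas_block t ht)
  obtain ⟨mX, mFe, mJe⟩ := measurable_run_sampling hD hψ hd hγ hη hθ hx₀ hS ht.le
  obtain ⟨mY, -, -⟩ := measurable_run_sampling hD hψ hd hγ hη hθ hx₀ hS ht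
  obtain ⟨pX, pFe, pJe⟩ := measurable_run_past hD hψ hd hγ hη hθ hx₀ S
    (le_refl t)
  have pY := measurable_nextPoint (θ := θ) hD hψ hd hγ hη pX pFe pJe
  have hB : Measurable[MeasurableSpace.comap (S.block t) inferInstance]
      fun ω => (S.F1 t ω, S.F2 t ω) := by
    have h : Measurable[MeasurableSpace.comap (S.block t) inferInstance] (S.block t) :=
      comap_measurable _
    exact (measurable_fst.comp h).prodMk (measurable_fst.comp (measurable_snd.comp h))
  have hind := indepFun_of_comap (hS.indep t ht) hB (pX.prodMk (pY.prodMk pFe))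
  have key := lintegral_hybrid_norm_sq_le h1 h2 mX mY mFe (hS.law_F1 t ht) (hS.law_F2 t ht)
    (S.kappa_spec μ ht) hnF hind (measurable_domF hD) (memLp_domF hD hF hdom) A.β
  -- The recursion was applied to the extension by zero, which satisfies its hypotheses everywhere;
  -- the iterates stay in the domain, so the original `F` can be restored.
  simp only [integral_domF (hmem t _), integral_domF (hmem (t + 1) _)] at key
  simp only [domF_eq (hmem t _), domF_eq (hmem (t + 1) _)] at key
  refine key.trans ?_
  gcongr
  · rw [← lintegral_const_mul' _ _ ENNReal.ofReal_ne_top]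
    refine lintegral_mono fun ω => ?_
    refine (lintegral_F_sub_sq_le hD hF hdom (hmem t ω) (hmem (t + 1) ω)).trans (le_of_eq ?_)
    rw [run_succ_x, norm_nextPoint_sub_sq, ← ENNReal.ofReal_mul (by positivity)]
    congr 1; ring
  · calc _ ≤ ∫⁻ _, ENNReal.ofReal (C.σF ^ 2) ∂μ :=
          lintegral_mono fun ω => hF.var_F _ (by rw [hdom]; exact hmem (t + 1) ω)
      _ = _ := by simp

/-- The same argument after `vec`; here average smoothness bounds the increment of the Jacobian
directly. -/
lemma lintegral_errJ_succ_le [IsProbabilityMeasure μ] (hD : D.Standing) (hF : D.AssumptionF C)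
    (hψ : D.AssumptionPsi C) (hd : D.AssumptionSmoothing) (hγ : 0 < A.γ) (hη : 0 < η)
    (hθ : θ ∈ Set.Ioc (0 : ℝ) 1) (hx₀ : x₀ ∈ effDom D.R) (hS : S.IsSampling μ D.law)
    (hb : 0 < A.b) {t : ℕ} (ht : t < A.T) :
    ∫⁻ ω, ENNReal.ofReal (frobSq ((run D S θ η x₀ (t + 1) ω).Je
        - D.meanJac (run D S θ η x₀ (t + 1) ω).x)) ∂μ
      ≤ ENNReal.ofReal (A.β ^ 2) * ∫⁻ ω, ENNReal.ofReal (frobSq ((run D S θ η x₀ t ω).Je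
          - D.meanJac (run D S θ η x₀ t ω).x)) ∂μ
        + ENNReal.ofReal (S.kappaHat μ / A.b) *
        (ENNReal.ofReal (A.β ^ 2) * (ENNReal.ofReal (C.LF ^ 2 * θ ^ 2) *
            ∫⁻ ω, ENNReal.ofReal (D.stepSq A.γ η (run D S θ η x₀ t ω)) ∂μ)
          + ENNReal.ofReal ((1 - A.β) ^ 2) * ENNReal.ofReal (C.σJ ^ 2)) := by
  have hdom := effDom_Psi0 hD hψ hd
  have := hD.prob
  have hmem := run_mem (S := S) hD hη hθ hx₀
  obtain ⟨-, -, h1, h2⟩ := Batches.measurable_of_block (hS.meas_block t ht)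
  obtain ⟨mX, mFe, mJe⟩ := measurable_run_sampling hD hψ hd hγ hη hθ hx₀ hS ht.le
  obtain ⟨mY, -, -⟩ := measurable_run_sampling hD hψ hd hγ hη hθ hx₀ hS ht
  obtain ⟨pX, pFe, pJe⟩ := measurable_run_past hD hψ hd hγ hη hθ hx₀ S
    (le_refl t)
  have pY := measurable_nextPoint (θ := θ) hD hψ hd hγ hη pX pFe pJe
  have hB : Measurable[MeasurableSpace.comap (S.block t) inferInstance]
      fun ω => (S.J1 t ω, S.J2 t ω) := by
    have h : Measurable[MeasurableSpace.comap (S.block t) inferInstance] (S.block t) :=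
      comap_measurable _
    exact (measurable_fst.comp (measurable_snd.comp (measurable_snd.comp h))).prodMk
      (measurable_snd.comp (measurable_snd.comp (measurable_snd.comp h)))
  have hvec : Measurable (vec : (E p →L[ℝ] E q) → _) := vec.continuous.measurable
  have hind := indepFun_of_comap (hS.indep t ht) hB (pX.prodMk (pY.prodMk (hvec.comp pJe)))
  have key := lintegral_hybrid_norm_sq_le h1 h2 mX mY (hvec.comp mJe) (hS.law_J1 t ht)
    (hS.law_J2 t ht) (S.kappaHat_spec μ ht) hb hind (measurable_domJac hD hdom)
    (memLp_domJac hD hF hdom) A.β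
  simp only [integral_domJac hD hF hdom (hmem t _),
    integral_domJac hD hF hdom (hmem (t + 1) _)] at key
  simp only [domJac_eq (hmem t _), domJac_eq (hmem (t + 1) _), Function.comp_apply, ← map_sub, ← map_smul, ← map_sum, ← map_add, norm_vec_sq] at key
  refine key.trans ?_
  gcongr
  · rw [← lintegral_const_mul' _ _ ENNReal.ofReal_ne_top]
    refine lintegral_mono fun ω => ?_
    refine (hF.smooth _ (by rw [hdom]; exact hmem (t + 1) ω) _
      (by rw [hdom]; exact hmem t ω)).trans (le_of_eq ?_)
    rw [run_succ_x, norm_nextPoint_sub_sq, ← ENNReal.ofReal_mul (by positivity)]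
    congr 1; ring
  · calc _ ≤ ∫⁻ _, ENNReal.ofReal (C.σJ ^ 2) ∂μ :=
          lintegral_mono fun ω => hF.var_J _ (by rw [hdom]; exact hmem (t + 1) ω)
      _ = _ := by simp

lemma lintegral_errF_zero_le (hD : D.Standing) (hF : D.AssumptionF C)
    (hdom : effDom D.Psi0 = effDom D.R) (hx₀ : x₀ ∈ effDom D.R) (hS : S.IsSampling μ D.law)
    (hnF : 0 < A.nF0) :
    ∫⁻ ω, ENNReal.ofReal (‖(run D S θ η x₀ 0 ω).Fe
        - D.meanF (run D S θ η x₀ 0 ω).x‖ ^ 2) ∂μ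
      ≤ ENNReal.ofReal (A.nF0 : ℝ)⁻¹ * ENNReal.ofReal (C.σF ^ 2) := by
  have := hD.prob
  have hx : x₀ ∈ effDom D.Psi0 := by rwa [hdom]
  refine (lintegral_average_sub_norm_sq hS.meas_F0 hS.law_F0 hnF (measurable_F hD x₀)
    (memLp_F hD hF hx)).le.trans ?_
  gcongr
  exact hF.var_F x₀ hx

lemma lintegral_errJ_zero_le (hD : D.Standing) (hF : D.AssumptionF C)
    (hdom : effDom D.Psi0 = effDom D.R) (hx₀ : x₀ ∈ effDom D.R) (hS : S.IsSampling μ D.law)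
    (hnJ : 0 < A.nJ0) :
    ∫⁻ ω, ENNReal.ofReal (frobSq ((run D S θ η x₀ 0 ω).Je
        - D.meanJac (run D S θ η x₀ 0 ω).x)) ∂μ
      ≤ ENNReal.ofReal (A.nJ0 : ℝ)⁻¹ * ENNReal.ofReal (C.σJ ^ 2) := by
  have := hD.prob
  have key := (lintegral_average_sub_norm_sq hS.meas_J0 hS.law_J0 hnJ
    ((measurable_domJac hD hdom).comp (measurable_prodMk_left (x := x₀)))
    (memLp_domJac hD hF hdom x₀)).le
  simp only [Function.comp_apply, Function.uncurry_apply_pair,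
    integral_domJac hD hF hdom hx₀] at key
  simp only [domJac_eq hx₀, ← map_sub, ← map_smul, ← map_sum, norm_vec_sq] at key
  refine key.trans ?_
  gcongr
  exact hF.var_J x₀ (by rwa [hdom])

end Recursion

/-- Lower integrals need no integrability, so the recursion can be proved before finiteness is
known; one finite bound then yields both. -/
lemma integrable_of_lintegral_ofReal_le {Ω : Type*} [MeasurableSpace Ω] {μ : Measure Ω}
    {X : Ω → ℝ} (hm : Measurable X) (h0 : ∀ ω, 0 ≤ X ω) {r : ℝ} (hr : 0 ≤ r)
    (h : ∫⁻ ω, ENNReal.ofReal (X ω) ∂μ ≤ ENNReal.ofReal r) :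
    Integrable X μ ∧ ∫ ω, X ω ∂μ ≤ r := by
  have hi : Integrable X μ := by
    refine ⟨hm.aestronglyMeasurable, ?_⟩
    rw [hasFiniteIntegral_iff_ofReal (Filter.Eventually.of_forall h0)]
    exact h.trans_lt ENNReal.ofReal_lt_top
  refine ⟨hi, ?_⟩
  rw [← ofReal_integral_eq_lintegral_ofReal hi (Filter.Eventually.of_forall h0)] at h
  exact (ENNReal.ofReal_le_ofReal_iff hr).1 h

lemma lintegral_ofReal_eq {Ω : Type*} [MeasurableSpace Ω] {μ : Measure Ω}
    {X : Ω → ℝ} (hi : Integrable X μ) (h0 : ∀ ω, 0 ≤ X ω) :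
    ∫⁻ ω, ENNReal.ofReal (X ω) ∂μ = ENNReal.ofReal (∫ ω, X ω ∂μ) :=
  (ofReal_integral_eq_lintegral_ofReal hi (Filter.Eventually.of_forall h0)).symm

/-! ### Expectations of errors, steps and gradient mappings along the run. -/

open Problem

/-- The assumptions on the problem, the samples and the parameters, with a smoothness
constant `L` and step-sizes `θ`, `η`. -/
structure IsSetup {p q n : ℕ} {Ξ Ω : Type*} [MeasurableSpace Ξ] [MeasurableSpace Ω]
    (D : Problem p q n Ξ) (C : Constants) {A : Params} (S : Batches Ω Ξ A) (μ : Measure Ω)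
    (θ η L : ℝ) (x₀ : E p) : Prop where
  standing : D.Standing
  assumptionF : D.AssumptionF C
  assumptionPsi : D.AssumptionPsi C
  smoothing : D.AssumptionSmoothing
  γ_mem : A.γ ∈ Set.Ioc (0 : ℝ) 1
  θ_mem : θ ∈ Set.Ioc (0 : ℝ) 1
  L_eq : L = C.LF * C.Mψ * ‖D.K‖ + C.MF ^ 2 * ‖D.K‖ ^ 2 / A.γ
  L_pos : 0 < L
  η_eq : η = 2 / (L * (3 + θ))
  x₀_mem : x₀ ∈ effDom D.R
  sampling : S.IsSampling μ D.law
  b_pos : 0 < A.b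
  nF_pos : 0 < A.nF
  nF0_pos : 0 < A.nF0
  nJ0_pos : 0 < A.nJ0

namespace IsSetup

variable {p q n : ℕ} {Ξ Ω : Type*} [MeasurableSpace Ξ] [MeasurableSpace Ω]
  {D : Problem p q n Ξ} {C : Constants} {A : Params} {S : Batches Ω Ξ A} {μ : Measure Ω}
  {θ η L : ℝ} {x₀ : E p}

section

variable (h : IsSetup D C S μ θ η L x₀)
include h

lemma η_pos : 0 < η := by
  have := h.θ_mem.1
  have := h.L_pos
  rw [h.η_eq]; positivity

lemma effDom_eq : effDom D.Psi0 = effDom D.R :=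
  effDom_Psi0 h.standing h.assumptionPsi h.smoothing

lemma run_mem (t : ℕ) (ω : Ω) : (run D S θ η x₀ t ω).x ∈ effDom D.R :=
  HybridMinimax.run_mem h.standing h.η_pos h.θ_mem h.x₀_mem t ω

lemma measurable_run {t : ℕ} (ht : t ≤ A.T) :
    Measurable (fun ω => (run D S θ η x₀ t ω).x) ∧
    Measurable (fun ω => (run D S θ η x₀ t ω).Fe) ∧
    Measurable (fun ω => (run D S θ η x₀ t ω).Je) :=
  measurable_run_sampling h.standing h.assumptionPsi h.smoothing h.γ_mem.1 h.η_pos h.θ_mem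
    h.x₀_mem h.sampling ht

/-- `x` is measurable for an arbitrary σ-algebra because the gradient mapping at `x_t` must later be
measurable with respect to the past samples, which gives independence of the output index. -/
lemma measurable_meanF_comp {α : Type*} {m : MeasurableSpace α} {x : α → E p} (hx : Measurable x)
    (hd : ∀ ω, x ω ∈ effDom D.R) : Measurable fun ω => D.meanF (x ω) := by
  have := h.standing.prob
  have h1 : Measurable fun x => ∫ ξ, D.domF x ξ ∂D.law :=
    ((measurable_domF h.standing).stronglyMeasurable.integral_prod_right').measurable
  have h2 := h1.comp hx
  simpa only [Function.comp_def, integral_domF (hd _)] using h2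

lemma measurable_vec_meanJac_comp {α : Type*} {m : MeasurableSpace α} {x : α → E p} (hx : Measurable x)
    (hd : ∀ ω, x ω ∈ effDom D.R) : Measurable fun ω => vec (D.meanJac (x ω)) := by
  have := h.standing.prob
  have h1 : Measurable fun x => ∫ ξ, D.domJac x ξ ∂D.law :=
    ((measurable_domJac h.standing h.effDom_eq).stronglyMeasurable.integral_prod_right').measurable
  have h2 := h1.comp hx
  simpa only [Function.comp_def, integral_domJac h.standing h.assumptionF h.effDom_eq (hd _)]
    using h2

lemma measurable_meanJac_comp {α : Type*} {m : MeasurableSpace α} {x : α → E p} (hx : Measurable x)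
    (hd : ∀ ω, x ω ∈ effDom D.R) : Measurable fun ω => D.meanJac (x ω) := by
  refine measurable_clm fun j => ?_
  have hv := h.measurable_vec_meanJac_comp hx hd
  have h1 : Measurable fun ω => WithLp.toLp 2 fun k => vec (D.meanJac (x ω)) (j, k) := by
    refine (PiLp.continuous_toLp 2 (fun _ : Fin q => ℝ)).measurable.comp ?_
    exact measurable_pi_lambda _ fun k => measurable_apply hv (j, k)
  exact h1

lemma measurable_gradMap_comp {α : Type*} {m : MeasurableSpace α} {x : α → E p} (hx : Measurable x)
    (hd : ∀ ω, x ω ∈ effDom D.R) : Measurable fun ω => D.gradMap A.γ η (x ω) := by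
  have hJ := h.measurable_meanJac_comp hx hd
  have hFm := h.measurable_meanF_comp hx hd
  have e : ∀ ω, D.gradMap A.γ η (x ω) = η⁻¹ • (x ω - prox η D.R (x ω - η •
      D.gradEst A.γ ⟨x ω, D.meanF (x ω), D.meanJac (x ω)⟩)) := by
    intro ω
    rw [gradMap, gradPhi_eq h.assumptionPsi h.smoothing h.γ_mem.1, gradEst]
  simp only [e]
  exact measurable_real_smul _ (hx.sub (measurable_proxStep
    (s := fun ω => ⟨x ω, D.meanF (x ω), D.meanJac (x ω)⟩) h.standing h.assumptionPsi h.smoothing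
    h.γ_mem.1 h.η_pos hx hFm hJ))

lemma measurable_errF {t : ℕ} (ht : t ≤ A.T) : Measurable fun ω =>
    ‖(run D S θ η x₀ t ω).Fe - D.meanF (run D S θ η x₀ t ω).x‖ ^ 2 := by
  obtain ⟨hx, hF, -⟩ := h.measurable_run ht
  exact ((hF.sub (h.measurable_meanF_comp hx (h.run_mem t))).norm).pow_const 2

lemma measurable_errJ {t : ℕ} (ht : t ≤ A.T) : Measurable fun ω =>
    frobSq ((run D S θ η x₀ t ω).Je - D.meanJac (run D S θ η x₀ t ω).x) := by
  obtain ⟨hx, -, hJ⟩ := h.measurable_run ht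
  exact continuous_frobSq.measurable.comp (hJ.sub (h.measurable_meanJac_comp hx (h.run_mem t)))

lemma measurable_stepSq {t : ℕ} (ht : t ≤ A.T) : Measurable fun ω =>
    D.stepSq A.γ η (run D S θ η x₀ t ω) := by
  obtain ⟨hx, hF, hJ⟩ := h.measurable_run ht
  exact (((measurable_proxStep h.standing h.assumptionPsi h.smoothing h.γ_mem.1 h.η_pos
    hx hF hJ).sub hx).norm).pow_const 2

lemma sum_stepSq_le (N : ℕ) (ω : Ω) :
    θ * L * ∑ t ∈ Finset.range N, D.stepSq A.γ η (run D S θ η x₀ t ω)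
      ≤ ((D.Psi0 x₀).toReal - D.Psi0Star.toReal + D.Bψ)
        + θ / (2 * L) * ∑ t ∈ Finset.range N, D.errSq C A.γ (run D S θ η x₀ t ω) :=
  HybridMinimax.sum_stepSq_le h.standing h.assumptionF h.assumptionPsi h.smoothing h.γ_mem h.θ_mem
    h.L_eq h.L_pos h.η_eq h.x₀_mem N ω

variable [IsProbabilityMeasure μ]

/-- The pathwise descent inequality dominates the step at time `t` by a constant plus finitely many
errors; no moment assumption on the iterates is needed. -/
lemma integrable_stepSq_of_errSq {t : ℕ} (ht : t ≤ A.T)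
    (hi : ∀ s ≤ t, Integrable (fun ω => D.errSq C A.γ (run D S θ η x₀ s ω)) μ) :
    Integrable (fun ω => D.stepSq A.γ η (run D S θ η x₀ t ω)) μ := by
  have hpos : 0 < θ * L := mul_pos h.θ_mem.1 h.L_pos
  have hbound : Integrable (fun ω => (θ * L)⁻¹ * (((D.Psi0 x₀).toReal - D.Psi0Star.toReal + D.Bψ)
        + θ / (2 * L) * ∑ s ∈ Finset.range (t + 1),
          D.errSq C A.γ (run D S θ η x₀ s ω))) μ := by
    refine Integrable.const_mul (Integrable.add (integrable_const _) (Integrable.const_mul ?_ _)) _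
    exact integrable_finsetSum _ fun s hs => hi s (Nat.lt_succ_iff.1 (Finset.mem_range.1 hs))
  refine hbound.mono' (h.measurable_stepSq ht).aestronglyMeasurable
    (Filter.Eventually.of_forall fun ω => ?_)
  have hnn : ∀ s, 0 ≤ D.stepSq A.γ η (run D S θ η x₀ s ω) := fun s => sq_nonneg _
  rw [Real.norm_of_nonneg (hnn t), ← div_eq_inv_mul, le_div_iff₀ hpos, mul_comm]
  refine le_trans ?_ (h.sum_stepSq_le (t + 1) ω)
  gcongr
  exact Finset.single_le_sum (f := fun s => D.stepSq A.γ η (run D S θ η x₀ s ω))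
    (fun s _ => hnn s) (Finset.self_mem_range_succ t)

omit [IsProbabilityMeasure μ] in
lemma integral_errF_zero_le :
    Integrable (fun ω => ‖(run D S θ η x₀ 0 ω).Fe - D.meanF (run D S θ η x₀ 0 ω).x‖ ^ 2) μ ∧
    ∫ ω, ‖(run D S θ η x₀ 0 ω).Fe - D.meanF (run D S θ η x₀ 0 ω).x‖ ^ 2 ∂μ
      ≤ C.σF ^ 2 / A.nF0 := by
  refine integrable_of_lintegral_ofReal_le (h.measurable_errF (Nat.zero_le _))
    (fun ω => sq_nonneg _) (by positivity) ?_
  refine (lintegral_errF_zero_le h.standing h.assumptionF h.effDom_eq h.x₀_mem h.sampling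
    h.nF0_pos).trans (le_of_eq ?_)
  rw [← ENNReal.ofReal_mul (by positivity), div_eq_inv_mul]

omit [IsProbabilityMeasure μ] in
lemma integral_errJ_zero_le :
    Integrable (fun ω => frobSq ((run D S θ η x₀ 0 ω).Je - D.meanJac (run D S θ η x₀ 0 ω).x)) μ ∧
    ∫ ω, frobSq ((run D S θ η x₀ 0 ω).Je - D.meanJac (run D S θ η x₀ 0 ω).x) ∂μ
      ≤ C.σJ ^ 2 / A.nJ0 := by
  refine integrable_of_lintegral_ofReal_le (h.measurable_errJ (Nat.zero_le _))
    (fun ω => frobSq_nonneg _) (by positivity) ?_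
  refine (lintegral_errJ_zero_le h.standing h.assumptionF h.effDom_eq h.x₀_mem h.sampling
    h.nJ0_pos).trans (le_of_eq ?_)
  rw [← ENNReal.ofReal_mul (by positivity), div_eq_inv_mul]

lemma integral_errF_succ_le {t : ℕ} (ht : t < A.T)
    (hi : Integrable (fun ω => ‖(run D S θ η x₀ t ω).Fe - D.meanF (run D S θ η x₀ t ω).x‖ ^ 2) μ)
    (hs : Integrable (fun ω => D.stepSq A.γ η (run D S θ η x₀ t ω)) μ) :
    Integrable (fun ω =>
      ‖(run D S θ η x₀ (t + 1) ω).Fe - D.meanF (run D S θ η x₀ (t + 1) ω).x‖ ^ 2) μ ∧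
    ∫ ω, ‖(run D S θ η x₀ (t + 1) ω).Fe - D.meanF (run D S θ η x₀ (t + 1) ω).x‖ ^ 2 ∂μ
      ≤ A.β ^ 2 * ∫ ω, ‖(run D S θ η x₀ t ω).Fe - D.meanF (run D S θ η x₀ t ω).x‖ ^ 2 ∂μ
        + S.kappa μ / A.nF * (A.β ^ 2 * (C.MF ^ 2 * θ ^ 2 *
            ∫ ω, D.stepSq A.γ η (run D S θ η x₀ t ω) ∂μ) + (1 - A.β) ^ 2 * C.σF ^ 2) := by
  have hκ : 0 ≤ S.kappa μ := zero_le_one.trans (S.one_le_kappa μ)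
  have h1 : 0 ≤ ∫ ω, ‖(run D S θ η x₀ t ω).Fe - D.meanF (run D S θ η x₀ t ω).x‖ ^ 2 ∂μ :=
    integral_nonneg fun ω => sq_nonneg _
  have h2 : 0 ≤ ∫ ω, D.stepSq A.γ η (run D S θ η x₀ t ω) ∂μ :=
    integral_nonneg fun ω => sq_nonneg _
  refine integrable_of_lintegral_ofReal_le (h.measurable_errF ht)
    (fun ω => sq_nonneg _) (by positivity) ?_
  refine (lintegral_errF_succ_le h.standing h.assumptionF h.assumptionPsi h.smoothing h.γ_mem.1
    h.η_pos h.θ_mem h.x₀_mem h.sampling h.nF_pos ht).trans (le_of_eq ?_)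
  rw [lintegral_ofReal_eq hi fun ω => sq_nonneg _, lintegral_ofReal_eq hs fun ω => sq_nonneg _]
  rw [← ENNReal.ofReal_mul (by positivity), ← ENNReal.ofReal_mul (by positivity),
    ← ENNReal.ofReal_mul (by positivity), ← ENNReal.ofReal_mul (by positivity),
    ← ENNReal.ofReal_add (by positivity) (by positivity), ← ENNReal.ofReal_mul (by positivity),
    ← ENNReal.ofReal_add (by positivity) (by positivity)]

lemma integral_errJ_succ_le {t : ℕ} (ht : t < A.T)
    (hi : Integrable (fun ω =>
      frobSq ((run D S θ η x₀ t ω).Je - D.meanJac (run D S θ η x₀ t ω).x)) μ)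
    (hs : Integrable (fun ω => D.stepSq A.γ η (run D S θ η x₀ t ω)) μ) :
    Integrable (fun ω =>
      frobSq ((run D S θ η x₀ (t + 1) ω).Je - D.meanJac (run D S θ η x₀ (t + 1) ω).x)) μ ∧
    ∫ ω, frobSq ((run D S θ η x₀ (t + 1) ω).Je - D.meanJac (run D S θ η x₀ (t + 1) ω).x) ∂μ
      ≤ A.β ^ 2 * ∫ ω, frobSq ((run D S θ η x₀ t ω).Je - D.meanJac (run D S θ η x₀ t ω).x) ∂μ
        + S.kappaHat μ / A.b * (A.β ^ 2 * (C.LF ^ 2 * θ ^ 2 *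
            ∫ ω, D.stepSq A.γ η (run D S θ η x₀ t ω) ∂μ) + (1 - A.β) ^ 2 * C.σJ ^ 2) := by
  have hκ : 0 ≤ S.kappaHat μ := zero_le_one.trans (S.one_le_kappaHat μ)
  have h1 : 0 ≤ ∫ ω, frobSq ((run D S θ η x₀ t ω).Je - D.meanJac (run D S θ η x₀ t ω).x) ∂μ :=
    integral_nonneg fun ω => frobSq_nonneg _
  have h2 : 0 ≤ ∫ ω, D.stepSq A.γ η (run D S θ η x₀ t ω) ∂μ :=
    integral_nonneg fun ω => sq_nonneg _
  refine integrable_of_lintegral_ofReal_le (h.measurable_errJ ht)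
    (fun ω => frobSq_nonneg _) (by positivity) ?_
  refine (lintegral_errJ_succ_le h.standing h.assumptionF h.assumptionPsi h.smoothing h.γ_mem.1
    h.η_pos h.θ_mem h.x₀_mem h.sampling h.b_pos ht).trans (le_of_eq ?_)
  rw [lintegral_ofReal_eq hi fun ω => frobSq_nonneg _,
    lintegral_ofReal_eq hs fun ω => sq_nonneg _]
  rw [← ENNReal.ofReal_mul (by positivity), ← ENNReal.ofReal_mul (by positivity),
    ← ENNReal.ofReal_mul (by positivity), ← ENNReal.ofReal_mul (by positivity),
    ← ENNReal.ofReal_add (by positivity) (by positivity), ← ENNReal.ofReal_mul (by positivity),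
    ← ENNReal.ofReal_add (by positivity) (by positivity)]

/-- Strong induction, as errors and steps feed each other: errors up to time `t` make the step at
`t` integrable, and the recursion then makes the errors at `t + 1` integrable. -/
lemma integrable_err {t : ℕ} (ht : t ≤ A.T) :
    Integrable (fun ω => ‖(run D S θ η x₀ t ω).Fe - D.meanF (run D S θ η x₀ t ω).x‖ ^ 2) μ ∧
    Integrable (fun ω =>
      frobSq ((run D S θ η x₀ t ω).Je - D.meanJac (run D S θ η x₀ t ω).x)) μ := by
  induction t using Nat.strong_induction_on with
  | _ t ih =>
    cases t with
    | zero => exact ⟨h.integral_errF_zero_le.1, h.integral_errJ_zero_le.1⟩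
    | succ t =>
      have hs := h.integrable_stepSq_of_errSq (Nat.le_of_succ_le ht) fun s hs => by
        obtain ⟨h1, h2⟩ := ih s (Nat.lt_succ_of_le hs) (hs.trans (Nat.le_of_succ_le ht))
        exact (h1.const_mul _).add (h2.const_mul _)
      obtain ⟨h1, h2⟩ := ih t t.lt_succ_self (Nat.le_of_succ_le ht)
      exact ⟨(h.integral_errF_succ_le ht h1 hs).1, (h.integral_errJ_succ_le ht h2 hs).1⟩

lemma integrable_errSq {t : ℕ} (ht : t ≤ A.T) :
    Integrable (fun ω => D.errSq C A.γ (run D S θ η x₀ t ω)) μ :=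
  ((h.integrable_err ht).1.const_mul _).add ((h.integrable_err ht).2.const_mul _)

lemma integrable_stepSq {t : ℕ} (ht : t ≤ A.T) :
    Integrable (fun ω => D.stepSq A.γ η (run D S θ η x₀ t ω)) μ :=
  h.integrable_stepSq_of_errSq ht fun _ hs => h.integrable_errSq (hs.trans ht)

lemma integral_errSq_eq {t : ℕ} (ht : t ≤ A.T) :
    ∫ ω, D.errSq C A.γ (run D S θ η x₀ t ω) ∂μ = 2 * C.MF ^ 2 * ‖D.K‖ ^ 4 / A.γ ^ 2 *
      ∫ ω, ‖(run D S θ η x₀ t ω).Fe - D.meanF (run D S θ η x₀ t ω).x‖ ^ 2 ∂μ +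
      2 * ‖D.K‖ ^ 2 * C.Mψ ^ 2 *
      ∫ ω, frobSq ((run D S θ η x₀ t ω).Je - D.meanJac (run D S θ η x₀ t ω).x) ∂μ := by
  unfold errSq
  rw [integral_add ((h.integrable_err ht).1.const_mul _) ((h.integrable_err ht).2.const_mul _),
    integral_const_mul, integral_const_mul]

lemma integral_errSq_zero_le : ∫ ω, D.errSq C A.γ (run D S θ η x₀ 0 ω) ∂μ ≤
    2 * C.MF ^ 2 * ‖D.K‖ ^ 4 / A.γ ^ 2 * (C.σF ^ 2 / A.nF0) +
      2 * ‖D.K‖ ^ 2 * C.Mψ ^ 2 * (C.σJ ^ 2 / A.nJ0) := by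
  rw [h.integral_errSq_eq (Nat.zero_le _)]
  gcongr
  · exact h.integral_errF_zero_le.2
  · exact h.integral_errJ_zero_le.2

lemma integral_errSq_succ_le {t : ℕ} (ht : t < A.T) :
    ∫ ω, D.errSq C A.γ (run D S θ η x₀ (t + 1) ω) ∂μ ≤
      A.β ^ 2 * ∫ ω, D.errSq C A.γ (run D S θ η x₀ t ω) ∂μ
      + A.β ^ 2 * θ ^ 2 * (2 * C.MF ^ 2 * ‖D.K‖ ^ 4 / A.γ ^ 2 * (S.kappa μ / A.nF * C.MF ^ 2)
          + 2 * ‖D.K‖ ^ 2 * C.Mψ ^ 2 * (S.kappaHat μ / A.b * C.LF ^ 2))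
        * ∫ ω, D.stepSq A.γ η (run D S θ η x₀ t ω) ∂μ
      + (1 - A.β) ^ 2 * (2 * C.MF ^ 2 * ‖D.K‖ ^ 4 / A.γ ^ 2 * (S.kappa μ / A.nF * C.σF ^ 2)
          + 2 * ‖D.K‖ ^ 2 * C.Mψ ^ 2 * (S.kappaHat μ / A.b * C.σJ ^ 2)) := by
  rw [h.integral_errSq_eq ht, h.integral_errSq_eq ht.le]
  have h1 := (h.integral_errF_succ_le ht (h.integrable_err ht.le).1 (h.integrable_stepSq ht.le)).2
  have h2 := (h.integral_errJ_succ_le ht (h.integrable_err ht.le).2 (h.integrable_stepSq ht.le)).2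
  have a1 : 0 ≤ 2 * C.MF ^ 2 * ‖D.K‖ ^ 4 / A.γ ^ 2 := by positivity
  have a2 : 0 ≤ 2 * ‖D.K‖ ^ 2 * C.Mψ ^ 2 := by positivity
  refine (add_le_add (mul_le_mul_of_nonneg_left h1 a1)
    (mul_le_mul_of_nonneg_left h2 a2)).trans (le_of_eq ?_)
  ring

lemma sum_integral_stepSq_le :
    θ * L * ∑ t ∈ Finset.range (A.T + 1), ∫ ω, D.stepSq A.γ η (run D S θ η x₀ t ω) ∂μ
      ≤ ((D.Psi0 x₀).toReal - D.Psi0Star.toReal + D.Bψ) + θ / (2 * L) *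
        ∑ t ∈ Finset.range (A.T + 1), ∫ ω, D.errSq C A.γ (run D S θ η x₀ t ω) ∂μ := by
  have hd : ∀ t ∈ Finset.range (A.T + 1),
      Integrable (fun ω => D.stepSq A.γ η (run D S θ η x₀ t ω)) μ := fun t ht =>
    h.integrable_stepSq (Nat.lt_succ_iff.1 (Finset.mem_range.1 ht))
  have he : ∀ t ∈ Finset.range (A.T + 1),
      Integrable (fun ω => D.errSq C A.γ (run D S θ η x₀ t ω)) μ := fun t ht =>
    h.integrable_errSq (Nat.lt_succ_iff.1 (Finset.mem_range.1 ht))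
  have key := integral_mono (μ := μ) ((integrable_finsetSum _ hd).const_mul (θ * L))
    ((integrable_const ((D.Psi0 x₀).toReal - D.Psi0Star.toReal + D.Bψ)).add
      ((integrable_finsetSum _ he).const_mul (θ / (2 * L)))) (fun ω => by
        simpa using h.sum_stepSq_le (A.T + 1) ω)
  rw [integral_const_mul, integral_finsetSum _ hd, integral_add' (integrable_const _)
    ((integrable_finsetSum _ he).const_mul (θ / (2 * L))), integral_const_mul,
    integral_finsetSum _ he] at key
  simpa using key

lemma integral_gradMap_sq_le {t : ℕ} (ht : t ≤ A.T) :
    Integrable (fun ω => ‖D.gradMap A.γ η (run D S θ η x₀ t ω).x‖ ^ 2) μ ∧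
    ∫ ω, ‖D.gradMap A.γ η (run D S θ η x₀ t ω).x‖ ^ 2 ∂μ
      ≤ 8 * L ^ 2 * ∫ ω, D.stepSq A.γ η (run D S θ η x₀ t ω) ∂μ
        + 2 * ∫ ω, D.errSq C A.γ (run D S θ η x₀ t ω) ∂μ := by
  have hle : ∀ ω, ‖D.gradMap A.γ η (run D S θ η x₀ t ω).x‖ ^ 2
      ≤ 8 * L ^ 2 * D.stepSq A.γ η (run D S θ η x₀ t ω)
        + 2 * D.errSq C A.γ (run D S θ η x₀ t ω) := fun ω =>
    norm_gradMap_sq_le h.standing h.assumptionF h.assumptionPsi h.smoothing h.γ_mem.1 h.θ_mem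
      h.L_pos h.η_eq (h.run_mem t ω)
  have hs := (h.integrable_stepSq ht).const_mul (8 * L ^ 2)
  have he := (h.integrable_errSq ht).const_mul 2
  have hm : Measurable fun ω => ‖D.gradMap A.γ η (run D S θ η x₀ t ω).x‖ ^ 2 :=
    ((h.measurable_gradMap_comp (h.measurable_run ht).1 (h.run_mem t)).norm).pow_const 2
  have hi : Integrable (fun ω => ‖D.gradMap A.γ η (run D S θ η x₀ t ω).x‖ ^ 2) μ := by
    refine (hs.add he).mono' hm.aestronglyMeasurable (Filter.Eventually.of_forall fun ω => ?_)
    rw [Real.norm_of_nonneg (sq_nonneg _)]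
    exact hle ω
  refine ⟨hi, ?_⟩
  rw [← integral_const_mul, ← integral_const_mul, ← integral_add hs he]
  exact integral_mono hi (hs.add he) hle

end

end IsSetup

/-- Summation gives `(1 - β²) Sv ≤ e + T c + β² a Sd`. Factoring `1 - β² = (1 - β)(1 + β)` and
dividing by `1 + β` yields the claim; the gain `a / 2` comes from `β² ≤ (1 + β) / 2` on `[0, 1]`. -/
lemma sum_le_of_recursion {v d : ℕ → ℝ} {T : ℕ} {β a c e : ℝ} (hβ0 : 0 ≤ β) (hβ1 : β ≤ 1)
    (hv : ∀ t, 0 ≤ v t) (hd : ∀ t, 0 ≤ d t) (ha : 0 ≤ a) (hc : 0 ≤ c) (he : 0 ≤ e)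
    (h0 : v 0 ≤ e) (hs : ∀ t < T, v (t + 1) ≤ β ^ 2 * v t + β ^ 2 * a * d t + c) :
    (1 - β) * ∑ t ∈ Finset.range (T + 1), v t
      ≤ e + T * c + a / 2 * ∑ t ∈ Finset.range (T + 1), d t := by
  have h1 : ∑ t ∈ Finset.range T, v (t + 1)
      ≤ ∑ t ∈ Finset.range T, (β ^ 2 * v t + β ^ 2 * a * d t + c) :=
    Finset.sum_le_sum fun t ht => hs t (Finset.mem_range.1 ht)
  rw [Finset.sum_add_distrib, Finset.sum_add_distrib, ← Finset.mul_sum, ← Finset.mul_sum,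
    Finset.sum_const, Finset.card_range, nsmul_eq_mul] at h1
  have h2 := Finset.sum_range_succ' v T
  have h3 := Finset.sum_range_succ v T
  have h4 := Finset.sum_range_succ d T
  set Sv := ∑ t ∈ Finset.range (T + 1), v t
  set Sd := ∑ t ∈ Finset.range (T + 1), d t with hSd
  have hSd0 : 0 ≤ Sd := Finset.sum_nonneg fun t _ => hd t
  have h5 : ∑ t ∈ Finset.range T, v t ≤ Sv := by linarith [hv T]
  have h6 : ∑ t ∈ Finset.range T, d t ≤ Sd := by linarith [hd T]
  have h7 : Sv ≤ e + β ^ 2 * Sv + β ^ 2 * a * Sd + T * c := by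
    have := mul_le_mul_of_nonneg_left h5 (sq_nonneg β)
    have := mul_le_mul_of_nonneg_left h6 (mul_nonneg (sq_nonneg β) ha)
    linarith
  have h8 : 0 ≤ a * Sd := mul_nonneg ha hSd0
  have h9 : 0 ≤ e + T * c := by positivity
  have h10 : (1 + β) * ((1 - β) * Sv) ≤ (1 + β) * (e + T * c + a / 2 * Sd) := by
    have : β ^ 2 * (a * Sd) ≤ (1 + β) / 2 * (a * Sd) :=
      mul_le_mul_of_nonneg_right (by nlinarith) h8
    nlinarith [mul_nonneg hβ0 h9]
  exact le_of_mul_le_mul_left h10 (by linarith)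

/-! ### The parameters in terms of `y = [b(T+1)]^{1/3}`. -/

namespace Params

variable {A : Params}

/-- The number `[b (T + 1)]^{1/3}`. -/
noncomputable def root (A : Params) : ℝ := ((A.b : ℝ) * (A.T + 1)) ^ (1 / 3 : ℝ)

lemma root_pos (hb : 0 < A.b) : 0 < A.root := by
  have : (0 : ℝ) < A.b := by exact_mod_cast hb
  unfold root; positivity

lemma root_pow_three (A : Params) : A.root ^ 3 = A.b * (A.T + 1) := by
  rw [root, ← Real.rpow_natCast, ← Real.rpow_mul (by positivity)]
  norm_num

lemma root_sq (A : Params) : A.root ^ 2 = ((A.b : ℝ) * (A.T + 1)) ^ (2 / 3 : ℝ) := by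
  rw [root, ← Real.rpow_natCast, ← Real.rpow_mul (by positivity)]
  norm_num

lemma b0hat_eq (A : Params) : A.b0hat = A.c₁ ^ 2 * A.root := rfl

lemma b0hat_pos (hb : 0 < A.b) (hc₁ : 0 < A.c₁) : 0 < A.b0hat := by
  have := root_pos hb
  rw [b0hat_eq]; positivity

/-- A square divided by `b`: the fractional powers in `β` and `θ` then reduce to integer powers of
`y`, apart from `√c₁`. -/
lemma b0hat_mul_eq (hb : 0 < A.b) :
    A.b0hat * (A.T + 1) = (A.c₁ * A.root ^ 2) ^ 2 / A.b := by
  have : (0 : ℝ) < A.b := by exact_mod_cast hb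
  rw [b0hat_eq, eq_div_iff this.ne']
  have := A.root_pow_three
  calc _ = A.c₁ ^ 2 * A.root * (A.b * (A.T + 1)) := by ring
    _ = _ := by rw [← this]; ring

lemma one_sub_β (hb : 0 < A.b) (hc₁ : 0 < A.c₁) : 1 - A.β = A.b / (A.c₁ * A.root ^ 2) := by
  have hb' : (0 : ℝ) < A.b := by exact_mod_cast hb
  have hr := root_pos hb
  rw [β, b0hat_mul_eq hb, ← Real.sqrt_eq_rpow, ← Real.sqrt_eq_rpow, Real.sqrt_div (by positivity),
    Real.sqrt_sq (by positivity)]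
  have h : Real.sqrt A.b * Real.sqrt A.b = A.b := Real.mul_self_sqrt hb'.le
  have hs : 0 < Real.sqrt A.b := Real.sqrt_pos.2 hb'
  field_simp
  linarith

lemma sqrt_sqrt_b0hat_mul (hb : 0 < A.b) (hc₁ : 0 < A.c₁) :
    (A.b0hat * (A.T + 1)) ^ (1 / 4 : ℝ)
      = Real.sqrt A.c₁ * A.root / (A.b : ℝ) ^ (1 / 4 : ℝ) := by
  have hb' : (0 : ℝ) < A.b := by exact_mod_cast hb
  have hr := root_pos hb
  rw [b0hat_mul_eq hb, Real.div_rpow (by positivity) hb'.le]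
  congr 1
  have e : (A.c₁ * A.root ^ 2) ^ 2 = (Real.sqrt A.c₁ * A.root) ^ 4 := by
    have := Real.sq_sqrt hc₁.le
    calc _ = (Real.sqrt A.c₁ ^ 2 * A.root ^ 2) ^ 2 := by rw [this]
      _ = _ := by ring
  rw [e, ← Real.rpow_natCast, ← Real.rpow_mul (by positivity)]
  norm_num

lemma nF_pos (hb : 0 < A.b) (hc₀ : 0 < A.c₀) (hγ : 0 < A.γ) : 0 < A.nF := by
  have hb' : (0 : ℝ) < A.b := by exact_mod_cast hb
  exact Nat.ceil_pos.2 (by positivity)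

lemma nF0_pos (hb : 0 < A.b) (hc₀ : 0 < A.c₀) (hc₁ : 0 < A.c₁) (hγ : 0 < A.γ) : 0 < A.nF0 := by
  have := b0hat_pos hb hc₁
  exact Nat.ceil_pos.2 (by positivity)

lemma nJ0_pos (hb : 0 < A.b) (hc₁ : 0 < A.c₁) : 0 < A.nJ0 :=
  Nat.ceil_pos.2 (b0hat_pos hb hc₁)

end Params

/-! ### Coefficients of the recursion in terms of `P` and `Q`. -/

section Constants

variable {p q n : ℕ} {Ξ : Type*} [MeasurableSpace Ξ] {D : Problem p q n Ξ} {C : Constants}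
  {A : Params} {κ κh : ℝ}

lemma Pconst_nonneg : 0 ≤ Pconst D C A κ κh := by
  unfold Pconst; positivity

/-- The factor `9/13` undoes the `26/9` inside `P²` and leaves the 2 of the error weights. -/
lemma Pconst_sq (hc₀ : 0 < A.c₀) (hκ : 0 ≤ κ) (hκh : 0 ≤ κh) :
    9 / 13 * Pconst D C A κ κh ^ 2 = 2 * ‖D.K‖ ^ 2 / A.c₀ *
      (κ * C.MF ^ 4 * ‖D.K‖ ^ 2 + A.c₀ * κh * C.LF ^ 2 * C.Mψ ^ 2) := by
  rw [Pconst, mul_pow, Real.sq_sqrt (by positivity), div_pow, mul_pow, mul_pow,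
    Real.sq_sqrt hc₀.le, Real.sq_sqrt (by norm_num)]
  field_simp
  ring

lemma Qconst_nonneg (hc₀ : 0 < A.c₀) (hκ : 0 ≤ κ) (hκh : 0 ≤ κh) : 0 ≤ Qconst D C A κ κh := by
  unfold Qconst; positivity

lemma theta_eq (hb : 0 < A.b) (hc₁ : 0 < A.c₁) : theta D C A κ κh =
    LPhi D C A * A.b / (Pconst D C A κ κh * (Real.sqrt A.c₁ * A.root)) := by
  have hb' : (0 : ℝ) < A.b := by exact_mod_cast hb
  rw [theta, Params.sqrt_sqrt_b0hat_mul hb hc₁]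
  have e : (A.b : ℝ) ^ (3 / 4 : ℝ) * (A.b : ℝ) ^ (1 / 4 : ℝ) = A.b := by
    rw [← Real.rpow_add hb']; norm_num
  rw [mul_div_assoc', div_div_eq_mul_div, mul_assoc, e]

/-- Bound for the coefficient of the squared steps in the variance recursion. -/
lemma errSq_step_coeff_le (hb : 0 < A.b) (hc₀ : 0 < A.c₀) (hγ : 0 < A.γ) (hκ : 0 ≤ κ)
    (hκh : 0 ≤ κh) :
    2 * C.MF ^ 2 * ‖D.K‖ ^ 4 / A.γ ^ 2 * (κ / A.nF * C.MF ^ 2)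
      + 2 * ‖D.K‖ ^ 2 * C.Mψ ^ 2 * (κh / A.b * C.LF ^ 2)
      ≤ 9 / 13 * Pconst D C A κ κh ^ 2 / A.b := by
  have hb' : (0 : ℝ) < A.b := by exact_mod_cast hb
  -- Rounding a batch size up only lowers the variance; the unrounded size then cancels `γ²` in the
  -- weight of the error.
  have h1 : κ / A.nF ≤ κ / (A.c₀ * A.b / A.γ ^ 2) := by
    gcongr; exact Nat.le_ceil _
  calc _ ≤ 2 * C.MF ^ 2 * ‖D.K‖ ^ 4 / A.γ ^ 2 * (κ / (A.c₀ * A.b / A.γ ^ 2) * C.MF ^ 2)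
      + 2 * ‖D.K‖ ^ 2 * C.Mψ ^ 2 * (κh / A.b * C.LF ^ 2) := by gcongr
    _ = _ := by rw [Pconst_sq hc₀ hκ hκh]; field_simp

/-- Bound for the constant term in the variance recursion. -/
lemma errSq_var_coeff_le (hb : 0 < A.b) (hc₀ : 0 < A.c₀) (hγ : 0 < A.γ) (hκ : 0 ≤ κ) :
    2 * C.MF ^ 2 * ‖D.K‖ ^ 4 / A.γ ^ 2 * (κ / A.nF * C.σF ^ 2)
      + 2 * ‖D.K‖ ^ 2 * C.Mψ ^ 2 * (κh / A.b * C.σJ ^ 2)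
      ≤ 9 / 13 * Qconst D C A κ κh / A.b := by
  have hb' : (0 : ℝ) < A.b := by exact_mod_cast hb
  have h1 : κ / A.nF ≤ κ / (A.c₀ * A.b / A.γ ^ 2) := by
    gcongr; exact Nat.le_ceil _
  calc _ ≤ 2 * C.MF ^ 2 * ‖D.K‖ ^ 4 / A.γ ^ 2 * (κ / (A.c₀ * A.b / A.γ ^ 2) * C.σF ^ 2)
      + 2 * ‖D.K‖ ^ 2 * C.Mψ ^ 2 * (κh / A.b * C.σJ ^ 2) := by gcongr
    _ = _ := by
      rw [Qconst]
      field_simp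
      ring

/-- Bound for the initial error. -/
lemma errSq_init_coeff_le (hb : 0 < A.b) (hc₀ : 0 < A.c₀) (hc₁ : 0 < A.c₁) (hγ : 0 < A.γ)
    (hκ : 1 ≤ κ) (hκh : 1 ≤ κh) :
    2 * C.MF ^ 2 * ‖D.K‖ ^ 4 / A.γ ^ 2 * (C.σF ^ 2 / A.nF0) +
      2 * ‖D.K‖ ^ 2 * C.Mψ ^ 2 * (C.σJ ^ 2 / A.nJ0)
      ≤ 9 / 13 * Qconst D C A κ κh / A.b0hat := by
  have hB := Params.b0hat_pos hb hc₁
  have h1 : C.σF ^ 2 / A.nF0 ≤ κ * C.σF ^ 2 / (A.c₀ * A.b0hat / A.γ ^ 2) := by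
    gcongr
    · exact le_mul_of_one_le_left (sq_nonneg _) hκ
    · exact Nat.le_ceil _
  have h2 : C.σJ ^ 2 / A.nJ0 ≤ κh * C.σJ ^ 2 / A.b0hat := by
    gcongr
    · exact le_mul_of_one_le_left (sq_nonneg _) hκh
    · exact Nat.le_ceil _
  calc _ ≤ 2 * C.MF ^ 2 * ‖D.K‖ ^ 4 / A.γ ^ 2 * (κ * C.σF ^ 2 / (A.c₀ * A.b0hat / A.γ ^ 2))
      + 2 * ‖D.K‖ ^ 2 * C.Mψ ^ 2 * (κh * C.σJ ^ 2 / A.b0hat) := by gcongr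
    _ = _ := by
      rw [Qconst]
      field_simp
      ring

end Constants

/-! ### The convergence rate and the random output. -/

section Rate

variable {p q n : ℕ} {Ξ Ω : Type*} [MeasurableSpace Ξ] [MeasurableSpace Ω]
  {D : Problem p q n Ξ} {C : Constants} {A : Params} {S : Batches Ω Ξ A} {μ : Measure Ω}
  [IsProbabilityMeasure μ] {θ η : ℝ} {x₀ : E p}

/-- Solves the coupled pair `hSv`, `hSd` for the sums of errors and squared steps. -/
lemma IsSetup.sum_integral_gradMap_sq_le (h : IsSetup D C S μ θ η (LPhi D C A) x₀)
    (hc₀ : 0 < A.c₀) (hc₁ : 0 < A.c₁) (hβ : 0 ≤ A.β) (hβ1 : A.β ≤ 1)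
    (hθ : θ = theta D C A (S.kappa μ) (S.kappaHat μ)) :
    ∑ t ∈ Finset.range (A.T + 1), ∫ ω, ‖D.gradMap A.γ η (run D S θ η x₀ t ω).x‖ ^ 2 ∂μ
      ≤ (A.T + 1) * (DeltaHat D C A (S.kappa μ) (S.kappaHat μ) x₀ / A.root ^ 2) := by
  have hκ := S.one_le_kappa μ
  have hκh := S.one_le_kappaHat μ
  set κ := S.kappa μ
  set κh := S.kappaHat μ
  have hb := h.b_pos
  have hb' : (0 : ℝ) < A.b := by exact_mod_cast hb
  set v : ℕ → ℝ := fun t => ∫ ω, D.errSq C A.γ (run D S θ η x₀ t ω) ∂μ with hv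
  set d : ℕ → ℝ := fun t => ∫ ω, D.stepSq A.γ η (run D S θ η x₀ t ω) ∂μ with hd
  have hv0 : ∀ t, 0 ≤ v t := fun t => integral_nonneg fun ω => Problem.errSq_nonneg _ _ _
  have hd0 : ∀ t, 0 ≤ d t := fun t => integral_nonneg fun ω => sq_nonneg _
  have hgrad : ∑ t ∈ Finset.range (A.T + 1),
      ∫ ω, ‖D.gradMap A.γ η (run D S θ η x₀ t ω).x‖ ^ 2 ∂μ
      ≤ 8 * (LPhi D C A ^ 2 * ∑ t ∈ Finset.range (A.T + 1), d t)
        + 2 * ∑ t ∈ Finset.range (A.T + 1), v t := by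
    rw [← mul_assoc, Finset.mul_sum, Finset.mul_sum, ← Finset.sum_add_distrib]
    exact Finset.sum_le_sum fun t ht =>
      (h.integral_gradMap_sq_le (Nat.lt_succ_iff.1 (Finset.mem_range.1 ht))).2
  have hstep := h.sum_integral_stepSq_le
  set G := (D.Psi0 x₀).toReal - D.Psi0Star.toReal + D.Bψ with hG
  set L := LPhi D C A with hL
  set P := Pconst D C A κ κh with hP
  set Q := Qconst D C A κ κh with hQ
  have hQ0 : 0 ≤ Q := Qconst_nonneg hc₀ (by linarith) (by linarith)
  have hL0 : 0 < L := h.L_pos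
  have hθ0 := h.θ_mem.1
  set y := A.root with hy
  have hy0 : 0 < y := Params.root_pos hb
  have hy3 : y ^ 3 = A.b * (A.T + 1) := A.root_pow_three
  set s := Real.sqrt A.c₁ with hs
  have hs0 : 0 < s := Real.sqrt_pos.2 hc₁
  have hs2 : s ^ 2 = A.c₁ := Real.sq_sqrt hc₁.le
  have hω : 1 - A.β = A.b / (A.c₁ * y ^ 2) := Params.one_sub_β hb hc₁
  have hθ' : θ = L * A.b / (P * (s * y)) := hθ.trans (theta_eq hb hc₁)
  -- With `P = 0` the quotient defining `θ` would be 0 by the convention for division, contrary to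
  -- `θ > 0`.
  have hP0 : 0 < P := by
    refine lt_of_le_of_ne Pconst_nonneg fun h0 => ?_
    rw [← h0] at hθ'
    simp at hθ'
    linarith
  have hrec := sum_le_of_recursion (v := v) (d := d) (T := A.T) (β := A.β)
    (a := θ ^ 2 * (9 / 13 * P ^ 2 / A.b)) (c := (1 - A.β) ^ 2 * (9 / 13 * Q / A.b))
    (e := 9 / 13 * Q / A.b0hat) hβ hβ1 hv0 hd0 (by positivity) (by positivity)
    (by have := Params.b0hat_pos hb hc₁; positivity)
    (h.integral_errSq_zero_le.trans (errSq_init_coeff_le hb hc₀ hc₁ h.γ_mem.1 hκ hκh))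
    (fun t ht => by
      refine (h.integral_errSq_succ_le ht).trans ?_
      have c1 := errSq_step_coeff_le (D := D) (C := C) hb hc₀ h.γ_mem.1
        (zero_le_one.trans hκ) (zero_le_one.trans hκh)
      have c2 := errSq_var_coeff_le (D := D) (C := C) (κh := κh) hb hc₀ h.γ_mem.1
        (zero_le_one.trans hκ)
      have := hd0 t
      rw [← mul_assoc (A.β ^ 2) (θ ^ 2)]
      gcongr)
  set Sv := ∑ t ∈ Finset.range (A.T + 1), v t
  set Sd := ∑ t ∈ Finset.range (A.T + 1), d t
  have hT : (A.T : ℝ) + 1 = y ^ 3 / A.b := by rw [hy3]; field_simp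
  -- Division of `hrec` by `1 - β = b / (c₁ y²)`. The initial error and the accumulated sampling
  -- noise each give `9/13`; as `θ² P² = L² b² / (c₁ y²)`, the step term becomes `9/26 L²` without
  -- further parameters.
  have hSv : Sv ≤ 18 / 13 * (Q * y / (A.c₁ * A.b)) + 9 / 26 * (L ^ 2 * Sd) := by
    have hT' : (A.T : ℝ) * ((1 - A.β) ^ 2 * (9 / 13 * Q / A.b))
        ≤ y ^ 3 / A.b * ((1 - A.β) ^ 2 * (9 / 13 * Q / A.b)) := by
      gcongr; linarith
    have h1 : A.b / (A.c₁ * y ^ 2) * Sv ≤ A.b / (A.c₁ * y ^ 2) *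
        (18 / 13 * (Q * y / (A.c₁ * A.b)) + 9 / 26 * (L ^ 2 * Sd)) := by
      rw [← hω]
      refine hrec.trans ((add_le_add_left (add_le_add_right hT' _) _).trans (le_of_eq ?_))
      rw [hω, hθ', Params.b0hat_eq, ← hy]
      rw [← hs2]
      field_simp
      ring
    exact le_of_mul_le_mul_left h1 (by positivity)
  -- The summed descent inequality multiplied by `L / θ = P √c₁ y / b`.
  have hSd : L ^ 2 * Sd ≤ P * s * y / A.b * G + Sv / 2 := by
    have e1 : L / θ * (θ * L * Sd) = L ^ 2 * Sd := by field_simp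
    have e2 : L / θ * (G + θ / (2 * L) * Sv) = P * s * y / A.b * G + Sv / 2 := by
      rw [hθ']; field_simp
    rw [← e1, ← e2]
    exact mul_le_mul_of_nonneg_left hstep (by positivity)
  have hG0 : 0 ≤ P * s * y / A.b * G := by
    have : 0 ≤ G := (sub_self _).ge.trans <|
      Problem.PsiReal_sub_le (γ := 0) h.standing h.assumptionPsi h.smoothing le_rfl zero_le_one
        h.x₀_mem h.x₀_mem
    positivity
  have hQ1 : 0 ≤ Q * y / (A.c₁ * A.b) := by positivity
  have e : ((A.T : ℝ) + 1) * (DeltaHat D C A κ κh x₀ / y ^ 2)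
      = 16 * (P * s * y / A.b * G) + 24 * (Q * y / (A.c₁ * A.b)) := by
    rw [hT, DeltaHat]
    field_simp
    ring
  rw [e]
  -- Elimination gives `(43/52) Sv ≤ (18/13) q + (9/26) g`; hence `8 L² Sd + 2 Sv ≤ 8 g + 6 Sv`
  -- stays below `16 g + 24 q`.
  linarith

/-- The random output index averages the squared norms of the gradient mapping. -/
lemma IsSetup.integral_output (h : IsSetup D C S μ θ η (LPhi D C A) x₀) {τ : Ω → ℕ}
    (hτ : IsOutputIndex S θ μ (LPhi D C A) τ) :
    Integrable (fun ω => ‖D.gradMap A.γ η (iterate D S θ η x₀ (τ ω) ω)‖ ^ 2) μ ∧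
    ∫ ω, ‖D.gradMap A.γ η (iterate D S θ η x₀ (τ ω) ω)‖ ^ 2 ∂μ = ((A.T : ℝ) + 1)⁻¹ *
      ∑ t ∈ Finset.range (A.T + 1), ∫ ω, ‖D.gradMap A.γ η (run D S θ η x₀ t ω).x‖ ^ 2 ∂μ := by
  set g : ℕ → Ω → ℝ := fun t ω => ‖D.gradMap A.γ η (run D S θ η x₀ t ω).x‖ ^ 2 with hg
  -- Splitting over the events `τ = t` expresses the output as a finite sum of products of
  -- independent factors.
  set χ : ℕ → ℕ → ℝ := fun t s => if s = t then 1 else 0 with hχ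
  have hχm : ∀ t, Measurable (χ t) := fun t => measurable_of_countable _
  have hT : (0 : ℝ) < A.T + 1 := by positivity
  have hprob : ∀ t ∈ Finset.range (A.T + 1),
      μ {ω | τ ω = t} = ENNReal.ofReal ((A.T : ℝ) + 1)⁻¹ := by
    intro t ht
    rw [hτ.prob t (Nat.lt_succ_iff.1 (Finset.mem_range.1 ht)), Finset.sum_const,
      Finset.card_range, nsmul_eq_mul]
    have hne := (div_pos h.θ_mem.1 h.L_pos).ne'
    push_cast
    rw [← div_div, div_right_comm, div_self hne, one_div]
  -- The `T + 1` prescribed probabilities already sum to 1, so other values of `τ` form a null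
  -- event.
  have hae : ∀ᵐ ω ∂μ, τ ω ∈ Finset.range (A.T + 1) := by
    have hU : {ω | τ ω ∈ Finset.range (A.T + 1)}
        = ⋃ t ∈ Finset.range (A.T + 1), {ω | τ ω = t} := by
      ext ω; simp
    have hm : ∀ t, MeasurableSet {ω | τ ω = t} := fun t => hτ.meas (measurableSet_singleton t)
    have h1 : μ {ω | τ ω ∈ Finset.range (A.T + 1)} = 1 := by
      rw [hU, measure_biUnion_finset (fun s _ t _ hst => Set.disjoint_left.2
        fun ω hs ht => hst (hs.symm.trans ht)) fun t _ => hm t, Finset.sum_congr rfl hprob,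
        Finset.sum_const, Finset.card_range, nsmul_eq_mul, ← ENNReal.ofReal_natCast,
        ← ENNReal.ofReal_mul (by positivity)]
      push_cast
      rw [mul_inv_cancel₀ hT.ne', ENNReal.ofReal_one]
    have hms : MeasurableSet {ω | τ ω ∈ Finset.range (A.T + 1)} := by
      rw [hU]; exact Finset.measurableSet_biUnion _ fun t _ => hm t
    exact (prob_compl_eq_zero_iff hms).2 h1
  have hind : ∀ t ∈ Finset.range (A.T + 1), IndepFun (fun ω => χ t (τ ω)) (g t) μ := by
    intro t ht
    have ht' := Nat.lt_succ_iff.1 (Finset.mem_range.1 ht)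
    refine indepFun_of_comap hτ.indep ?_ ?_
    · exact (hχm t).comp (comap_measurable τ)
    · have hx := (measurable_run_past h.standing h.assumptionPsi h.smoothing h.γ_mem.1 h.η_pos
        h.θ_mem h.x₀_mem S ht').1
      have hsq : Measurable fun z : E p => ‖z‖ ^ 2 := by fun_prop
      exact hsq.comp (h.measurable_gradMap_comp hx (h.run_mem t))
  have hgi : ∀ t ∈ Finset.range (A.T + 1), Integrable (g t) μ := fun t ht =>
    (h.integral_gradMap_sq_le (Nat.lt_succ_iff.1 (Finset.mem_range.1 ht))).1
  have hχi : ∀ t, Integrable (fun ω => χ t (τ ω)) μ := fun t =>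
    Integrable.of_bound ((hχm t).comp hτ.meas).aestronglyMeasurable 1
      (Filter.Eventually.of_forall fun ω => by
        simp only [hχ]; split_ifs <;> simp)
  have hχint : ∀ t ∈ Finset.range (A.T + 1), ∫ ω, χ t (τ ω) ∂μ = ((A.T : ℝ) + 1)⁻¹ := by
    intro t ht
    have e : (fun ω => χ t (τ ω)) = {ω | τ ω = t}.indicator fun _ => 1 := by
      ext ω
      simp [hχ, Set.indicator_apply]
    have hms : MeasurableSet {ω | τ ω = t} := hτ.meas (measurableSet_singleton t)
    rw [e, integral_indicator_const _ hms, measureReal_def,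
      hprob t ht, ENNReal.toReal_ofReal (by positivity), smul_eq_mul, mul_one]
  have hprodi : ∀ t ∈ Finset.range (A.T + 1), Integrable (fun ω => χ t (τ ω) * g t ω) μ :=
    fun t ht => (hind t ht).integrable_mul (hχi t) (hgi t ht)
  have heq : (fun ω => ‖D.gradMap A.γ η (iterate D S θ η x₀ (τ ω) ω)‖ ^ 2)
      =ᵐ[μ] fun ω => ∑ t ∈ Finset.range (A.T + 1), χ t (τ ω) * g t ω := by
    filter_upwards [hae] with ω hω
    simp only [hχ, ite_mul, one_mul, zero_mul]
    rw [Finset.sum_ite_eq, if_pos hω]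
    rfl
  refine ⟨(integrable_finsetSum _ hprodi).congr heq.symm, ?_⟩
  rw [integral_congr_ae heq, integral_finsetSum _ hprodi, Finset.mul_sum]
  refine Finset.sum_congr rfl fun t ht => ?_
  rw [(hind t ht).integral_fun_mul_eq_mul_integral (hχi t).aestronglyMeasurable
    (hgi t ht).aestronglyMeasurable, hχint t ht]

end Rate

/-! ### Numbers of evaluations. -/

section Counts

variable {p q n : ℕ} {Ξ Ω : Type*} [MeasurableSpace Ξ] {D : Problem p q n Ξ} {A : Params}
  {S : Batches Ω Ξ A} {θ η : ℝ} {x₀ : E p}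

/-- The first batch of an iteration is evaluated at two points and the second at one, so each
iteration costs three batches. -/
lemma card_queriesF (ω : Ω) :
    ((queriesF D S θ η x₀ ω).card : ℝ) = A.nF0 + 3 * A.T * A.nF := by
  have h : (queriesF D S θ η x₀ ω).card = A.nF0 + A.T * (A.nF + A.nF + A.nF) := by
    simp [queriesF, Multiset.card_sum, add_assoc]
  rw [h]
  push_cast
  ring

lemma card_queriesJ (ω : Ω) :
    ((queriesJ D S θ η x₀ ω).card : ℝ) = A.nJ0 + 3 * A.T * A.b := by
  have h : (queriesJ D S θ η x₀ ω).card = A.nJ0 + A.T * (A.b + A.b + A.b) := by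
    simp [queriesJ, Multiset.card_sum, add_assoc]
  rw [h]
  push_cast
  ring

end Counts

/-! ### Complexity bounds; `w` plays the role of `Δ^{1/2}`. -/

section Complexity

variable {A : Params} {w ε : ℝ}

lemma rpow_three_halves {Δ : ℝ} (hΔ : 0 ≤ Δ) : Δ ^ (3 / 2 : ℝ) = (Δ ^ (1 / 2 : ℝ)) ^ 3 := by
  rw [← Real.rpow_natCast, ← Real.rpow_mul hΔ]
  norm_num

lemma rpow_half_sq {Δ : ℝ} (hΔ : 0 ≤ Δ) : (Δ ^ (1 / 2 : ℝ)) ^ 2 = Δ := by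
  rw [← Real.rpow_natCast, ← Real.rpow_mul hΔ]
  norm_num

namespace Params

lemma cast_T_le (hw : 0 ≤ w) (hε : 0 < ε)
    (hT : A.T ≤ ⌊w ^ 3 / (A.b * ε ^ 3)⌋₊) : (A.T : ℝ) ≤ w ^ 3 / (A.b * ε ^ 3) :=
  le_trans (by exact_mod_cast hT) (Nat.floor_le (by positivity))

lemma b_mul_T_le (hb : 0 < A.b) (hw : 0 ≤ w) (hε : 0 < ε)
    (hT : A.T ≤ ⌊w ^ 3 / (A.b * ε ^ 3)⌋₊) : (A.b : ℝ) * A.T ≤ (w / ε) ^ 3 := by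
  have hb' : (0 : ℝ) < A.b := by exact_mod_cast hb
  calc (A.b : ℝ) * A.T ≤ A.b * (w ^ 3 / (A.b * ε ^ 3)) := by gcongr; exact cast_T_le hw hε hT
    _ = _ := by rw [div_pow]; field_simp

/-- The bound concerns `T`, while `y³ = b T + b`. The extra `b` produces the summand `b^{1/3}`, by
`(w/ε)³ + b ≤ (w/ε + b^{1/3})³`. -/
lemma root_le (hb : 0 < A.b) (hw : 0 ≤ w) (hε : 0 < ε)
    (hT : A.T ≤ ⌊w ^ 3 / (A.b * ε ^ 3)⌋₊) :
    A.root ≤ w / ε + (A.b : ℝ) ^ (1 / 3 : ℝ) := by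
  have hz : ((A.b : ℝ) ^ (1 / 3 : ℝ)) ^ 3 = A.b := by
    rw [← Real.rpow_natCast, ← Real.rpow_mul (by positivity)]
    norm_num
  have hz0 : 0 ≤ (A.b : ℝ) ^ (1 / 3 : ℝ) := by positivity
  set z := (A.b : ℝ) ^ (1 / 3 : ℝ)
  have hwe : 0 ≤ w / ε := by positivity
  refine le_of_pow_le_pow_left₀ three_ne_zero (by positivity) ?_
  rw [A.root_pow_three]
  have h1 := b_mul_T_le hb hw hε hT
  have h2 : 0 ≤ (w / ε) ^ 2 * z + w / ε * z ^ 2 := by positivity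
  nlinarith

lemma nF0_le (hb : 0 < A.b) (hc₀ : 0 < A.c₀) (hc₁ : 0 < A.c₁) (hγ : 0 < A.γ) :
    (A.nF0 : ℝ) ≤ A.c₀ * A.c₁ ^ 2 / A.γ ^ 2 * A.root + 1 := by
  have hB := b0hat_pos hb hc₁
  refine (Nat.ceil_lt_add_one (by positivity)).le.trans (le_of_eq ?_)
  rw [b0hat_eq]; ring

lemma nJ0_le (hb : 0 < A.b) (hc₁ : 0 < A.c₁) : (A.nJ0 : ℝ) ≤ A.c₁ ^ 2 * A.root + 1 :=
  (Nat.ceil_lt_add_one (b0hat_pos hb hc₁).le).le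

lemma nF_le (hb : 0 < A.b) (hc₀ : 0 < A.c₀) (hγ : 0 < A.γ) :
    (A.nF : ℝ) ≤ A.c₀ / A.γ ^ 2 * A.b + 1 := by
  have hb' : (0 : ℝ) < A.b := by exact_mod_cast hb
  refine (Nat.ceil_lt_add_one (by positivity)).le.trans (le_of_eq ?_)
  ring

lemma evaluationsF_le (hb : 0 < A.b) (hc₀ : 0 < A.c₀) (hc₁ : 0 < A.c₁) (hγ : 0 < A.γ)
    (hw : 0 ≤ w) (hε : 0 < ε) (hT : A.T ≤ ⌊w ^ 3 / (A.b * ε ^ 3)⌋₊) :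
    (A.nF0 : ℝ) + 3 * A.T * A.nF ≤ A.c₀ * A.c₁ ^ 2 * w / (A.γ ^ 2 * ε)
      + 3 * A.c₀ * w ^ 3 / (A.γ ^ 2 * ε ^ 3)
      + (A.c₀ * A.c₁ ^ 2 * (A.b : ℝ) ^ (1 / 3 : ℝ) / A.γ ^ 2 + 3 * A.T + 1) := by
  have h1 := nF0_le hb hc₀ hc₁ hγ
  have h2 : 3 * (A.T : ℝ) * A.nF ≤ 3 * A.T * (A.c₀ / A.γ ^ 2 * A.b + 1) := by
    gcongr; exact nF_le hb hc₀ hγ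
  have h3 : A.c₀ * A.c₁ ^ 2 / A.γ ^ 2 * A.root
      ≤ A.c₀ * A.c₁ ^ 2 / A.γ ^ 2 * (w / ε + (A.b : ℝ) ^ (1 / 3 : ℝ)) := by
    gcongr; exact root_le hb hw hε hT
  have h4 : 3 * A.c₀ / A.γ ^ 2 * (A.b * A.T) ≤ 3 * A.c₀ / A.γ ^ 2 * (w / ε) ^ 3 := by
    gcongr; exact b_mul_T_le hb hw hε hT
  have e1 : A.c₀ * A.c₁ ^ 2 * w / (A.γ ^ 2 * ε) = A.c₀ * A.c₁ ^ 2 / A.γ ^ 2 * (w / ε) := by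
    field_simp
  have e2 : 3 * A.c₀ * w ^ 3 / (A.γ ^ 2 * ε ^ 3) = 3 * A.c₀ / A.γ ^ 2 * (w / ε) ^ 3 := by
    field_simp
  rw [e1, e2]
  calc _ ≤ A.c₀ * A.c₁ ^ 2 / A.γ ^ 2 * (w / ε + (A.b : ℝ) ^ (1 / 3 : ℝ)) + 1
        + (3 * A.c₀ / A.γ ^ 2 * (w / ε) ^ 3 + 3 * A.T) := by
        have e : 3 * (A.T : ℝ) * (A.c₀ / A.γ ^ 2 * A.b + 1)
          = 3 * A.c₀ / A.γ ^ 2 * (A.b * A.T) + 3 * A.T := by ring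
        linarith
    _ = _ := by ring

lemma evaluationsJ_le (hb : 0 < A.b) (hc₁ : 0 < A.c₁)
    (hw : 0 ≤ w) (hε : 0 < ε) (hT : A.T ≤ ⌊w ^ 3 / (A.b * ε ^ 3)⌋₊) :
    (A.nJ0 : ℝ) + 3 * A.T * A.b ≤ A.c₁ ^ 2 * w / ε + 3 * w ^ 3 / ε ^ 3
      + (A.c₁ ^ 2 * (A.b : ℝ) ^ (1 / 3 : ℝ) + 1) := by
  have h1 := nJ0_le hb hc₁
  have h3 : A.c₁ ^ 2 * A.root ≤ A.c₁ ^ 2 * (w / ε + (A.b : ℝ) ^ (1 / 3 : ℝ)) := by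
    gcongr; exact root_le hb hw hε hT
  have h4 := b_mul_T_le hb hw hε hT
  have e1 : A.c₁ ^ 2 * w / ε = A.c₁ ^ 2 * (w / ε) := by ring
  have e2 : 3 * w ^ 3 / ε ^ 3 = 3 * (w / ε) ^ 3 := by ring
  rw [e1, e2]
  linarith

lemma root_eq_of_T_eq (hb : 0 < A.b) (hw : 0 ≤ w) (hε : 0 < ε)
    (hT : (A.T : ℝ) + 1 = w ^ 3 / (A.b * ε ^ 3)) : A.root = w / ε := by
  have hb' : (0 : ℝ) < A.b := by exact_mod_cast hb
  refine (pow_left_inj₀ (root_pos hb).le (by positivity) three_ne_zero).1 ?_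
  rw [A.root_pow_three, hT]
  field_simp

lemma evaluationsF_le_of_exact (hb : 0 < A.b) (hc₀ : 0 < A.c₀) (hγ : 0 < A.γ)
    (hw : 0 ≤ w) (hε : 0 < ε) (hT : (A.T : ℝ) + 1 = w ^ 3 / (A.b * ε ^ 3))
    (h0 : (A.nF0 : ℝ) = A.c₀ * A.b0hat / A.γ ^ 2) (h1 : (A.nF : ℝ) = A.c₀ * A.b / A.γ ^ 2) :
    (A.nF0 : ℝ) + 3 * A.T * A.nF ≤ A.c₀ * A.c₁ ^ 2 * w / (A.γ ^ 2 * ε)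
      + 3 * A.c₀ * w ^ 3 / (A.γ ^ 2 * ε ^ 3) := by
  have hb' : (0 : ℝ) < A.b := by exact_mod_cast hb
  rw [h0, h1, b0hat_eq, root_eq_of_T_eq hb hw hε hT]
  have hT' : (A.T : ℝ) ≤ w ^ 3 / (A.b * ε ^ 3) := by linarith
  calc _ ≤ A.c₀ * (A.c₁ ^ 2 * (w / ε)) / A.γ ^ 2
        + 3 * (w ^ 3 / (A.b * ε ^ 3)) * (A.c₀ * A.b / A.γ ^ 2) := by gcongr
    _ = _ := by field_simp

lemma evaluationsJ_le_of_exact (hb : 0 < A.b)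
    (hw : 0 ≤ w) (hε : 0 < ε) (hT : (A.T : ℝ) + 1 = w ^ 3 / (A.b * ε ^ 3))
    (h0 : (A.nJ0 : ℝ) = A.b0hat) :
    (A.nJ0 : ℝ) + 3 * A.T * A.b ≤ A.c₁ ^ 2 * w / ε + 3 * w ^ 3 / ε ^ 3 := by
  have hb' : (0 : ℝ) < A.b := by exact_mod_cast hb
  rw [h0, b0hat_eq, root_eq_of_T_eq hb hw hε hT]
  have hT' : (A.T : ℝ) ≤ w ^ 3 / (A.b * ε ^ 3) := by linarith
  calc _ ≤ A.c₁ ^ 2 * (w / ε) + 3 * (w ^ 3 / (A.b * ε ^ 3)) * A.b := by gcongr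
    _ = _ := by field_simp

/-- For small `ε`, all rounding terms are dominated by `(w / ε)³`. -/
lemma rounding_terms_le (hb : 0 < A.b) (hw : 0 ≤ w) (hε : 0 < ε) (hεw : ε ≤ w)
    (hbw : A.b * ε ^ 3 ≤ w ^ 3) (hT : A.T ≤ ⌊w ^ 3 / (A.b * ε ^ 3)⌋₊) :
    1 ≤ (w / ε) ^ 3 ∧ w / ε ≤ (w / ε) ^ 3 ∧ (A.b : ℝ) ^ (1 / 3 : ℝ) ≤ (w / ε) ^ 3 ∧
      (A.T : ℝ) ≤ (w / ε) ^ 3 := by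
  have hb1 : (1 : ℝ) ≤ A.b := by exact_mod_cast hb
  have hr1 : 1 ≤ w / ε := (one_le_div hε).2 hεw
  have hr3 : w / ε ≤ (w / ε) ^ 3 := le_self_pow₀ hr1 three_ne_zero
  refine ⟨hr1.trans hr3, hr3, ?_, ?_⟩
  · have hbr : (A.b : ℝ) ≤ (w / ε) ^ 3 := by rw [div_pow, le_div_iff₀ (by positivity)]; exact hbw
    refine le_trans ?_ hbr
    calc (A.b : ℝ) ^ (1 / 3 : ℝ) ≤ (A.b : ℝ) ^ (1 : ℝ) :=
          Real.rpow_le_rpow_of_exponent_le hb1 (by norm_num)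
      _ = A.b := Real.rpow_one _
  · have h := b_mul_T_le hb hw hε hT
    nlinarith [(Nat.cast_nonneg A.T : (0 : ℝ) ≤ A.T)]

lemma evaluationsF_le_order (hb : 0 < A.b) (hc₀ : 0 < A.c₀) (hc₁ : 0 < A.c₁) (hγ : 0 < A.γ)
    (hγ1 : A.γ ≤ 1) (hw : 0 ≤ w) (hε : 0 < ε) (hεw : ε ≤ w) (hbw : A.b * ε ^ 3 ≤ w ^ 3)
    (hT : A.T ≤ ⌊w ^ 3 / (A.b * ε ^ 3)⌋₊) :
    (A.nF0 : ℝ) + 3 * A.T * A.nF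
      ≤ (2 * A.c₀ * A.c₁ ^ 2 + 3 * A.c₀ + 4) * (w ^ 3 / (A.γ ^ 2 * ε ^ 3)) := by
  refine (evaluationsF_le hb hc₀ hc₁ hγ hw hε hT).trans ?_
  obtain ⟨h1, h2, h3, h4⟩ := rounding_terms_le hb hw hε hεw hbw hT
  have e1 : A.c₀ * A.c₁ ^ 2 * w / (A.γ ^ 2 * ε) = A.c₀ * A.c₁ ^ 2 / A.γ ^ 2 * (w / ε) := by
    field_simp
  have e2 : 3 * A.c₀ * w ^ 3 / (A.γ ^ 2 * ε ^ 3) = 3 * A.c₀ / A.γ ^ 2 * (w / ε) ^ 3 := by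
    field_simp
  have e3 : A.c₀ * A.c₁ ^ 2 * (A.b : ℝ) ^ (1 / 3 : ℝ) / A.γ ^ 2
      = A.c₀ * A.c₁ ^ 2 / A.γ ^ 2 * (A.b : ℝ) ^ (1 / 3 : ℝ) := by ring
  have e4 : w ^ 3 / (A.γ ^ 2 * ε ^ 3) = (w / ε) ^ 3 / A.γ ^ 2 := by
    rw [div_pow]; field_simp
  rw [e1, e2, e3, e4]
  set r := (w / ε) ^ 3
  set a := A.c₀ * A.c₁ ^ 2 / A.γ ^ 2 with ha
  have ha0 : 0 ≤ a := by positivity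
  -- Since `γ ≤ 1`, the rounding terms without `γ` also fit into the order `γ⁻² r`.
  have h5 : r ≤ r / A.γ ^ 2 := by
    rw [le_div_iff₀ (by positivity)]
    have : A.γ ^ 2 ≤ 1 := pow_le_one₀ hγ.le hγ1
    nlinarith
  have h6 := mul_le_mul_of_nonneg_left h2 ha0
  have h7 := mul_le_mul_of_nonneg_left h3 ha0
  have e5 : (2 * A.c₀ * A.c₁ ^ 2 + 3 * A.c₀ + 4) * (r / A.γ ^ 2)
      = 2 * (a * r) + 3 * A.c₀ / A.γ ^ 2 * r + 4 * (r / A.γ ^ 2) := by rw [ha]; ring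
  rw [e5]
  linarith

lemma evaluationsJ_le_order (hb : 0 < A.b) (hc₁ : 0 < A.c₁) (hw : 0 ≤ w) (hε : 0 < ε)
    (hεw : ε ≤ w) (hbw : A.b * ε ^ 3 ≤ w ^ 3) (hT : A.T ≤ ⌊w ^ 3 / (A.b * ε ^ 3)⌋₊) :
    (A.nJ0 : ℝ) + 3 * A.T * A.b ≤ (2 * A.c₁ ^ 2 + 4) * (w ^ 3 / ε ^ 3) := by
  refine (evaluationsJ_le hb hc₁ hw hε hT).trans ?_
  obtain ⟨h1, h2, h3, -⟩ := rounding_terms_le hb hw hε hεw hbw hT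
  have e1 : A.c₁ ^ 2 * w / ε = A.c₁ ^ 2 * (w / ε) := by ring
  have e2 : 3 * w ^ 3 / ε ^ 3 = 3 * (w / ε) ^ 3 := by ring
  have e3 : w ^ 3 / ε ^ 3 = (w / ε) ^ 3 := by ring
  rw [e1, e2, e3]
  have h6 := mul_le_mul_of_nonneg_left h2 (sq_nonneg A.c₁)
  have h7 := mul_le_mul_of_nonneg_left h3 (sq_nonneg A.c₁)
  linarith

end Params

end Complexity

/-! ### Signs of `L` and `Δ̂₀`. -/

section Constants

variable {p q n : ℕ} {Ξ : Type*} [MeasurableSpace Ξ] {D : Problem p q n Ξ} {C : Constants}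
  {A : Params} {κ κh : ℝ} {x₀ : E p}

/-- `K = 0` is not excluded beforehand, but `L = 0` would force `θ = 0`. -/
lemma LPhi_pos (hF : D.AssumptionF C) (hψ : D.AssumptionPsi C) (hγ : 0 < A.γ)
    (hθ : theta D C A κ κh ≠ 0) : 0 < LPhi D C A := by
  have h1 := hF.LF_pos
  have h2 := hψ.Mψ_pos
  have h0 : 0 ≤ LPhi D C A := by unfold LPhi; positivity
  refine lt_of_le_of_ne h0 fun h => hθ ?_
  rw [theta, ← h, zero_mul, zero_div]

lemma DeltaHat_nonneg (hD : D.Standing) (hψ : D.AssumptionPsi C) (hd : D.AssumptionSmoothing)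
    (hc₀ : 0 < A.c₀) (hc₁ : 0 < A.c₁) (hκ : 0 ≤ κ) (hκh : 0 ≤ κh) (hx : x₀ ∈ effDom D.R) :
    0 ≤ DeltaHat D C A κ κh x₀ := by
  -- The comparison is used with both points equal to `x₀`, so its left side is 0.
  have h4 : 0 ≤ (D.Psi0 x₀).toReal - D.Psi0Star.toReal + D.Bψ := (sub_self _).ge.trans <|
    Problem.PsiReal_sub_le (γ := 0) hD hψ hd le_rfl zero_le_one hx hx
  have h5 := Pconst_nonneg (D := D) (C := C) (A := A) (κ := κ) (κh := κh)
  have h6 := Qconst_nonneg (D := D) (C := C) hc₀ hκ hκh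
  unfold DeltaHat
  positivity

end Constants

end HybridMinimax

theorem theorem3 {p q n : ℕ} {Ξ Ω : Type*} [MeasurableSpace Ξ] [MeasurableSpace Ω]
    (D : HybridMinimax.Problem p q n Ξ) (C : HybridMinimax.Constants)
    (A : HybridMinimax.Params)
    (hD : D.Standing) (hF : D.AssumptionF C) (hψ : D.AssumptionPsi C)
    (hd : D.AssumptionSmoothing)
    (hγ : A.γ ∈ Set.Ioc (0 : ℝ) 1) (hc₀ : 0 < A.c₀) (hc₁ : 0 < A.c₁) (hb : 0 < A.b)
    (x₀ : HybridMinimax.E p) (hx₀ : x₀ ∈ HybridMinimax.effDom D.Psi0)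
    (μ : MeasureTheory.Measure Ω) [MeasureTheory.IsProbabilityMeasure μ]
    (S : HybridMinimax.Batches Ω Ξ A) (hS : S.IsSampling μ D.law)
    (κ κh : ℝ) (hκ : κ = S.kappa μ) (hκh : κh = S.kappaHat μ)
    (θ η Δ : ℝ) (hθ : θ = HybridMinimax.theta D C A κ κh)
    (hη : η = HybridMinimax.eta D C A κ κh)
    (hΔ : Δ = HybridMinimax.DeltaHat D C A κ κh x₀)
    (hβmem : A.β ∈ Set.Ioc (0 : ℝ) 1) (hθmem : θ ∈ Set.Ioc (0 : ℝ) 1)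
    (τ : Ω → ℕ)
    (hτ : HybridMinimax.IsOutputIndex S θ μ (HybridMinimax.LPhi D C A) τ)
    (G : Ω → ℝ)
    (hG : G = fun ω =>
      ‖D.gradMap A.γ η (HybridMinimax.iterate D S θ η x₀ (τ ω) ω)‖ ^ 2)
    (NF NJ : Ω → ℝ)
    (hNF : NF = fun ω => ((HybridMinimax.queriesF D S θ η x₀ ω).card : ℝ))
    (hNJ : NJ = fun ω => ((HybridMinimax.queriesJ D S θ η x₀ ω).card : ℝ)) :
    -- convergence rate
    (MeasureTheory.Integrable G μ ∧
      ∫ ω, G ω ∂μ ≤ Δ / ((A.b : ℝ) * (A.T + 1)) ^ (2 / 3 : ℝ)) ∧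
    -- number of iterations: `T = ⌊Δ^{3/2} / (b ε³)⌋` iterations (or more) suffice
    (∀ ε : ℝ, 0 < ε → Δ ^ (3 / 2 : ℝ) / (A.b * ε ^ 3) ≤ A.T + 1 → ∫ ω, G ω ∂μ ≤ ε ^ 2) ∧
    -- numbers of evaluations for at most `⌊Δ^{3/2} / (b ε³)⌋` iterations; the last summands are
    -- due to rounding `T` and the batch sizes to integers
    (∀ ε : ℝ, 0 < ε → A.T ≤ ⌊Δ ^ (3 / 2 : ℝ) / (A.b * ε ^ 3)⌋₊ → ∀ ω,
      NF ω ≤ A.c₀ * A.c₁ ^ 2 * Δ ^ (1 / 2 : ℝ) / (A.γ ^ 2 * ε)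
          + 3 * A.c₀ * Δ ^ (3 / 2 : ℝ) / (A.γ ^ 2 * ε ^ 3)
          + (A.c₀ * A.c₁ ^ 2 * (A.b : ℝ) ^ (1 / 3 : ℝ) / A.γ ^ 2 + 3 * A.T + 1) ∧
      NJ ω ≤ A.c₁ ^ 2 * Δ ^ (1 / 2 : ℝ) / ε + 3 * Δ ^ (3 / 2 : ℝ) / ε ^ 3
          + (A.c₁ ^ 2 * (A.b : ℝ) ^ (1 / 3 : ℝ) + 1) ∧
      (∀ c₂ : ℝ, 0 < c₂ → A.γ = c₂ * ε →
        NF ω ≤ A.c₀ * A.c₁ ^ 2 * Δ ^ (1 / 2 : ℝ) / (c₂ ^ 2 * ε ^ 3)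
          + 3 * A.c₀ * Δ ^ (3 / 2 : ℝ) / (c₂ ^ 2 * ε ^ 5)
          + (A.c₀ * A.c₁ ^ 2 * (A.b : ℝ) ^ (1 / 3 : ℝ) / (c₂ ^ 2 * ε ^ 2) + 3 * A.T + 1))) ∧
    -- the same without rounding
    (∀ ε : ℝ, 0 < ε → (A.T : ℝ) + 1 = Δ ^ (3 / 2 : ℝ) / (A.b * ε ^ 3) →
      (A.nF0 : ℝ) = A.c₀ * A.b0hat / A.γ ^ 2 → (A.nF : ℝ) = A.c₀ * A.b / A.γ ^ 2 →
      (A.nJ0 : ℝ) = A.b0hat → ∀ ω,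
      NF ω ≤ A.c₀ * A.c₁ ^ 2 * Δ ^ (1 / 2 : ℝ) / (A.γ ^ 2 * ε)
          + 3 * A.c₀ * Δ ^ (3 / 2 : ℝ) / (A.γ ^ 2 * ε ^ 3) ∧
      NJ ω ≤ A.c₁ ^ 2 * Δ ^ (1 / 2 : ℝ) / ε + 3 * Δ ^ (3 / 2 : ℝ) / ε ^ 3) ∧
    -- orders of magnitude, with constants depending only on `c₀`, `c₁` (and `c₂`)
    (∀ ε : ℝ, 0 < ε → ε ^ 2 ≤ Δ → A.b * ε ^ 3 ≤ Δ ^ (3 / 2 : ℝ) →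
      A.T ≤ ⌊Δ ^ (3 / 2 : ℝ) / (A.b * ε ^ 3)⌋₊ → ∀ ω,
      NF ω ≤ (2 * A.c₀ * A.c₁ ^ 2 + 3 * A.c₀ + 4)
          * (Δ ^ (3 / 2 : ℝ) / (A.γ ^ 2 * ε ^ 3)) ∧
      NJ ω ≤ (2 * A.c₁ ^ 2 + 4) * (Δ ^ (3 / 2 : ℝ) / ε ^ 3) ∧
      (∀ c₂ : ℝ, 0 < c₂ → A.γ = c₂ * ε →
        NF ω ≤ (2 * A.c₀ * A.c₁ ^ 2 + 3 * A.c₀ + 4) / c₂ ^ 2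
          * (Δ ^ (3 / 2 : ℝ) / ε ^ 5))) := by
  subst hG hNF hNJ
  have hκ1 : 1 ≤ κ := hκ ▸ S.one_le_kappa μ
  have hκh1 : 1 ≤ κh := hκh ▸ S.one_le_kappaHat μ
  have hdom := HybridMinimax.Problem.effDom_Psi0 hD hψ hd
  have hx : x₀ ∈ HybridMinimax.effDom D.R := hdom ▸ hx₀
  have hL : 0 < HybridMinimax.LPhi D C A := HybridMinimax.LPhi_pos hF hψ hγ.1
    (by rw [hθ] at hθmem; exact hθmem.1.ne')
  have hsetup : HybridMinimax.IsSetup D C S μ θ η (HybridMinimax.LPhi D C A) x₀ :=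
    { standing := hD
      assumptionF := hF
      assumptionPsi := hψ
      smoothing := hd
      γ_mem := hγ
      θ_mem := hθmem
      L_eq := rfl
      L_pos := hL
      η_eq := by rw [hη, HybridMinimax.eta, hθ]
      x₀_mem := hx
      sampling := hS
      b_pos := hb
      nF_pos := HybridMinimax.Params.nF_pos hb hc₀ hγ.1
      nF0_pos := HybridMinimax.Params.nF0_pos hb hc₀ hc₁ hγ.1
      nJ0_pos := HybridMinimax.Params.nJ0_pos hb hc₁ }
  have hb' : (0 : ℝ) < A.b := by exact_mod_cast hb
  have hΔ0 : 0 ≤ Δ := by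
    rw [hΔ]
    exact HybridMinimax.DeltaHat_nonneg hD hψ hd hc₀ hc₁ (by linarith) (by linarith) hx
  obtain ⟨hGi, hGint⟩ := hsetup.integral_output hτ
  have hroot := HybridMinimax.Params.root_pos hb
  have hrate : ∫ ω, ‖D.gradMap A.γ η (HybridMinimax.iterate D S θ η x₀ (τ ω) ω)‖ ^ 2 ∂μ
      ≤ Δ / ((A.b : ℝ) * (A.T + 1)) ^ (2 / 3 : ℝ) := by
    have hsum := hsetup.sum_integral_gradMap_sq_le hc₀ hc₁ hβmem.1.le hβmem.2
      (by rw [hθ, hκ, hκh])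
    rw [← hκ, ← hκh, ← hΔ] at hsum
    rw [hGint, ← A.root_sq, inv_mul_le_iff₀ (by positivity)]
    exact hsum
  -- Turns `Δ` and `Δ^{3/2}` into the integer powers `w²` and `w³`.
  set w := Δ ^ (1 / 2 : ℝ) with hw
  have hw0 : 0 ≤ w := Real.rpow_nonneg hΔ0 _
  have hw2 : w ^ 2 = Δ := HybridMinimax.rpow_half_sq hΔ0
  rw [HybridMinimax.rpow_three_halves hΔ0, ← hw]
  simp only [HybridMinimax.card_queriesF, HybridMinimax.card_queriesJ]
  refine ⟨⟨hGi, hrate⟩, ?_, ?_, ?_, ?_⟩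
  · intro ε hε hT
    refine hrate.trans ?_
    rw [← A.root_sq, div_le_iff₀ (by positivity), ← hw2, ← mul_pow]
    -- Both the lower bound on `T + 1` and the definition of `y` are cubic; taking cube roots gives
    -- `w ≤ ε y`, that is, `Δ / y² ≤ ε²`.
    have h3 : w ^ 3 ≤ (ε * A.root) ^ 3 := by
      rw [div_le_iff₀ (by positivity)] at hT
      rw [mul_pow, A.root_pow_three]
      linarith
    gcongr
    exact le_of_pow_le_pow_left₀ three_ne_zero (by positivity) h3
  · intro ε hε hT ω
    have h1 := HybridMinimax.Params.evaluationsF_le hb hc₀ hc₁ hγ.1 hw0 hε hT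
    refine ⟨h1, HybridMinimax.Params.evaluationsJ_le hb hc₁ hw0 hε hT, fun c₂ hc₂ hγc => ?_⟩
    refine h1.trans (le_of_eq ?_)
    rw [hγc]
    field_simp
  · intro ε hε hT h0 h1 h2 ω
    exact ⟨HybridMinimax.Params.evaluationsF_le_of_exact hb hc₀ hγ.1 hw0 hε hT h0 h1,
      HybridMinimax.Params.evaluationsJ_le_of_exact hb hw0 hε hT h2⟩
  · intro ε hε hεΔ hbε hT ω
    have hεw : ε ≤ w := le_of_pow_le_pow_left₀ two_ne_zero hw0 (by rw [hw2]; exact hεΔ)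
    have h1 := HybridMinimax.Params.evaluationsF_le_order hb hc₀ hc₁ hγ.1 hγ.2 hw0 hε hεw hbε hT
    refine ⟨h1, HybridMinimax.Params.evaluationsJ_le_order hb hc₁ hw0 hε hεw hbε hT,
      fun c₂ hc₂ hγc => ?_⟩
    refine h1.trans (le_of_eq ?_)
    rw [hγc]
    field_simp
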